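/- Let $\{Y_i\}_{i\in\mathbb Z}$ and, for each $m\ge 1$, $\{Z_{i,m}\}_{i\in\mathbb Z}$ be (strictly) stationary real time series on one probability space. For $\lambda>0$, $\beta\ge 0$ let $k^*=k^*_m=\lfloor\lambda m^\beta\rfloor$ and $X_{i,m}=Y_i$ for $1\le i\le m+k^*$, $X_{i,m}=Z_{i,m}$ for $i>m+k^*$. Let $h:\mathbb R^2\to\mathbb R$ be measurable, and let $Y$ be a copy of $Y_1$ independent of $Y_1$ and $Z_{1,m}$, such that $\theta=\mathrm E\,h(Y,Y_1)$, $\theta_m^*=\mathrm E\,h(Y,Z_{1,m})$ exist. Put $\Delta_m=\theta_m^*-\theta$, $$h_1(s)=\mathrm E(h(s,Y_1)-\theta),\quad h_{1,m}^*(s)=\mathrm E(h(s,Z_{1,m})-\theta_m^*),\quad h_2(t)=\mathrm E(h(Y_1,t)-\theta),\quad h_{2,m}^*(t)=\mathrm E(h(Y_1,t)-\theta_m^*),$$ $$r(s,t)=h(s,t)-h_1(s)-h_2(t)-\theta,\qquad r_m^*(s,t)=h(s,t)-h_{1,m}^*(s)-h_{2,m}^*(t)-\theta_m^*,$$ $$S_{1,m}=\frac1{\sqrt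 m}\sum_{i=1}^m h_1(Y_i),\qquad S_{1,m}^*=\frac1{\sqrt m}\sum_{i=1}^m h_{1,m}^*(Y_i).$$ For a sequence of thresholds $c_m\in\mathbb R$, with $w(m,k)=\bigl(\sqrt m(1+k/m)\bigr)^{-1}$ and $\Gamma(m,k)=\frac1m\sum_{i=1}^m\sum_{j=m+1}^{m+k}(h(X_{i,m},X_{j,m})-\theta)$, let $$\kappa_m=\inf\{k>k^*:\ w(m,k)|\Gamma(m,k)|>c_m\}\in\mathbb N\cup\{\infty\},\qquad \inf\emptyset=\infty .$$ Assume the following, where "$k_m\to\infty$" means: for every sequence of natural numbers $k_m\to\infty$. 1. $\Delta_m=O(1)$ and $\sqrt m|\Delta_m|/c_m\to\infty$. 2. (i) There is $u$ with $\frac{u(m)}{m^2}(\log m)^2\to0$ and $\mathrm E\bigl|\sum_{i=1}^m\sum_{j=k_1}^{k_2}r(Y_i,Y_j)\bigr|^2\le u(m)(k_2-k_1+1)$ for all $m\ge1$, $m+1\le k_1\le k_2$. (ii) $\sup_{1\le k\le k_m}\frac1{\sqrt{k_m}}\bigl|\sum_{j=m+1}^{m+k}h_2(Y_j)\bigr|=O_P(1)$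 as $k_m\to\infty$. 3. For each $m$, the monitoring data $\{X_{m+j,m}:j\ge1\}$ is independent of $(S_{1,m},S_{1,m}^*)$. 4. (i) 2(i) holds with $r_m^*(Y_i,Z_{j,m})$ in place of $r(Y_i,Y_j)$ (possibly with another $u$). (ii) For all $0\le\alpha<\frac12$, $\sup_{1\le l\le l_m}\frac{1}{l_m^{1/2-\alpha}l^\alpha}\bigl|\sum_{j=m+k^*+1}^{m+k^*+l}h_{2,m}^*(Z_{j,m})\bigr|=O_P(1)$ as $l_m\to\infty$. 5. $m^{\beta-1}\sqrt m|\Delta_m|/c_m\to D$ for some $D\in[0,\infty]$, and: (i) if $D<\infty$, then for each $m$ the bivariate series $\{(Y_i,Z_{i,m})\}_i$ is stationary, and as $k_m\to\infty$ the processes $\frac1{\sqrt{k_m}}\sum_{j=1}^{\lfloor k_mt\rfloor}(h_2(Y_j),h_{2,m}^*(Z_{j,m}))$, $0\le t\le1$, converge weakly to a centered bivariate Wiener process $(W,W^*)$ with $\mathrm{Var}\,W(1)=\sigma^2>0$, $\mathrm{Var}\,W^*(1)=\sigma^{*2}>0$; (ii) if $D=\infty$, then as $k_m\to\infty$, $\frac1{\sqrt{k_m}}\sum_{j=1}^{k_m}h_2(Y_j)$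 converges in distribution to $N(0,\sigma^2)$ with $\sigma^2>0$, and $\sup_{1\le l\le k_m}\frac1{\sqrt{k_m}}\bigl|\sum_{j=m+k^*+1}^{m+k^*+l}h_{2,m}^*(Z_{j,m})\bigr|=O_P(1)$. 6. $S_{1,m}=O_P(1)$, $S_{1,m}^*=O_P(1)$, $\liminf_m c_m>0$ and $c_m\max(1,m^{1-\beta})\to\infty$. Let $\sigma_\infty^2=\sigma^{*2}$ if $D=0$, $\sigma_\infty^2=\frac{\lambda D}{1+\lambda D}\sigma^2+\frac1{1+\lambda D}\sigma^{*2}$ if $0<D<\infty$, $\sigma_\infty^2=\sigma^2$ if $D=\infty$. For real $s,s^*$ put $$a_m(s,s^*)=\Bigl(1-\frac{c_m}{\sqrt m|\Delta_m|}+\frac{s^*\operatorname{sign}(\Delta_m)}{\sqrt m|\Delta_m|}\Bigr)^{-1}\Bigl(k^*+k^*\frac{(s^*-s)\operatorname{sign}(\Delta_m)}{\sqrt m|\Delta_m|}+\frac{c_m\sqrt m}{|\Delta_m|}\Bigr),\qquad b_m(s,s^*)=\frac{\sqrt{a_m(s,s^*)}}{|\Delta_m|}.$$ Then, as $m\to\infty$: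 (a) For every $\beta\ge0$, $\ \dfrac{\kappa_m-a_m(S_{1,m},S_{1,m}^*)}{b_m(0,0)}\xrightarrow{D}N(0,\sigma_\infty^2)$. (b) If $\dfrac{c_m}{\sqrt m|\Delta_m|}\max\bigl(1,m^{(\beta-1)/2}\bigr)\to0$, then $\ \dfrac{\kappa_m-a_m(S_{1,m},0)}{b_m(0,0)}\xrightarrow{D}N(0,\sigma_\infty^2)$. This condition always holds for sublinear and linear changes ($\beta\le1$); for superlinear changes ($\beta>1$) it holds if and only if $c_m m^{\beta/2-1}/|\Delta_m|\to0$ (so for instance if $1<\beta<2$, $|\Delta_m|$ is bounded away from $0$ and $c_m=o(m^{1-\beta/2})$). (c) If $\beta<1$, then $\ \dfrac{\kappa_m-a_m(0,0)}{b_m(0,0)}\xrightarrow{D}N(0,\sigma_\infty^2)$. -/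

import Mathlib

open MeasureTheory ProbabilityTheory Filter Topology Asymptotics
open scoped NNReal ENNReal BoundedContinuousFunction UniformConvergence

namespace SeqUStat

/-- The data of the sequential monitoring problem. `Y i` is the time series before the change,
`Z m i` the time series after the change when the historic data set has length `m`, `h` the kernel,
`⌊lam * m ^ beta⌋` the change point and `c m` the threshold. Only time indices `i ≥ 1` matter. -/
structure Model (Ω : Type*) where
  Y : ℕ → Ω → ℝ
  Z : ℕ → ℕ → Ω → ℝ
  h : ℝ → ℝ → ℝ
  lam : ℝ
  beta : ℝ
  c : ℕ → ℝ

/-- `X_m = O_P(1)`. -/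
def BoundedInProb {Ω : Type*} [MeasurableSpace Ω] (P : Measure Ω) (X : ℕ → Ω → ℝ) : Prop :=
  ∀ ε : ℝ, 0 < ε → ∃ C : ℝ, ∀ᶠ m in atTop, P {ω | C < |X m ω|} ≤ ENNReal.ofReal ε

/-- `max_{1 ≤ k ≤ n} |f k|` (equal to `0` for `n = 0`). -/
noncomputable def maxAbs (n : ℕ) (f : ℕ → ℝ) : ℝ :=
  (((Finset.Icc 1 n).sup fun k => ‖f k‖₊ : ℝ≥0) : ℝ)

/-- Strict stationarity of a time series with values in `E`. -/
def StrictlyStationary {Ω E : Type*} [MeasurableSpace Ω] [MeasurableSpace E] (P : Measure Ω)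
    (X : ℕ → Ω → E) : Prop :=
  ∀ s : ℕ, IdentDistrib (fun ω i => X (i + s) ω) (fun ω i => X i ω) P P

/-- A centered bivariate Wiener process `(W, W*)` on `[0,1]` with `Var W(1) = σ ^ 2`,
`Var W*(1) = σs ^ 2` and arbitrary covariance `ρ` of `W(1)` and `W*(1)`. -/
structure IsBivariateWiener {Ω : Type*} [MeasurableSpace Ω] (W : Set.Icc (0 : ℝ) 1 → Ω → ℝ × ℝ)
    (Q : Measure Ω) (σ σs : ℝ≥0) : Prop where
  isGaussian : IsGaussianProcess W Q
  mean_fst : ∀ t, ∫ ω, (W t ω).1 ∂Q = 0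
  mean_snd : ∀ t, ∫ ω, (W t ω).2 ∂Q = 0
  cov_fst : ∀ s t : Set.Icc (0 : ℝ) 1,
    covariance (fun ω => (W s ω).1) (fun ω => (W t ω).1) Q = min (s : ℝ) t * (σ : ℝ) ^ 2
  cov_snd : ∀ s t : Set.Icc (0 : ℝ) 1,
    covariance (fun ω => (W s ω).2) (fun ω => (W t ω).2) Q = min (s : ℝ) t * (σs : ℝ) ^ 2
  cov_fst_snd : ∃ ρ : ℝ, ∀ s t : Set.Icc (0 : ℝ) 1,
    covariance (fun ω => (W s ω).1) (fun ω => (W t ω).2) Q = min (s : ℝ) t * ρ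
  continuous_paths : ∀ ω, Continuous fun t => W t ω

/-- The path `t ↦ n ^ (-1/2) ∑_{j = 1}^{⌊n t⌋} ξ j` on `[0,1]`, as an element of the space of
functions `[0,1] → ℝ × ℝ` with the topology of uniform convergence. -/
noncomputable def partialSumPath (n : ℕ) (ξ : ℕ → ℝ × ℝ) : Set.Icc (0 : ℝ) 1 →ᵤ ℝ × ℝ :=
  UniformFun.ofFun fun t : Set.Icc (0 : ℝ) 1 =>
    (√(n : ℝ))⁻¹ • ∑ j ∈ Finset.Icc 1 ⌊(n : ℝ) * (t : ℝ)⌋₊, ξ j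

/-- Functional central limit theorem for the row-wise partial sums of `ξ m j`, along `n m` summands:
weak convergence, for the uniform topology on paths, to a bivariate Wiener process. The limit has
continuous paths, so this is the same as weak convergence in the Skorokhod space; a functional that
is continuous for the uniform topology is a continuous function of the `n m` summands, so that all
the expectations below are expectations of genuine random variables. -/
def FunctionalCLT {Ω : Type*} [MeasurableSpace Ω] (P : Measure Ω)
    (ξ : ℕ → ℕ → Ω → ℝ × ℝ) (n : ℕ → ℕ) (σ σs : ℝ≥0) : Prop :=
  ∃ (Ω' : Type) (_ : MeasurableSpace Ω') (Q : Measure Ω') (_ : IsProbabilityMeasure Q)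
    (W : Set.Icc (0 : ℝ) 1 → Ω' → ℝ × ℝ), IsBivariateWiener W Q σ σs ∧
    ∀ F : (Set.Icc (0 : ℝ) 1 →ᵤ ℝ × ℝ) →ᵇ ℝ,
      Tendsto (fun m => ∫ ω, F (partialSumPath (n m) fun j => ξ m j ω) ∂P) atTop
        (𝓝 (∫ ω, F (UniformFun.ofFun fun t => W t ω) ∂Q))

/-- The limiting variance `σ_∞ ^ 2`, where `D ∈ [0, ∞]` is the limit of
`m ^ (β - 1) * √m * |Δ_m| / c_m`. -/
noncomputable def limitVariance (lam : ℝ) (σ σs : ℝ≥0) (D : ℝ≥0∞) : ℝ≥0 :=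
  if D = 0 then σs ^ 2
  else if D = ⊤ then σ ^ 2
  else (lam * D.toReal / (1 + lam * D.toReal)).toNNReal * σ ^ 2
    + (1 / (1 + lam * D.toReal)).toNNReal * σs ^ 2

/-- The weight function: `w(m,k) = (√m (1 + k / m))⁻¹`. -/
noncomputable def weight (m k : ℕ) : ℝ := (√(m : ℝ) * (1 + (k : ℝ) / (m : ℝ)))⁻¹

namespace Model

section

variable {Ω : Type*} (M : Model Ω)

/-- The change point `k*`. -/
noncomputable def kstar (m : ℕ) : ℕ := ⌊M.lam * (m : ℝ) ^ M.beta⌋₊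

/-- The observations `X_{i,m}`. -/
noncomputable def X (m i : ℕ) (ω : Ω) : ℝ :=
  if i ≤ M.kstar m + m then M.Y i ω else M.Z m i ω

end

section

variable {Ω : Type*} [MeasurableSpace Ω] (P : Measure Ω) (M : Model Ω)

/-- `θ = E h(Y, Y_1)` with `Y` an independent copy of `Y_1`. -/
noncomputable def theta : ℝ :=
  ∫ p, M.h p.1 p.2 ∂((P.map (M.Y 1)).prod (P.map (M.Y 1)))

/-- `θ*_m = E h(Y, Z_{1,m})` with `Y` a copy of `Y_1` that is independent of `Z_{1,m}`. -/
noncomputable def thetaStar (m : ℕ) : ℝ :=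
  ∫ p, M.h p.1 p.2 ∂((P.map (M.Y 1)).prod (P.map (M.Z m 1)))

/-- The magnitude of the change `Δ_m`. -/
noncomputable def Delta (m : ℕ) : ℝ := M.thetaStar P m - M.theta P

noncomputable def h1 (s : ℝ) : ℝ := ∫ ω, (M.h s (M.Y 1 ω) - M.theta P) ∂P

noncomputable def h1Star (m : ℕ) (s : ℝ) : ℝ := ∫ ω, (M.h s (M.Z m 1 ω) - M.thetaStar P m) ∂P

noncomputable def h2 (t : ℝ) : ℝ := ∫ ω, (M.h (M.Y 1 ω) t - M.theta P) ∂P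

noncomputable def h2Star (m : ℕ) (t : ℝ) : ℝ := ∫ ω, (M.h (M.Y 1 ω) t - M.thetaStar P m) ∂P

noncomputable def r (s t : ℝ) : ℝ := M.h s t - M.h1 P s - M.h2 P t - M.theta P

noncomputable def rStar (m : ℕ) (s t : ℝ) : ℝ :=
  M.h s t - M.h1Star P m s - M.h2Star P m t - M.thetaStar P m

/-- The historic part `S_{1,m}`. -/
noncomputable def S1 (m : ℕ) (ω : Ω) : ℝ :=
  (√(m : ℝ))⁻¹ * ∑ i ∈ Finset.Icc 1 m, M.h1 P (M.Y i ω)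

/-- The historic part `S*_{1,m}`. -/
noncomputable def S1Star (m : ℕ) (ω : Ω) : ℝ :=
  (√(m : ℝ))⁻¹ * ∑ i ∈ Finset.Icc 1 m, M.h1Star P m (M.Y i ω)

/-- The monitoring statistic `Γ(m,k)`. -/
noncomputable def Gam (m k : ℕ) (ω : Ω) : ℝ :=
  (m : ℝ)⁻¹ * ∑ i ∈ Finset.Icc 1 m, ∑ j ∈ Finset.Icc (m + 1) (m + k),
    (M.h (M.X m i ω) (M.X m j ω) - M.theta P)

/-- The delay time `κ_m = inf {k > k* : w(m,k) |Γ(m,k)| > c_m}`, with `inf ∅ = ∞`. -/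
noncomputable def kappa (m : ℕ) (ω : Ω) : ℕ∞ :=
  sInf ((fun k : ℕ => (k : ℕ∞)) '' {k | M.kstar m < k ∧ M.c m < weight m k * |M.Gam P m k ω|})

/-- The standardizing sequence `a_m(s, s*)`. -/
noncomputable def a (m : ℕ) (s sStar : ℝ) : ℝ :=
  (1 - M.c m / (√(m : ℝ) * |M.Delta P m|)
      + sStar * Real.sign (M.Delta P m) / (√(m : ℝ) * |M.Delta P m|))⁻¹
    * (M.kstar m
      + M.kstar m * ((sStar - s) * Real.sign (M.Delta P m) / (√(m : ℝ) * |M.Delta P m|))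
      + M.c m * √(m : ℝ) / |M.Delta P m|)

/-- The standardizing sequence `b_m(s, s*)`. -/
noncomputable def b (m : ℕ) (s sStar : ℝ) : ℝ := √(M.a P m s sStar) / |M.Delta P m|

/-- The delay time centered at `A m` and scaled by `b_m(0,0)`; it takes the value `+∞` where
`κ_m = ∞` (as soon as `b_m(0,0) > 0`). -/
noncomputable def standardizedDelay (A : ℕ → Ω → ℝ) (m : ℕ) (ω : Ω) : EReal :=
  (((M.kappa P m ω : ℝ≥0∞) : EReal) - (A m ω : EReal)) / (M.b P m 0 0 : EReal)

/-- `(κ_m - A m) / b_m(0,0)` converges in distribution to `N(0, v)`. -/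
def DelayTendstoNormal [IsProbabilityMeasure P] (A : ℕ → Ω → ℝ) (v : ℝ≥0) : Prop :=
  TendstoInDistribution (M.standardizedDelay P A) atTop (fun x : ℝ => (x : EReal)) (fun _ => P)
    (gaussianReal 0 v)

/-- The standing conventions: `λ > 0`, `β ≥ 0`, measurability, (marginal) stationarity of the time
series before and after the change, and existence of the expectations `θ` and `θ*_m`. -/
structure Standing : Prop where
  lam_pos : 0 < M.lam
  beta_nonneg : 0 ≤ M.beta
  measurable_h : Measurable (Function.uncurry M.h)
  measurable_Y : ∀ i, Measurable (M.Y i)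
  measurable_Z : ∀ m i, Measurable (M.Z m i)
  stationary_Y : StrictlyStationary P M.Y
  stationary_Z : ∀ m, 1 ≤ m → StrictlyStationary P (M.Z m)
  integrable_theta :
    Integrable (Function.uncurry M.h) ((P.map (M.Y 1)).prod (P.map (M.Y 1)))
  integrable_thetaStar : ∀ m, 1 ≤ m →
    Integrable (Function.uncurry M.h) ((P.map (M.Y 1)).prod (P.map (M.Z m 1)))

/-- The magnitude of the change is bounded, and large enough to be detectable. -/
structure ChangeAssumption : Prop where
  bounded : M.Delta P =O[atTop] fun _ => (1 : ℝ)
  detectable : Tendsto (fun m : ℕ => √(m : ℝ) * |M.Delta P m| / M.c m) atTop atTop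

/-- Assumptions on the time series before the change. -/
structure RegularityAssumption : Prop where
  remainder : ∃ u : ℕ → ℝ,
    Tendsto (fun m : ℕ => u m / (m : ℝ) ^ 2 * Real.log m ^ 2) atTop (𝓝 0) ∧
    ∀ m k₁ k₂ : ℕ, 1 ≤ m → m + 1 ≤ k₁ → k₁ ≤ k₂ →
      ∫⁻ ω, ENNReal.ofReal
          ((∑ i ∈ Finset.Icc 1 m, ∑ j ∈ Finset.Icc k₁ k₂, M.r P (M.Y i ω) (M.Y j ω)) ^ 2) ∂P
        ≤ ENNReal.ofReal (u m * ((k₂ : ℝ) - k₁ + 1))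
  maximal : ∀ k : ℕ → ℕ, Tendsto k atTop atTop →
    BoundedInProb P fun m ω =>
      maxAbs (k m) fun l => (√(k m : ℝ))⁻¹ * ∑ j ∈ Finset.Icc (m + 1) (m + l), M.h2 P (M.Y j ω)

/-- The monitoring data set is independent of the historic quantities `S_{1,m}`, `S*_{1,m}`. -/
def IndependenceAssumption : Prop :=
  ∀ m, 1 ≤ m →
    IndepFun (fun ω (j : ℕ) => M.X m (m + 1 + j) ω) (fun ω => (M.S1 P m ω, M.S1Star P m ω)) P

/-- Assumptions on the time series after the change; `D ∈ [0, ∞]` is the limit of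
`m ^ (β - 1) * √m * |Δ_m| / c_m`, and `σ`, `σs` are the long-run standard deviations. -/
structure StoppingAssumption [IsProbabilityMeasure P] (σ σs : ℝ≥0) (D : ℝ≥0∞) : Prop where
  remainder : ∃ u : ℕ → ℝ,
    Tendsto (fun m : ℕ => u m / (m : ℝ) ^ 2 * Real.log m ^ 2) atTop (𝓝 0) ∧
    ∀ m k₁ k₂ : ℕ, 1 ≤ m → m + 1 ≤ k₁ → k₁ ≤ k₂ →
      ∫⁻ ω, ENNReal.ofReal
          ((∑ i ∈ Finset.Icc 1 m, ∑ j ∈ Finset.Icc k₁ k₂,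
            M.rStar P m (M.Y i ω) (M.Z m j ω)) ^ 2) ∂P
        ≤ ENNReal.ofReal (u m * ((k₂ : ℝ) - k₁ + 1))
  hajekRenyi : ∀ α : ℝ, 0 ≤ α → α < 1 / 2 → ∀ l : ℕ → ℕ, Tendsto l atTop atTop →
    BoundedInProb P fun m ω =>
      maxAbs (l m) fun k => ((l m : ℝ) ^ (1 / 2 - α) * (k : ℝ) ^ α)⁻¹ *
        ∑ j ∈ Finset.Icc (m + M.kstar m + 1) (m + M.kstar m + k), M.h2Star P m (M.Z m j ω)
  limit_D : Tendsto
    (fun m : ℕ => ENNReal.ofReal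
      ((m : ℝ) ^ (M.beta - 1) * (√(m : ℝ) * |M.Delta P m| / M.c m))) atTop (𝓝 D)
  veryEarly : D ≠ ⊤ → 0 < σ ∧ 0 < σs ∧
    (∀ m, 1 ≤ m → StrictlyStationary P fun i ω => (M.Y i ω, M.Z m i ω)) ∧
    ∀ k : ℕ → ℕ, Tendsto k atTop atTop →
      FunctionalCLT P (fun m j ω => (M.h2 P (M.Y j ω), M.h2Star P m (M.Z m j ω))) k σ σs
  later : D = ⊤ → 0 < σ ∧
    (∀ k : ℕ → ℕ, Tendsto k atTop atTop →
      TendstoInDistribution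
        (fun m ω => (√(k m : ℝ))⁻¹ * ∑ j ∈ Finset.Icc 1 (k m), M.h2 P (M.Y j ω)) atTop
        (fun x : ℝ => x) (fun _ => P) (gaussianReal 0 (σ ^ 2))) ∧
    ∀ k : ℕ → ℕ, Tendsto k atTop atTop →
      BoundedInProb P fun m ω =>
        maxAbs (k m) fun l => (√(k m : ℝ))⁻¹ *
          ∑ j ∈ Finset.Icc (m + M.kstar m + 1) (m + M.kstar m + l), M.h2Star P m (M.Z m j ω)

/-- Stochastic boundedness of the historic parts, and the growth of the threshold; the field
`threshold_lower` is `liminf c_m > 0`. -/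
structure ThresholdAssumption : Prop where
  S1_bounded : BoundedInProb P (M.S1 P)
  S1Star_bounded : BoundedInProb P (M.S1Star P)
  threshold_lower : ∃ ε : ℝ, 0 < ε ∧ ∀ᶠ m in atTop, ε ≤ M.c m
  threshold_growth : Tendsto (fun m : ℕ => M.c m * max 1 ((m : ℝ) ^ (1 - M.beta))) atTop atTop

/-- The condition `c_m / (√m |Δ_m|) * max(1, m ^ ((β - 1) / 2)) → 0`. -/
def NotTooLate : Prop :=
  Tendsto (fun m : ℕ => M.c m / (√(m : ℝ) * |M.Delta P m|) * max 1 ((m : ℝ) ^ ((M.beta - 1) / 2)))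
    atTop (𝓝 0)

end

end Model

end SeqUStat

/-! For k > k*, Hoeffding's decomposition turns the detector into an affine function of k plus noise
(`Model.Gam_eq`, `Model.sign_mul_Gam_eq`). Namely, sign(Δ_m) Γ(m,k) is the sum of the threshold c_m
/ w(m,k), the drift q_m |Δ_m| (k - a_m(S_1, S_1*)), the linear sums of h_2 and h_2* times sign(Δ_m),
and a degenerate remainder. The slope q_m tends to 1 in probability, and a_m(S_1, S_1*) is exactly
the point where the noiseless detector meets the threshold. Near a_m the noise has order √a_m and
the drift gains about |Δ_m| per step, so the noise displaces the crossing by order b_m = √a_m /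
|Δ_m|. Thus (κ_m - a_m) / b_m should be close to `Model.noise`, the negative of the signed linear
sums at a_m divided by √a_m.

Three facts make this rigorous. The remainder is negligible by a Rademacher–Menshov inequality,
whose squared logarithm costs only log² m because the horizon 2 a_m is polynomial in m
(`Model.ThresholdAssumption.vanish_remainder`). The noise is almost constant on a window around a_m
whose relative radius tends to 0 but whose length is large compared with b_m; to the left of this
window the drift outweighs any noise. Finally, the threshold of the opposite sign is out of reach,
since c_m (m + k*) dominates both k* and √(m a_m) (`Model.neg_threshold_le`). Given these facts,
locating the first crossing is the deterministic lemma `exists_first_crossing`;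
`Model.delayApprox_a` collects the bad events.

For the limit law, k* / a_m → τ with τ determined by λ and D. Up to sign, the noise is therefore a
normalized sum of about a_m terms, a fraction τ from h_2(Y) and the rest from h_2*(Z). After a shift
by stationarity, the functional limit theorem gives W(τ) + W*(1) - W*(τ) when D < ∞. Its variance is
τσ² + (1 - τ)σ*², because increments over disjoint time intervals are uncorrelated, whatever the
covariance of W and W* is. For D = ∞, τ = 1 and the ordinary limit theorem for h_2(Y) suffices. In
(b) and (c), replacing S_1* and then S_1 by 0 moves a_m by o_P(b_m). -/

namespace SeqUStat

/-! ### Maxima of partial sums over windows of indices. -/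

section MaxAbs

lemma maxAbs_nonneg (n : ℕ) (f : ℕ → ℝ) : 0 ≤ maxAbs n f := NNReal.coe_nonneg _

lemma abs_le_maxAbs {n k : ℕ} (f : ℕ → ℝ) (h1 : 1 ≤ k) (hk : k ≤ n) : |f k| ≤ maxAbs n f := by
  have : ‖f k‖₊ ≤ (Finset.Icc 1 n).sup fun k => ‖f k‖₊ :=
    Finset.le_sup (f := fun k => ‖f k‖₊) (Finset.mem_Icc.2 ⟨h1, hk⟩)
  exact_mod_cast this

lemma maxAbs_le {n : ℕ} {f : ℕ → ℝ} {C : ℝ} (hC : 0 ≤ C) (h : ∀ k, 1 ≤ k → k ≤ n → |f k| ≤ C) :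
    maxAbs n f ≤ C := by
  lift C to ℝ≥0 using hC
  unfold maxAbs
  rw [NNReal.coe_le_coe, Finset.sup_le_iff]
  intro k hk
  rw [Finset.mem_Icc] at hk
  exact_mod_cast h k hk.1 hk.2

lemma maxAbs_const_mul (n : ℕ) (c : ℝ) (f : ℕ → ℝ) :
    maxAbs n (fun k => c * f k) = |c| * maxAbs n f := by
  unfold maxAbs
  simp_rw [nnnorm_mul]
  rw [← NNReal.mul_finset_sup]
  simp

lemma measurable_maxAbs {Ω : Type*} [MeasurableSpace Ω] (n : ℕ) {f : ℕ → Ω → ℝ}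
    (hf : ∀ k, Measurable (f k)) : Measurable fun ω => maxAbs n (fun k => f k ω) := by
  unfold maxAbs
  refine Measurable.coe_nnreal_real ?_
  induction (Finset.Icc 1 n) using Finset.induction_on with
  | empty => simp
  | insert a s ha ih =>
    simp_rw [Finset.sup_insert]
    exact (hf a).nnnorm.sup ih

/-- `max_{1 ≤ l ≤ L} |∑_{j = s + 1}^{s + l} ξ j|`. -/
noncomputable def windowMax (ξ : ℕ → ℝ) (s L : ℕ) : ℝ :=
  maxAbs L fun l => ∑ j ∈ Finset.Icc (s + 1) (s + l), ξ j

lemma windowMax_nonneg (ξ : ℕ → ℝ) (s L : ℕ) : 0 ≤ windowMax ξ s L := maxAbs_nonneg _ _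

lemma abs_sum_le_windowMax (ξ : ℕ → ℝ) {s k L : ℕ} (h : k ≤ s + L) :
    |∑ j ∈ Finset.Icc (s + 1) k, ξ j| ≤ windowMax ξ s L := by
  rcases Nat.lt_or_ge s k with hk | hk
  · obtain ⟨l, rfl⟩ := Nat.exists_eq_add_of_lt hk
    exact abs_le_maxAbs (fun l => ∑ j ∈ Finset.Icc (s + 1) (s + l), ξ j) (k := l + 1)
      (by omega) (by omega)
  · rw [Finset.Icc_eq_empty (by omega)]
    simpa using windowMax_nonneg ξ s L

lemma sum_Icc_split (ξ : ℕ → ℝ) {s e k : ℕ} (h1 : s ≤ e) (h2 : e ≤ k) :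
    ∑ j ∈ Finset.Icc (s + 1) k, ξ j
      = ∑ j ∈ Finset.Icc (s + 1) e, ξ j + ∑ j ∈ Finset.Icc (e + 1) k, ξ j := by
  have h : ∀ a b : ℕ, Finset.Icc (a + 1) b = Finset.Ioc a b := fun a b => by
    ext x; simp
  rw [h, h, h, Finset.sum_Ioc_consecutive _ h1 h2]

/-- Both sums share the part up to s, which cancels; each of the two rests is a partial sum over the
window after s. -/
lemma abs_sum_sub_sum_le_windowMax (ξ : ℕ → ℝ) {s₀ s k k' L : ℕ} (h0 : s₀ ≤ s) (h1 : s ≤ k)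
    (h2 : s ≤ k') (hk : k ≤ s + L) (hk' : k' ≤ s + L) :
    |∑ j ∈ Finset.Icc (s₀ + 1) k, ξ j - ∑ j ∈ Finset.Icc (s₀ + 1) k', ξ j|
      ≤ 2 * windowMax ξ s L := by
  rw [sum_Icc_split ξ h0 h1, sum_Icc_split ξ h0 h2]
  have e1 := abs_sum_le_windowMax ξ hk
  have e2 := abs_sum_le_windowMax ξ hk'
  rw [abs_le] at *
  constructor <;> linarith [e1.1, e1.2, e2.1, e2.2]

lemma measurable_windowMax {Ω : Type*} [MeasurableSpace Ω] {ξ : ℕ → Ω → ℝ}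
    (hξ : ∀ k, Measurable (ξ k)) (s L : ℕ) :
    Measurable fun ω => windowMax (fun j => ξ j ω) s L :=
  measurable_maxAbs L fun _ => Finset.measurable_sum _ fun j _ => hξ j

lemma sum_Icc_shift {E : Type*} [AddCommMonoid E] (ξ : ℕ → E) (s a k : ℕ) :
    ∑ j ∈ Finset.Icc (s + a + 1) (s + k), ξ j = ∑ j ∈ Finset.Icc (a + 1) k, ξ (j + s) := by
  have h := Finset.sum_map (Finset.Icc (a + 1) k) (addRightEmbedding s) ξ
  rw [Finset.map_add_right_Icc] at h
  rw [show s + a + 1 = a + 1 + s by omega, add_comm s k, h]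
  rfl

lemma windowMax_shift (ξ : ℕ → ℝ) (s L : ℕ) :
    windowMax ξ s L = windowMax (fun j => ξ (j + s)) 0 L := by
  unfold windowMax
  congr 1
  ext l
  simpa using sum_Icc_shift ξ s 0 l

end MaxAbs

/-! ### Stochastic orders and stationarity. -/

section Prob

variable {Ω : Type*} [MeasurableSpace Ω] {P : Measure Ω}

/-- `X_m = o_P(1)`. -/
def VanishInProb (P : Measure Ω) (X : ℕ → Ω → ℝ) : Prop :=
  ∀ η : ℝ, 0 < η → Tendsto (fun m => P {ω | η < |X m ω|}) atTop (𝓝 0)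

lemma tendsto_zero_of_forall_eventually_le {p : ℕ → ℝ≥0∞}
    (h : ∀ ε : ℝ, 0 < ε → ∀ᶠ m in atTop, p m ≤ ENNReal.ofReal ε) : Tendsto p atTop (𝓝 0) := by
  rw [ENNReal.tendsto_nhds_zero]
  intro ε hε
  rcases eq_or_ne ε ⊤ with rfl | hε'
  · simp
  · have := h ε.toReal (ENNReal.toReal_pos hε.ne' hε')
    simpa [ENNReal.ofReal_toReal hε'] using this

lemma eventually_le_of_tendsto_zero {p : ℕ → ℝ≥0∞} (h : Tendsto p atTop (𝓝 0)) {ε : ℝ}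
    (hε : 0 < ε) : ∀ᶠ m in atTop, p m ≤ ENNReal.ofReal ε :=
  ENNReal.tendsto_nhds_zero.1 h _ (ENNReal.ofReal_pos.2 hε)

lemma VanishInProb.mono {X Y : ℕ → Ω → ℝ} (h : VanishInProb P X)
    (hXY : ∀ᶠ m in atTop, ∀ ω, |Y m ω| ≤ |X m ω|) : VanishInProb P Y := by
  intro η hη
  refine tendsto_of_tendsto_of_tendsto_of_le_of_le' tendsto_const_nhds (h η hη)
    (Eventually.of_forall fun _ => zero_le) ?_
  filter_upwards [hXY] with m hm
  exact measure_mono fun ω (hω : η < |Y m ω|) => hω.trans_le (hm ω)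

lemma BoundedInProb.mono {X Y : ℕ → Ω → ℝ} (h : BoundedInProb P X)
    (hXY : ∀ᶠ m in atTop, ∀ ω, |Y m ω| ≤ |X m ω|) : BoundedInProb P Y := by
  intro ε hε
  obtain ⟨C, hC⟩ := h ε hε
  refine ⟨C, ?_⟩
  filter_upwards [hXY, hC] with m hm hm'
  exact (measure_mono fun ω (hω : C < |Y m ω|) => hω.trans_le (hm ω)).trans hm'

lemma BoundedInProb.exists_pos {X : ℕ → Ω → ℝ} (h : BoundedInProb P X) {ε : ℝ} (hε : 0 < ε) :
    ∃ C : ℝ, 0 < C ∧ ∀ᶠ m in atTop, P {ω | C < |X m ω|} ≤ ENNReal.ofReal ε := by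
  obtain ⟨C, hC⟩ := h ε hε
  refine ⟨max C 1, by positivity, ?_⟩
  filter_upwards [hC] with m hm
  exact (measure_mono fun ω (hω : max C 1 < |X m ω|) => (le_max_left _ _).trans_lt hω).trans hm

lemma BoundedInProb.vanish_mul {X : ℕ → Ω → ℝ} (h : BoundedInProb P X) {t : ℕ → ℝ}
    (ht : Tendsto t atTop (𝓝 0)) : VanishInProb P fun m ω => t m * X m ω := by
  intro η hη
  refine tendsto_zero_of_forall_eventually_le fun ε hε => ?_
  obtain ⟨C, hC0, hC⟩ := h.exists_pos hε
  have ht' : ∀ᶠ m in atTop, |t m| < η / C :=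
    (ht.abs.eventually_lt_const (by simpa using div_pos hη hC0))
  filter_upwards [hC, ht'] with m hm htm
  refine (measure_mono fun ω (hω : η < |t m * X m ω|) => ?_).trans hm
  by_contra hlt
  have hlt : |X m ω| ≤ C := not_lt.1 hlt
  rw [abs_mul] at hω
  have : |t m| * |X m ω| ≤ η / C * C := by gcongr
  rw [div_mul_cancel₀ _ hC0.ne'] at this
  linarith

lemma BoundedInProb.add {X Y : ℕ → Ω → ℝ} (hX : BoundedInProb P X) (hY : BoundedInProb P Y) :
    BoundedInProb P fun m ω => X m ω + Y m ω := by
  intro ε hε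
  obtain ⟨C, hC⟩ := hX (ε / 2) (by positivity)
  obtain ⟨C', hC'⟩ := hY (ε / 2) (by positivity)
  refine ⟨C + C', ?_⟩
  filter_upwards [hC, hC'] with m h1 h2
  calc P {ω | C + C' < |X m ω + Y m ω|}
      ≤ P ({ω | C < |X m ω|} ∪ {ω | C' < |Y m ω|}) := by
        refine measure_mono fun ω (hω : C + C' < |X m ω + Y m ω|) => ?_
        by_contra hc
        simp only [Set.mem_union, Set.mem_ofPred_eq, not_or, not_lt] at hc
        linarith [abs_add_le (X m ω) (Y m ω)]
    _ ≤ ENNReal.ofReal (ε / 2) + ENNReal.ofReal (ε / 2) :=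
        (measure_union_le _ _).trans (add_le_add h1 h2)
    _ = ENNReal.ofReal ε := by
        rw [← ENNReal.ofReal_add (by positivity) (by positivity), add_halves]

/-- By stationarity the maximum of partial sums has the same law for every starting point. -/
lemma StrictlyStationary.measure_windowMax {E : Type*} [MeasurableSpace E] {X : ℕ → Ω → E}
    (hX : StrictlyStationary P X) {f : E → ℝ} (hf : Measurable f) (C : ℝ) (s s' L : ℕ) :
    P {ω | C < windowMax (fun j => f (X j ω)) s L}
      = P {ω | C < windowMax (fun j => f (X j ω)) s' L} := by
  have key : ∀ s, P {ω | C < windowMax (fun j => f (X j ω)) s L}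
      = P {ω | C < windowMax (fun j => f (X j ω)) 0 L} := by
    intro s
    -- The event depends on the whole path only through a measurable functional, so equality of the
    -- laws of the shifted and unshifted series transfers it.
    have hm : MeasurableSet {x : ℕ → E | C < windowMax (fun j => f (x j)) 0 L} :=
      measurableSet_lt measurable_const
        (measurable_windowMax (fun k => hf.comp (measurable_pi_apply k)) 0 L)
    have := (hX s).measure_mem_eq hm
    simpa [windowMax_shift _ s L] using this
  rw [key s, key s']

/-- If the maxima over windows are stochastically bounded for one choice of starting points, then
they are for every choice. -/
lemma boundedInProb_windowMax_of_stationary {X : ℕ → ℕ → Ω → ℝ}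
    (hX : ∀ᶠ m in atTop, StrictlyStationary P (X m)) {f : ℕ → ℝ → ℝ}
    (hf : ∀ m, Measurable (f m)) {s : ℕ → ℕ} {L : ℕ → ℕ}
    (h : BoundedInProb P fun m ω => (√(L m : ℝ))⁻¹ * windowMax (fun j => f m (X m j ω)) (s m) (L m))
    (s' : ℕ → ℕ) :
    BoundedInProb P fun m ω =>
      (√(L m : ℝ))⁻¹ * windowMax (fun j => f m (X m j ω)) (s' m) (L m) := by
  intro ε hε
  obtain ⟨C, hC0, hC⟩ := h.exists_pos hε
  refine ⟨C, ?_⟩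
  filter_upwards [hC, hX] with m hm hXm
  refine le_of_eq_of_le ?_ hm
  rcases Nat.eq_zero_or_pos (L m) with h0 | h0
  · simp [h0]
  have hpos : 0 < √(L m : ℝ) := Real.sqrt_pos.2 (by exact_mod_cast h0)
  have e : ∀ x : ℝ, 0 ≤ x → (C < |(√(L m : ℝ))⁻¹ * x| ↔ √(L m : ℝ) * C < x) := by
    intro x hx
    rw [abs_of_nonneg (by positivity), inv_mul_eq_div, lt_div_iff₀ hpos, mul_comm]
  simp_rw [e _ (windowMax_nonneg _ _ _)]
  exact hXm.measure_windowMax (hf m) _ _ _ _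

/-- Measure of a union of bad events. -/
lemma eventually_measure_union_le {A B : ℕ → Set Ω} {ε ε' : ℝ} (h0 : 0 ≤ ε) (h0' : 0 ≤ ε')
    (hA : ∀ᶠ m in atTop, P (A m) ≤ ENNReal.ofReal ε)
    (hB : ∀ᶠ m in atTop, P (B m) ≤ ENNReal.ofReal ε') :
    ∀ᶠ m in atTop, P (A m ∪ B m) ≤ ENNReal.ofReal (ε + ε') := by
  filter_upwards [hA, hB] with m h1 h2
  rw [ENNReal.ofReal_add h0 h0']
  exact (measure_union_le _ _).trans (add_le_add h1 h2)

end Prob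

/-! ### A maximal inequality from second moments of block sums. -/

section RademacherMenshov

variable {Ω : Type*} [MeasurableSpace Ω] {P : Measure Ω}

/-- A partial sum ending in the second half is the full first block plus a partial sum of the
second. Bounding the maximum of two squares by their sum gives the recursion behind the dyadic
induction; t weighs the mixed term and is free. -/
lemma windowMax_add_sq_le (ξ : ℕ → ℝ) (s L : ℕ) {t : ℝ} (ht : 0 < t) :
    windowMax ξ s (L + L) ^ 2 ≤ windowMax ξ s L ^ 2 + ((1 + t) * windowMax ξ (s + L) L ^ 2
      + (1 + 1 / t) * (∑ j ∈ Finset.Icc (s + 1) (s + L), ξ j) ^ 2) := by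
  set A := windowMax ξ s L
  set B := windowMax ξ (s + L) L
  set S := ∑ j ∈ Finset.Icc (s + 1) (s + L), ξ j
  have hBS : (|S| + B) ^ 2 ≤ (1 + t) * B ^ 2 + (1 + 1 / t) * S ^ 2 := by
    have h1 : 0 ≤ (t * B - |S|) ^ 2 / t := by positivity
    have h2 : (1 + t) * B ^ 2 + (1 + 1 / t) * |S| ^ 2 - (|S| + B) ^ 2
        = (t * B - |S|) ^ 2 / t := by
      field_simp; ring
    rw [sq_abs] at h2
    linarith
  have hle : windowMax ξ s (L + L) ≤ √(A ^ 2 + ((1 + t) * B ^ 2 + (1 + 1 / t) * S ^ 2)) := by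
    refine maxAbs_le (Real.sqrt_nonneg _) fun l h1 h2 => Real.le_sqrt_of_sq_le ?_
    rcases le_total l L with hl | hl
    · have : |∑ j ∈ Finset.Icc (s + 1) (s + l), ξ j| ≤ A := abs_sum_le_windowMax ξ (by omega)
      have h3 : |∑ j ∈ Finset.Icc (s + 1) (s + l), ξ j| ^ 2 ≤ A ^ 2 := by gcongr
      have : 0 ≤ (|S| + B) ^ 2 := by positivity
      linarith
    · have h3 : |∑ j ∈ Finset.Icc (s + L + 1) (s + l), ξ j| ≤ B :=
        abs_sum_le_windowMax ξ (by omega)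
      have h4 : |∑ j ∈ Finset.Icc (s + 1) (s + l), ξ j| ≤ |S| + B := by
        rw [sum_Icc_split ξ (show s ≤ s + L by omega) (show s + L ≤ s + l by omega)]
        exact (abs_add_le _ _).trans (by gcongr)
      have h5 : |∑ j ∈ Finset.Icc (s + 1) (s + l), ξ j| ^ 2 ≤ (|S| + B) ^ 2 := by gcongr
      nlinarith [sq_nonneg A]
  have := windowMax_nonneg ξ s (L + L)
  calc windowMax ξ s (L + L) ^ 2
      ≤ (√(A ^ 2 + ((1 + t) * B ^ 2 + (1 + 1 / t) * S ^ 2))) ^ 2 := by gcongr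
    _ = _ := Real.sq_sqrt (by positivity)

/-- The Rademacher–Menshov maximal inequality over dyadic windows. -/
lemma lintegral_windowMax_sq_le {ξ : ℕ → Ω → ℝ} (hξ : ∀ j, Measurable (ξ j)) {u : ℝ} (hu : 0 ≤ u)
    {s₀ : ℕ} (h : ∀ k₁ k₂, s₀ + 1 ≤ k₁ → k₁ ≤ k₂ →
      ∫⁻ ω, ENNReal.ofReal ((∑ j ∈ Finset.Icc k₁ k₂, ξ j ω) ^ 2) ∂P
        ≤ ENNReal.ofReal (u * ((k₂ : ℝ) - k₁ + 1))) (p : ℕ) :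
    ∀ s, s₀ ≤ s → ∫⁻ ω, ENNReal.ofReal (windowMax (fun j => ξ j ω) s (2 ^ p) ^ 2) ∂P
      ≤ ENNReal.ofReal (u * 2 ^ p * ((p : ℝ) + 1) ^ 2) := by
  induction p with
  | zero =>
    intro s hs
    have h1 := h (s + 1) (s + 1) (by omega) le_rfl
    have e : ∀ ω, windowMax (fun j => ξ j ω) s (2 ^ 0) ^ 2 = (ξ (s + 1) ω) ^ 2 := by
      intro ω
      simp [windowMax, maxAbs]
    simp_rw [e]
    simpa using h1
  | succ p ih =>
    intro s hs
    -- The weight t = 1/(p+1) keeps the growth quadratic in p: in units of u 2^p the recursion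
    -- produces 2(p+1)² + (p+1) + (p+2), which is at most 2(p+2)².
    have ht : (0 : ℝ) < 1 / ((p : ℝ) + 1) := by positivity
    have hb := h (s + 1) (s + 2 ^ p) (by omega) (by have := Nat.one_le_two_pow (n := p); omega)
    have hmS : Measurable fun ω => ∑ j ∈ Finset.Icc (s + 1) (s + 2 ^ p), ξ j ω :=
      Finset.measurable_sum _ fun j _ => hξ j
    calc ∫⁻ ω, ENNReal.ofReal (windowMax (fun j => ξ j ω) s (2 ^ (p + 1)) ^ 2) ∂P
        ≤ ∫⁻ ω, (ENNReal.ofReal (windowMax (fun j => ξ j ω) s (2 ^ p) ^ 2)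
            + (ENNReal.ofReal (1 + 1 / ((p : ℝ) + 1))
                * ENNReal.ofReal (windowMax (fun j => ξ j ω) (s + 2 ^ p) (2 ^ p) ^ 2)
              + ENNReal.ofReal (1 + 1 / (1 / ((p : ℝ) + 1)))
                * ENNReal.ofReal ((∑ j ∈ Finset.Icc (s + 1) (s + 2 ^ p), ξ j ω) ^ 2))) ∂P := by
          refine lintegral_mono fun ω => ?_
          rw [← ENNReal.ofReal_mul (by positivity), ← ENNReal.ofReal_mul (by positivity),
            ← ENNReal.ofReal_add (by positivity) (by positivity),
            ← ENNReal.ofReal_add (by positivity) (by positivity)]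
          refine ENNReal.ofReal_le_ofReal ?_
          rw [show 2 ^ (p + 1) = 2 ^ p + 2 ^ p by ring]
          exact windowMax_add_sq_le _ _ _ ht
      _ ≤ ENNReal.ofReal (u * 2 ^ p * ((p : ℝ) + 1) ^ 2)
            + (ENNReal.ofReal (1 + 1 / ((p : ℝ) + 1))
                * ENNReal.ofReal (u * 2 ^ p * ((p : ℝ) + 1) ^ 2)
              + ENNReal.ofReal (1 + 1 / (1 / ((p : ℝ) + 1))) * ENNReal.ofReal (u * 2 ^ p)) := by
          have m1 := measurable_windowMax hξ s (2 ^ p)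
          have m2 := measurable_windowMax hξ (s + 2 ^ p) (2 ^ p)
          rw [lintegral_add_left (by fun_prop), lintegral_add_left (by fun_prop),
            lintegral_const_mul _ (by fun_prop), lintegral_const_mul _ (by fun_prop)]
          gcongr
          · exact ih s hs
          · exact ih _ (hs.trans (Nat.le_add_right _ _))
          · refine hb.trans_eq ?_
            push_cast
            congr 1
            ring
      _ ≤ ENNReal.ofReal (u * 2 ^ (p + 1) * (((p + 1 : ℕ) : ℝ) + 1) ^ 2) := by
          rw [← ENNReal.ofReal_mul (by positivity), ← ENNReal.ofReal_mul (by positivity),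
            ← ENNReal.ofReal_add (by positivity) (by positivity),
            ← ENNReal.ofReal_add (by positivity) (by positivity)]
          refine ENNReal.ofReal_le_ofReal ?_
          push_cast
          have : u * 2 ^ p * ((p : ℝ) + 1) ^ 2 + ((1 + 1 / ((p : ℝ) + 1))
              * (u * 2 ^ p * ((p : ℝ) + 1) ^ 2) + (1 + 1 / (1 / ((p : ℝ) + 1))) * (u * 2 ^ p))
              = (u * 2 ^ p) * (2 * ((p : ℝ) + 1) ^ 2 + ((p : ℝ) + 1) + ((p : ℝ) + 2)) := by
            field_simp; ring
          rw [this]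
          have h0 : 0 ≤ u * 2 ^ p := by positivity
          have : (u * 2 ^ (p + 1) * ((p : ℝ) + 1 + 1) ^ 2)
              = (u * 2 ^ p) * (2 * ((p : ℝ) + 2) ^ 2) := by ring
          rw [this]
          gcongr
          have : (0 : ℝ) ≤ p := by positivity
          nlinarith

/-- Markov's inequality for the squared maximum, after enlarging the window to a dyadic length. -/
lemma measure_windowMax_le {ξ : ℕ → Ω → ℝ} (hξ : ∀ j, Measurable (ξ j)) {u : ℝ} (hu : 0 ≤ u)
    {s₀ : ℕ} (h : ∀ k₁ k₂, s₀ + 1 ≤ k₁ → k₁ ≤ k₂ →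
      ∫⁻ ω, ENNReal.ofReal ((∑ j ∈ Finset.Icc k₁ k₂, ξ j ω) ^ 2) ∂P
        ≤ ENNReal.ofReal (u * ((k₂ : ℝ) - k₁ + 1))) {s L p : ℕ} (hs : s₀ ≤ s) (hL : L ≤ 2 ^ p)
    {η : ℝ} (hη : 0 < η) :
    P {ω | η < windowMax (fun j => ξ j ω) s L}
      ≤ ENNReal.ofReal (u * 2 ^ p * ((p : ℝ) + 1) ^ 2 / η ^ 2) := by
  have m1 := measurable_windowMax hξ s (2 ^ p)
  calc P {ω | η < windowMax (fun j => ξ j ω) s L}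
      ≤ P {ω | ENNReal.ofReal (η ^ 2)
          ≤ ENNReal.ofReal (windowMax (fun j => ξ j ω) s (2 ^ p) ^ 2)} := by
        refine measure_mono fun ω (hω : η < _) => ENNReal.ofReal_le_ofReal ?_
        have : windowMax (fun j => ξ j ω) s L ≤ windowMax (fun j => ξ j ω) s (2 ^ p) :=
          maxAbs_le (windowMax_nonneg _ _ _) fun l _ h2 =>
            abs_sum_le_windowMax (fun j => ξ j ω) (by omega)
        have : η ≤ windowMax (fun j => ξ j ω) s (2 ^ p) := by linarith
        gcongr
    _ ≤ (∫⁻ ω, ENNReal.ofReal (windowMax (fun j => ξ j ω) s (2 ^ p) ^ 2) ∂P)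
          / ENNReal.ofReal (η ^ 2) :=
        meas_ge_le_lintegral_div (m1.pow_const 2).ennreal_ofReal.aemeasurable
          (ENNReal.ofReal_pos.2 (by positivity)).ne' ENNReal.ofReal_ne_top
    _ ≤ ENNReal.ofReal (u * 2 ^ p * ((p : ℝ) + 1) ^ 2) / ENNReal.ofReal (η ^ 2) := by
        gcongr
        exact lintegral_windowMax_sq_le hξ hu h p s hs
    _ = _ := by rw [ENNReal.ofReal_div_of_pos (by positivity)]

end RademacherMenshov

/-! ### Measurability and the Hoeffding decomposition of the detector. -/

namespace Model

variable {Ω : Type*} [MeasurableSpace Ω] (P : Measure Ω) (M : Model Ω)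

/-- The part of the linear statistic that comes from the observations before the change. -/
noncomputable def preSum (m : ℕ) (ω : Ω) : ℝ :=
  ∑ j ∈ Finset.Icc (m + 1) (m + M.kstar m), M.h2 P (M.Y j ω)

/-- The part of the linear statistic that comes from the observations after the change. -/
noncomputable def postSum (m k : ℕ) (ω : Ω) : ℝ :=
  ∑ j ∈ Finset.Icc (m + M.kstar m + 1) (m + k), M.h2Star P m (M.Z m j ω)

/-- The remainder column sums before the change. -/
noncomputable def remCol (m j : ℕ) (ω : Ω) : ℝ :=
  ∑ i ∈ Finset.Icc 1 m, M.r P (M.Y i ω) (M.Y j ω)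

/-- The remainder column sums after the change. -/
noncomputable def remColStar (m j : ℕ) (ω : Ω) : ℝ :=
  ∑ i ∈ Finset.Icc 1 m, M.rStar P m (M.Y i ω) (M.Z m j ω)

noncomputable def remSum (m k : ℕ) (ω : Ω) : ℝ :=
  ∑ j ∈ Finset.Icc (m + 1) (m + M.kstar m), M.remCol P m j ω
    + ∑ j ∈ Finset.Icc (m + M.kstar m + 1) (m + k), M.remColStar P m j ω

/-- The order of the signal-to-noise ratio, `√m |Δ_m|`. -/
noncomputable def signal (m : ℕ) : ℝ := √(m : ℝ) * |M.Delta P m|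

section Measurability

variable {M} {P} [IsProbabilityMeasure P] (hM : M.Standing P)
include hM

lemma Standing.measurable_h1 : Measurable (M.h1 P) := by
  have : StronglyMeasurable (Function.uncurry fun s ω => M.h s (M.Y 1 ω) - M.theta P) := by
    refine (Measurable.sub ?_ measurable_const).stronglyMeasurable
    exact hM.measurable_h.comp (measurable_fst.prodMk ((hM.measurable_Y 1).comp measurable_snd))
  exact (this.integral_prod_right (ν := P)).measurable

lemma Standing.measurable_h1Star (m : ℕ) : Measurable (M.h1Star P m) := by
  have : StronglyMeasurable (Function.uncurry fun s ω => M.h s (M.Z m 1 ω) - M.thetaStar P m) := by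
    refine (Measurable.sub ?_ measurable_const).stronglyMeasurable
    exact hM.measurable_h.comp (measurable_fst.prodMk ((hM.measurable_Z m 1).comp measurable_snd))
  exact (this.integral_prod_right (ν := P)).measurable

lemma Standing.measurable_h2 : Measurable (M.h2 P) := by
  have : StronglyMeasurable (Function.uncurry fun t ω => M.h (M.Y 1 ω) t - M.theta P) := by
    refine (Measurable.sub ?_ measurable_const).stronglyMeasurable
    exact hM.measurable_h.comp (((hM.measurable_Y 1).comp measurable_snd).prodMk measurable_fst)
  exact (this.integral_prod_right (ν := P)).measurable

lemma Standing.measurable_h2Star (m : ℕ) : Measurable (M.h2Star P m) := by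
  have : StronglyMeasurable (Function.uncurry fun t ω => M.h (M.Y 1 ω) t - M.thetaStar P m) := by
    refine (Measurable.sub ?_ measurable_const).stronglyMeasurable
    exact hM.measurable_h.comp (((hM.measurable_Y 1).comp measurable_snd).prodMk measurable_fst)
  exact (this.integral_prod_right (ν := P)).measurable

omit [IsProbabilityMeasure P] in
lemma Standing.measurable_h_comp {f g : Ω → ℝ} (hf : Measurable f) (hg : Measurable g) :
    Measurable fun ω => M.h (f ω) (g ω) :=
  hM.measurable_h.comp (hf.prodMk hg)

lemma Standing.measurable_remCol (m j : ℕ) : Measurable (M.remCol P m j) := by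
  refine Finset.measurable_sum _ fun i _ => ?_
  have hi := hM.measurable_Y i
  have hj := hM.measurable_Y j
  exact (((hM.measurable_h_comp hi hj).sub (hM.measurable_h1.comp hi)).sub
    (hM.measurable_h2.comp hj)).sub measurable_const

lemma Standing.measurable_remColStar (m j : ℕ) : Measurable (M.remColStar P m j) := by
  refine Finset.measurable_sum _ fun i _ => ?_
  have hi := hM.measurable_Y i
  have hj := hM.measurable_Z m j
  exact (((hM.measurable_h_comp hi hj).sub ((hM.measurable_h1Star m).comp hi)).sub
    ((hM.measurable_h2Star m).comp hj)).sub measurable_const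

lemma Standing.measurable_S1 (m : ℕ) : Measurable (M.S1 P m) :=
  (Finset.measurable_sum _ fun i _ => hM.measurable_h1.comp (hM.measurable_Y i)).const_mul _

lemma Standing.measurable_S1Star (m : ℕ) : Measurable (M.S1Star P m) :=
  (Finset.measurable_sum _ fun i _ =>
    (hM.measurable_h1Star m).comp (hM.measurable_Y i)).const_mul _

omit [IsProbabilityMeasure P] in
lemma Standing.measurable_X (m i : ℕ) : Measurable (M.X m i) := by
  unfold Model.X
  split_ifs
  · exact hM.measurable_Y i
  · exact hM.measurable_Z m i

omit [IsProbabilityMeasure P] in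
lemma Standing.measurable_Gam (m k : ℕ) : Measurable (M.Gam P m k) :=
  (Finset.measurable_sum _ fun i _ => Finset.measurable_sum _ fun j _ =>
    (hM.measurable_h_comp (hM.measurable_X m i) (hM.measurable_X m j)).sub
      measurable_const).const_mul _

omit [IsProbabilityMeasure P] in
lemma Standing.measurable_kappa (m : ℕ) : Measurable (M.kappa P m) := by
  classical
  have hcross : ∀ k, MeasurableSet {ω | M.kstar m < k ∧ M.c m < weight m k * |M.Gam P m k ω|} := by
    intro k
    by_cases hk : M.kstar m < k
    · simp only [hk, true_and]
      exact measurableSet_lt measurable_const ((hM.measurable_Gam m k).abs.const_mul _)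
    · simp [hk]
  refine measurable_to_countable' fun y => ?_
  -- Since ℕ∞ is countable, it suffices to treat single values; each is obtained from the events κ_m
  -- < n, which are finite unions of crossing events.
  have hlt : ∀ n : ℕ, MeasurableSet {ω | M.kappa P m ω < n} := by
    intro n
    have : {ω | M.kappa P m ω < n}
        = ⋃ k ∈ Finset.range n,
          {ω | M.kstar m < k ∧ M.c m < weight m k * |M.Gam P m k ω|} := by
      ext ω
      simp only [Model.kappa, sInf_lt_iff, Set.mem_ofPred_eq, Set.mem_iUnion, Finset.mem_range,
        Set.exists_mem_image]
      constructor
      · rintro ⟨k, hk, hkn⟩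
        exact ⟨k, by exact_mod_cast hkn, hk⟩
      · rintro ⟨k, hkn, hk⟩
        exact ⟨k, hk, by exact_mod_cast hkn⟩
    rw [this]
    exact Finset.measurableSet_biUnion _ fun k _ => hcross k
  induction y using ENat.recTopCoe with
  | top =>
    have : M.kappa P m ⁻¹' {⊤} = (⋃ n : ℕ, {ω | M.kappa P m ω < n})ᶜ := by
      ext ω
      simp only [Set.mem_preimage, Set.mem_singleton_iff, Set.mem_compl_iff, Set.mem_iUnion,
        Set.mem_ofPred_eq, not_exists, not_lt]
      rw [ENat.eq_top_iff_forall_ge]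
    rw [this]
    exact (MeasurableSet.iUnion hlt).compl
  | coe n =>
    have : M.kappa P m ⁻¹' {(n : ℕ∞)}
        = {ω | M.kappa P m ω < (n + 1 : ℕ)} \ {ω | M.kappa P m ω < n} := by
      ext ω
      simp only [Set.mem_preimage, Set.mem_singleton_iff, Set.mem_sdiff, Set.mem_ofPred_eq, not_lt]
      push_cast
      rw [ENat.lt_add_one_iff (ENat.natCast_ne_top n)]
      exact le_antisymm_iff
    rw [this]
    exact (hlt _).diff (hlt _)

omit [IsProbabilityMeasure P] in
lemma Standing.measurable_standardizedDelay {A : ℕ → Ω → ℝ} (m : ℕ) (hA : Measurable (A m)) :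
    Measurable (M.standardizedDelay P A m) := by
  have h1 : Measurable fun ω => ((M.kappa P m ω : ℝ≥0∞) : EReal) :=
    (measurable_from_top (f := fun k : ℕ∞ => ((k : ℝ≥0∞) : EReal))).comp (hM.measurable_kappa m)
  have h2 : Measurable fun ω => (-(A m ω) : EReal) := by
    exact_mod_cast hA.neg.coe_real_ereal
  unfold standardizedDelay
  simp_rw [sub_eq_add_neg, div_eq_mul_inv]
  exact (h1.add h2).mul_const _

end Measurability

variable {P M}

/-- Hoeffding's decomposition applied column by column. A column before the change contributes √m
S_1 and m h_2(Y_j); a column after it contributes √m S_1*, m h_2*(Z_j) and the drift m Δ_m, the last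
because the detector is centred at θ rather than θ*_m. -/
lemma Gam_eq {m k : ℕ} (hm : 1 ≤ m) (hk : M.kstar m ≤ k) (ω : Ω) :
    M.Gam P m k ω = M.kstar m * M.S1 P m ω / √(m : ℝ)
      + ((k : ℝ) - M.kstar m) * (M.S1Star P m ω / √(m : ℝ)) + ((k : ℝ) - M.kstar m) * M.Delta P m
      + (M.preSum P m ω + M.postSum P m k ω) + M.remSum P m k ω / m := by
  have hm0 : (0 : ℝ) < m := by exact_mod_cast hm
  have hsq : √(m : ℝ) * √(m : ℝ) = m := Real.mul_self_sqrt hm0.le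
  have hsm : √(m : ℝ) ≠ 0 := (Real.sqrt_pos.2 hm0).ne'
  have hS1 : ∑ i ∈ Finset.Icc 1 m, M.h1 P (M.Y i ω) = √(m : ℝ) * M.S1 P m ω := by
    rw [S1, mul_inv_cancel_left₀ hsm]
  have hS1' : ∑ i ∈ Finset.Icc 1 m, M.h1Star P m (M.Y i ω) = √(m : ℝ) * M.S1Star P m ω := by
    rw [S1Star, mul_inv_cancel_left₀ hsm]
  have hX : ∀ i ∈ Finset.Icc 1 m, M.X m i ω = M.Y i ω := fun i hi => by
    rw [Finset.mem_Icc] at hi; exact if_pos (by omega)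
  have hpre : ∀ j ∈ Finset.Icc (m + 1) (m + M.kstar m),
      ∑ i ∈ Finset.Icc 1 m, (M.h (M.X m i ω) (M.X m j ω) - M.theta P)
        = M.remCol P m j ω + √(m : ℝ) * M.S1 P m ω + m * M.h2 P (M.Y j ω) := by
    intro j hj
    have hj' : M.X m j ω = M.Y j ω := by
      rw [Finset.mem_Icc] at hj; exact if_pos (by omega)
    rw [← hS1, remCol, ← Finset.sum_add_distrib]
    have : (m : ℝ) * M.h2 P (M.Y j ω) = ∑ i ∈ Finset.Icc 1 m, M.h2 P (M.Y j ω) := by simp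
    rw [this, ← Finset.sum_add_distrib]
    refine Finset.sum_congr rfl fun i hi => ?_
    rw [hX i hi, hj', r]; ring
  have hpost : ∀ j ∈ Finset.Icc (m + M.kstar m + 1) (m + k),
      ∑ i ∈ Finset.Icc 1 m, (M.h (M.X m i ω) (M.X m j ω) - M.theta P)
        = M.remColStar P m j ω + √(m : ℝ) * M.S1Star P m ω + m * M.h2Star P m (M.Z m j ω)
          + m * M.Delta P m := by
    intro j hj
    have hj' : M.X m j ω = M.Z m j ω := by
      rw [Finset.mem_Icc] at hj; exact if_neg (by omega)
    rw [← hS1', remColStar, ← Finset.sum_add_distrib]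
    have : (m : ℝ) * M.h2Star P m (M.Z m j ω)
      = ∑ i ∈ Finset.Icc 1 m, M.h2Star P m (M.Z m j ω) := by simp
    rw [this, ← Finset.sum_add_distrib]
    have : (m : ℝ) * M.Delta P m = ∑ i ∈ Finset.Icc 1 m, M.Delta P m := by simp
    rw [this, ← Finset.sum_add_distrib]
    refine Finset.sum_congr rfl fun i hi => ?_
    rw [hX i hi, hj', rStar, Delta]; ring
  have hc1 : ((Finset.Icc (m + 1) (m + M.kstar m)).card : ℝ) = M.kstar m := by
    rw [Nat.card_Icc]; congr 1; omega
  have hc2 : ((Finset.Icc (m + M.kstar m + 1) (m + k)).card : ℝ) = (k : ℝ) - M.kstar m := by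
    rw [Nat.card_Icc, ← Nat.cast_sub hk]; congr 1; omega
  rw [Gam, Finset.sum_comm, sum_Icc_split _ (show m ≤ m + M.kstar m by omega) (by omega),
    Finset.sum_congr rfl hpre, Finset.sum_congr rfl hpost]
  simp only [Finset.sum_add_distrib, Finset.sum_const, nsmul_eq_mul, hc1, hc2,
    ← Finset.mul_sum]
  rw [remSum, preSum, postSum]
  field_simp
  linear_combination (M.kstar m * M.S1 P m ω + ((k : ℝ) - M.kstar m) * M.S1Star P m ω) * hsq

lemma lt_weight_mul_iff {m k : ℕ} (hm : 1 ≤ m) (c x : ℝ) :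
    c < weight m k * x ↔ c * (√(m : ℝ) * (1 + (k : ℝ) / m)) < x := by
  have hm0 : (0 : ℝ) < m := by exact_mod_cast hm
  have : 0 < √(m : ℝ) * (1 + (k : ℝ) / m) := by
    have := Real.sqrt_pos.2 hm0
    positivity
  rw [weight, inv_mul_eq_div, lt_div_iff₀ this]

lemma sign_mul_self_eq_abs (x : ℝ) : Real.sign x * x = |x| := by
  rcases lt_trichotomy x 0 with h | rfl | h
  · rw [Real.sign_of_neg h, abs_of_neg h]; ring
  · simp
  · rw [Real.sign_of_pos h, abs_of_pos h]; ring

/-- The slope of the detector after the change, relative to `|Δ_m|`. -/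
noncomputable def slope (P : Measure Ω) (M : Model Ω) (m : ℕ) (sStar : ℝ) : ℝ :=
  1 - M.c m / M.signal P m + sStar * Real.sign (M.Delta P m) / M.signal P m

/-- `slope * a` is an affine function of the historic quantities. -/
lemma slope_mul_a {m : ℕ} {s sStar : ℝ} (hm : 1 ≤ m)
    (hΔ : M.Delta P m ≠ 0) (hq : slope P M m sStar ≠ 0) :
    slope P M m sStar * M.a P m s sStar = M.kstar m
      + M.kstar m * ((sStar - s) * Real.sign (M.Delta P m) / M.signal P m)
      + M.c m * m / M.signal P m := by
  have hm0 : (0 : ℝ) < m := by exact_mod_cast hm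
  have hsm := Real.sqrt_pos.2 hm0
  have hΔ' := abs_pos.2 hΔ
  unfold slope signal at *
  rw [a, mul_inv_cancel_left₀ hq]
  congr 1
  field_simp
  rw [Real.sq_sqrt hm0.le]

/-- Both the threshold and the noiseless detector are affine in k. Their difference has slope q_m
|Δ_m|, and by `slope_mul_a` it vanishes at a_m(S_1, S_1*). -/
lemma sign_mul_Gam_eq {m k : ℕ} (hm : 1 ≤ m) (hk : M.kstar m ≤ k) (ω : Ω)
    (hΔ : M.Delta P m ≠ 0) (hq : slope P M m (M.S1Star P m ω) ≠ 0) :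
    Real.sign (M.Delta P m) * M.Gam P m k ω = M.c m * (√(m : ℝ) * (1 + (k : ℝ) / m))
      + slope P M m (M.S1Star P m ω) * |M.Delta P m|
        * (k - M.a P m (M.S1 P m ω) (M.S1Star P m ω))
      + Real.sign (M.Delta P m) * (M.preSum P m ω + M.postSum P m k ω)
      + Real.sign (M.Delta P m) * (M.remSum P m k ω / m) := by
  have hm0 : (0 : ℝ) < m := by exact_mod_cast hm
  have hsm := Real.sqrt_pos.2 hm0
  have hsq : √(m : ℝ) ^ 2 = m := Real.sq_sqrt hm0.le
  have hΔ' := abs_pos.2 hΔ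
  have h1 := slope_mul_a (s := M.S1 P m ω) hm hΔ hq
  have h2 : slope P M m (M.S1Star P m ω) * |M.Delta P m|
        * (k - M.a P m (M.S1 P m ω) (M.S1Star P m ω))
      = |M.Delta P m| * (slope P M m (M.S1Star P m ω) * k
        - slope P M m (M.S1Star P m ω) * M.a P m (M.S1 P m ω) (M.S1Star P m ω)) := by ring
  rw [h2, h1, Gam_eq hm hk, ← sign_mul_self_eq_abs]
  simp only [mul_add]
  have h3 : ∀ x, Real.sign (M.Delta P m) * (x * M.Delta P m) = x * |M.Delta P m| := fun x => by
    rw [← sign_mul_self_eq_abs]; ring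
  rw [h3, sign_mul_self_eq_abs, slope, signal]
  field_simp
  rw [hsq]
  ring

end Model

/-! ### Orders of magnitude of the standardizing sequences. -/

namespace Model

variable {Ω : Type*} [MeasurableSpace Ω] {P : Measure Ω} {M : Model Ω}

/-- The leading order of `a_m`. -/
noncomputable def leadA (P : Measure Ω) (M : Model Ω) (m : ℕ) : ℝ :=
  M.kstar m + M.c m * m / M.signal P m

lemma signal_nonneg (m : ℕ) : 0 ≤ M.signal P m := by
  unfold signal; positivity

lemma ThresholdAssumption.tendsto_signal (hthr : M.ThresholdAssumption P)
    (hch : M.ChangeAssumption P) : Tendsto (M.signal P) atTop atTop := by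
  obtain ⟨ε, hε, hc⟩ := hthr.threshold_lower
  refine tendsto_atTop_mono' _ ?_ (hch.detectable.const_mul_atTop hε)
  filter_upwards [hc] with m hm
  have hcm : 0 < M.c m := hε.trans_le hm
  have h0 := signal_nonneg (P := P) (M := M) m
  calc ε * (√(m : ℝ) * |M.Delta P m| / M.c m)
      ≤ M.c m * (M.signal P m / M.c m) := by
        unfold signal at *; gcongr
    _ = M.signal P m := by field_simp

lemma ChangeAssumption.tendsto_inv_detectable (hch : M.ChangeAssumption P) :
    Tendsto (fun m => M.c m / M.signal P m) atTop (𝓝 0) := by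
  refine hch.detectable.inv_tendsto_atTop.congr fun m => ?_
  simp [signal]

lemma ThresholdAssumption.eventually_pos (hthr : M.ThresholdAssumption P)
    (hch : M.ChangeAssumption P) :
    ∀ᶠ m in atTop, 1 ≤ m ∧ 0 < M.c m ∧ 0 < M.signal P m ∧ M.Delta P m ≠ 0 ∧ 0 < |M.Delta P m| := by
  obtain ⟨ε, hε, hc⟩ := hthr.threshold_lower
  filter_upwards [hc, (hthr.tendsto_signal hch).eventually_gt_atTop 0, eventually_ge_atTop 1]
    with m h1 h2 h3
  have : M.Delta P m ≠ 0 := by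
    intro h; simp [signal, h] at h2
  exact ⟨h3, hε.trans_le h1, h2, this, abs_pos.2 this⟩

/-- The deterministic slope 1 - c_m / (√m |Δ_m|) lies eventually between 1/2 and 1, so a_m(0,0) and
its leading order differ by a factor of at most 2. -/
lemma ThresholdAssumption.a_bounds (hthr : M.ThresholdAssumption P) (hch : M.ChangeAssumption P) :
    ∀ᶠ m in atTop, (1 - M.c m / M.signal P m) * M.a P m 0 0 = leadA P M m ∧
      leadA P M m ≤ M.a P m 0 0 ∧ M.a P m 0 0 ≤ 2 * leadA P M m ∧ 0 < leadA P M m := by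
  filter_upwards [hthr.eventually_pos hch,
    hch.tendsto_inv_detectable.eventually_lt_const (show (0 : ℝ) < 1 / 2 by norm_num)]
    with m ⟨h1, h2, h3, h4, _⟩ h5
  have hq : slope P M m 0 = 1 - M.c m / M.signal P m := by simp [slope]
  have h6 := slope_mul_a (s := 0) h1 h4 (show slope P M m 0 ≠ 0 by rw [hq]; linarith)
  have hm0 : (0 : ℝ) < m := by exact_mod_cast h1
  have e : (1 - M.c m / M.signal P m) * M.a P m 0 0 = leadA P M m := by
    rw [← hq, h6]; simp [leadA]
  have h7 : 0 < leadA P M m := by unfold leadA; positivity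
  have h8 : 0 < M.c m / M.signal P m := by positivity
  have h9 : 0 < M.a P m 0 0 := by
    by_contra hneg
    have : (1 - M.c m / M.signal P m) * M.a P m 0 0 ≤ 0 :=
      mul_nonpos_of_nonneg_of_nonpos (by linarith) (not_lt.1 hneg)
    linarith
  exact ⟨e, by nlinarith, by nlinarith, h7⟩

/-- The quantity equals c_m √m / |Δ_m|, where c_m stays away from 0 and Δ_m is bounded. It is the
part of the leading order that does not involve k*. -/
lemma ThresholdAssumption.tendsto_leadA (hthr : M.ThresholdAssumption P)
    (hch : M.ChangeAssumption P) :
    Tendsto (fun m => M.c m * m / M.signal P m) atTop atTop := by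
  obtain ⟨ε, hε, hc⟩ := hthr.threshold_lower
  obtain ⟨B, hB0, hB⟩ := hch.bounded.exists_pos
  have ht : Tendsto (fun m : ℕ => ε / B * √(m : ℝ)) atTop atTop :=
    (Real.tendsto_sqrt_atTop.comp tendsto_natCast_atTop_atTop).const_mul_atTop (by positivity)
  refine tendsto_atTop_mono' _ ?_ ht
  filter_upwards [hthr.eventually_pos hch, hc, hB.bound] with m ⟨h1, h2, h3, h4, h5⟩ h6 h7
  have hm0 : (0 : ℝ) < m := by exact_mod_cast h1
  have hsm := Real.sqrt_pos.2 hm0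
  have hd : |M.Delta P m| ≤ B := by simpa using h7
  have e : M.c m * m / M.signal P m = M.c m / |M.Delta P m| * √(m : ℝ) := by
    unfold signal
    field_simp
    rw [Real.sq_sqrt hm0.le]
  rw [e]
  gcongr

lemma ThresholdAssumption.tendsto_a (hthr : M.ThresholdAssumption P)
    (hch : M.ChangeAssumption P) : Tendsto (fun m => M.a P m 0 0) atTop atTop := by
  refine tendsto_atTop_mono' _ ?_ (hthr.tendsto_leadA hch)
  filter_upwards [hthr.a_bounds hch] with m ⟨_, h, _⟩
  refine le_trans ?_ h
  simp [leadA]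

lemma ThresholdAssumption.tendsto_sqrt_a (hthr : M.ThresholdAssumption P)
    (hch : M.ChangeAssumption P) : Tendsto (fun m => √(M.a P m 0 0)) atTop atTop :=
  Real.tendsto_sqrt_atTop.comp (hthr.tendsto_a hch)

lemma ThresholdAssumption.tendsto_b (hthr : M.ThresholdAssumption P)
    (hch : M.ChangeAssumption P) : Tendsto (fun m => M.b P m 0 0) atTop atTop := by
  obtain ⟨B, hB0, hB⟩ := hch.bounded.exists_pos
  refine tendsto_atTop_mono' _ ?_ ((hthr.tendsto_sqrt_a hch).const_mul_atTop (inv_pos.2 hB0))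
  filter_upwards [hthr.eventually_pos hch, hB.bound] with m ⟨_, _, _, _, h5⟩ h7
  have hd : |M.Delta P m| ≤ B := by simpa using h7
  rw [b, div_eq_inv_mul]
  gcongr

/-- `b_m / a_m` is the inverse of `|Δ_m| √a_m`. -/
lemma ThresholdAssumption.tendsto_delta_mul_sqrt_a (hthr : M.ThresholdAssumption P)
    (hch : M.ChangeAssumption P) :
    Tendsto (fun m => |M.Delta P m| * √(M.a P m 0 0)) atTop atTop := by
  obtain ⟨ε, hε, hc⟩ := hthr.threshold_lower
  have ht : Tendsto (fun m : ℕ => √(ε * M.signal P m)) atTop atTop :=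
    Real.tendsto_sqrt_atTop.comp ((hthr.tendsto_signal hch).const_mul_atTop hε)
  refine tendsto_atTop_mono' _ ?_ ht
  filter_upwards [hthr.eventually_pos hch, hc, hthr.a_bounds hch] with m ⟨h1, h2, h3, h4, h5⟩ h6
    ⟨_, h7, _, _⟩
  have hm0 : (0 : ℝ) < m := by exact_mod_cast h1
  have hsm := Real.sqrt_pos.2 hm0
  have h8 : M.c m * m / M.signal P m ≤ M.a P m 0 0 := le_trans (by simp [leadA]) h7
  calc √(ε * M.signal P m) ≤ √(|M.Delta P m| ^ 2 * (M.c m * m / M.signal P m)) := by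
        apply Real.sqrt_le_sqrt
        have : |M.Delta P m| ^ 2 * (M.c m * m / M.signal P m) = M.c m * M.signal P m := by
          unfold signal
          field_simp
          rw [Real.sq_sqrt hm0.le]
        rw [this]
        gcongr
    _ ≤ √(|M.Delta P m| ^ 2 * M.a P m 0 0) := by gcongr
    _ = _ := by rw [Real.sqrt_mul (by positivity), Real.sqrt_sq (by positivity)]

lemma kstar_le (hM : M.Standing P) (m : ℕ) : (M.kstar m : ℝ) ≤ M.lam * (m : ℝ) ^ M.beta :=
  Nat.floor_le (mul_nonneg hM.lam_pos.le (by positivity))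

omit [MeasurableSpace Ω] in
lemma lt_kstar_add_one (m : ℕ) : M.lam * (m : ℝ) ^ M.beta < M.kstar m + 1 :=
  Nat.lt_floor_add_one _

/-- The pre-change historic term k* S_1 / √m is negligible against the threshold c_m (m + k*) / √m
at the change point. This is where c_m max(1, m^(1-β)) → ∞ enters: k* ≤ m + k* covers the first
entry of the maximum and k* m^(1-β) ≤ λ m the second. -/
lemma ThresholdAssumption.tendsto_kstar_div (hthr : M.ThresholdAssumption P)
    (hch : M.ChangeAssumption P) (hM : M.Standing P) :
    Tendsto (fun m => (M.kstar m : ℝ) / (M.c m * (m + M.kstar m))) atTop (𝓝 0) := by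
  have ht := hthr.threshold_growth.inv_tendsto_atTop.const_mul (max 1 M.lam)
  rw [mul_zero] at ht
  refine tendsto_of_tendsto_of_tendsto_of_le_of_le' tendsto_const_nhds ht ?_ ?_
  · filter_upwards [hthr.eventually_pos hch] with m ⟨_, h2, _⟩
    positivity
  filter_upwards [hthr.eventually_pos hch] with m ⟨h1, h2, _⟩
  have hm0 : (0 : ℝ) < m := by exact_mod_cast h1
  have hK : (0 : ℝ) ≤ M.kstar m := by positivity
  simp only [Pi.inv_apply]
  rw [← div_eq_mul_inv, div_le_div_iff₀ (by positivity) (by positivity)]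
  have key : (M.kstar m : ℝ) * max 1 ((m : ℝ) ^ (1 - M.beta))
      ≤ max 1 M.lam * (m + M.kstar m) := by
    rw [mul_max_of_nonneg _ _ hK]
    refine max_le ?_ ?_
    · calc (M.kstar m : ℝ) * 1 ≤ 1 * (m + M.kstar m) := by linarith
        _ ≤ _ := by gcongr; exact le_max_left _ _
    · calc (M.kstar m : ℝ) * (m : ℝ) ^ (1 - M.beta)
          ≤ (M.lam * (m : ℝ) ^ M.beta) * (m : ℝ) ^ (1 - M.beta) := by
            gcongr; exact kstar_le hM m
        _ = M.lam * m := by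
            rw [mul_assoc, ← Real.rpow_add hm0]; simp
        _ ≤ max 1 M.lam * (m + M.kstar m) := by
            gcongr
            · exact le_max_right _ _
            · linarith
  calc (M.kstar m : ℝ) * (M.c m * max 1 ((m : ℝ) ^ (1 - M.beta)))
      = M.c m * ((M.kstar m : ℝ) * max 1 ((m : ℝ) ^ (1 - M.beta))) := by ring
    _ ≤ M.c m * (max 1 M.lam * (m + M.kstar m)) := by gcongr
    _ = _ := by ring

/-- The noise, of order √a_m, is negligible against the threshold at the change point. In the
squared ratio, the two parts k* and c_m m / (√m |Δ_m|) of a_m are estimated separately. -/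
lemma ThresholdAssumption.tendsto_sqrt_div (hthr : M.ThresholdAssumption P)
    (hch : M.ChangeAssumption P) (hM : M.Standing P) :
    Tendsto (fun m : ℕ => √(m : ℝ) * √(M.a P m 0 0) / (M.c m * (m + M.kstar m))) atTop (𝓝 0) := by
  obtain ⟨ε, hε, hc⟩ := hthr.threshold_lower
  have ht : Tendsto (fun m => √((2 / ε) * ((M.kstar m : ℝ) / (M.c m * (m + M.kstar m)))
      + 2 / (ε * M.signal P m))) atTop (𝓝 0) := by
    have h1 := (hthr.tendsto_kstar_div hch hM).const_mul (2 / ε)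
    have h2 : Tendsto (fun m => 2 / (ε * M.signal P m)) atTop (𝓝 0) :=
      ((hthr.tendsto_signal hch).const_mul_atTop hε).const_div_atTop 2
    have h3 := h1.add h2
    have := (Real.continuous_sqrt.tendsto _).comp h3
    simpa [Function.comp_def] using this
  refine tendsto_of_tendsto_of_tendsto_of_le_of_le' tendsto_const_nhds ht ?_ ?_
  · filter_upwards [hthr.eventually_pos hch] with m ⟨_, h2, _⟩
    positivity
  filter_upwards [hthr.eventually_pos hch, hc, hthr.a_bounds hch] with m ⟨h1, h2, h3, h4, h5⟩ h6
    ⟨_, h7, h8, h9⟩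
  have hm0 : (0 : ℝ) < m := by exact_mod_cast h1
  have hK : (0 : ℝ) ≤ M.kstar m := by positivity
  have ha : 0 ≤ M.a P m 0 0 := h9.le.trans h7
  refine Real.le_sqrt_of_sq_le ?_
  rw [div_pow, mul_pow, Real.sq_sqrt hm0.le, Real.sq_sqrt ha]
  set K : ℝ := (M.kstar m : ℝ)
  set c := M.c m
  set d := M.signal P m
  calc (m : ℝ) * M.a P m 0 0 / (c * (m + K)) ^ 2
      ≤ m * (2 * (K + c * m / d)) / (c * (m + K)) ^ 2 := by gcongr; exact h8
    _ = (2 / c) * (K / (c * (m + K))) * (m / (m + K)) + 2 / (c * d) * (m / (m + K)) ^ 2 := by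
        field_simp
    _ ≤ (2 / c) * (K / (c * (m + K))) * 1 + 2 / (c * d) * 1 ^ 2 := by
        have : (m : ℝ) / (m + K) ≤ 1 := by
          rw [div_le_one (by positivity)]; linarith
        gcongr
    _ ≤ (2 / ε) * (K / (c * (m + K))) + 2 / (ε * d) := by
        rw [mul_one, one_pow, mul_one]
        gcongr

/-- The limit of `k* / a_m`. -/
noncomputable def tau (lam : ℝ) (D : ℝ≥0∞) : ℝ :=
  if D = ⊤ then 1 else lam * D.toReal / (1 + lam * D.toReal)

lemma tau_nonneg (hM : M.Standing P) (D : ℝ≥0∞) : 0 ≤ tau M.lam D := by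
  have := hM.lam_pos
  unfold tau
  split_ifs <;> positivity

lemma tau_le_one (hM : M.Standing P) (D : ℝ≥0∞) : tau M.lam D ≤ 1 := by
  have := hM.lam_pos
  have hD : 0 ≤ D.toReal := ENNReal.toReal_nonneg
  unfold tau
  split_ifs
  · exact le_rfl
  · rw [div_le_one (by positivity)]; linarith

/-- With y the ratio of the two parts of the leading order, k* / a_m is y / (1 + y) times a factor
tending to 1. Apart from rounding in k*, y is λ times the sequence that defines D. -/
lemma ThresholdAssumption.tendsto_kstar_div_a (hthr : M.ThresholdAssumption P)
    (hch : M.ChangeAssumption P) (hM : M.Standing P) {D : ℝ≥0∞}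
    (hD : Tendsto (fun m : ℕ => ENNReal.ofReal
      ((m : ℝ) ^ (M.beta - 1) * (√(m : ℝ) * |M.Delta P m| / M.c m))) atTop (𝓝 D)) :
    Tendsto (fun m => (M.kstar m : ℝ) / M.a P m 0 0) atTop (𝓝 (tau M.lam D)) := by
  have hlam := hM.lam_pos
  set x : ℕ → ℝ := fun m => (m : ℝ) ^ (M.beta - 1) * (√(m : ℝ) * |M.Delta P m| / M.c m) with hx
  set y : ℕ → ℝ := fun m => M.kstar m * M.signal P m / (M.c m * m) with hy
  have hyx : Tendsto (fun m => y m - M.lam * x m) atTop (𝓝 0) := by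
    have ht := (hthr.tendsto_leadA hch).inv_tendsto_atTop
    refine squeeze_zero_norm' ?_ ht
    filter_upwards [hthr.eventually_pos hch] with m ⟨h1, h2, h3, h4, h5⟩
    have hm0 : (0 : ℝ) < m := by exact_mod_cast h1
    have e : y m - M.lam * x m
        = (M.kstar m - M.lam * (m : ℝ) ^ M.beta) * (M.c m * m / M.signal P m)⁻¹ := by
      simp only [hx, hy]
      rw [Real.rpow_sub_one hm0.ne', ← signal]
      field_simp
    have hk := kstar_le hM m
    have hk' := lt_kstar_add_one (M := M) m
    have h6 : 0 < (M.c m * m / M.signal P m)⁻¹ := by positivity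
    rw [e, norm_mul, Real.norm_eq_abs, Real.norm_eq_abs, abs_of_pos h6]
    have : |M.kstar m - M.lam * (m : ℝ) ^ M.beta| ≤ 1 := by
      rw [abs_le]; constructor <;> linarith
    simpa using mul_le_mul_of_nonneg_right this h6.le
  have hratio : (fun m => (1 - M.c m / M.signal P m) * (y m / (1 + y m)))
      =ᶠ[atTop] fun m => (M.kstar m : ℝ) / M.a P m 0 0 := by
    filter_upwards [hthr.eventually_pos hch, hthr.a_bounds hch] with m ⟨h1, h2, h3, h4, h5⟩
      ⟨h6, h7, h8, h9⟩
    have hm0 : (0 : ℝ) < m := by exact_mod_cast h1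
    have ha : 0 < M.a P m 0 0 := h9.trans_le h7
    have hq : 1 - M.c m / M.signal P m = leadA P M m / M.a P m 0 0 := by
      rw [← h6]; field_simp
    have hy1 : y m / (1 + y m) = M.kstar m / leadA P M m := by
      simp only [hy, leadA]
      have hK : (0 : ℝ) ≤ M.kstar m := by positivity
      field_simp
      ring
    rw [hq, hy1]
    field_simp
  refine Tendsto.congr' hratio ?_
  have h1 : Tendsto (fun m => 1 - M.c m / M.signal P m) atTop (𝓝 1) := by
    simpa using hch.tendsto_inv_detectable.const_sub 1
  suffices h2 : Tendsto (fun m => y m / (1 + y m)) atTop (𝓝 (tau M.lam D)) by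
    simpa using h1.mul h2
  by_cases hDtop : D = ⊤
  · rw [tau, if_pos hDtop]
    rw [hDtop, ENNReal.tendsto_ofReal_nhds_top] at hD
    have hyt : Tendsto y atTop atTop := by
      have := (hD.const_mul_atTop hlam).atTop_add hyx
      refine this.congr fun m => ?_
      simp [hx]
    have h3 : Tendsto (fun m => 1 - (1 + y m)⁻¹) atTop (𝓝 1) := by
      simpa using (tendsto_atTop_add_const_left _ 1 hyt).inv_tendsto_atTop.const_sub 1
    refine h3.congr' ?_
    filter_upwards [hyt.eventually_gt_atTop 0] with m hm
    field_simp
    ring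
  · rw [tau, if_neg hDtop]
    have hxt : Tendsto x atTop (𝓝 D.toReal) := by
      refine ((ENNReal.tendsto_toReal hDtop).comp hD).congr' ?_
      filter_upwards [hthr.eventually_pos hch] with m ⟨h1, h2, h3, h4, h5⟩
      simp only [Function.comp]
      rw [ENNReal.toReal_ofReal (by positivity)]
    have hyt : Tendsto y atTop (𝓝 (M.lam * D.toReal)) := by
      have := (hxt.const_mul M.lam).add hyx
      rw [add_zero] at this
      refine this.congr fun m => by ring
    have hD0 : 0 ≤ D.toReal := ENNReal.toReal_nonneg
    exact hyt.div (hyt.const_add 1) (by positivity)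

/-- A polynomial horizon has a logarithm of order log m, which matches the factor (log m)² in the
remainder assumptions. -/
lemma ThresholdAssumption.exists_horizon_le_pow (hthr : M.ThresholdAssumption P)
    (hch : M.ChangeAssumption P) (hM : M.Standing P) :
    ∃ J : ℕ, ∀ᶠ m in atTop, ⌈2 * M.a P m 0 0⌉₊ ≤ m ^ J := by
  have hlam := hM.lam_pos
  set J := ⌈M.beta⌉₊ + 1
  refine ⟨J + 1, ?_⟩
  filter_upwards [hthr.eventually_pos hch, hthr.a_bounds hch,
    hch.tendsto_inv_detectable.eventually_le_const (show (0 : ℝ) < 1 by norm_num),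
    tendsto_natCast_atTop_atTop.eventually_ge_atTop (4 * M.lam + 4)]
    with m ⟨h1, h2, h3, h4, h5⟩ ⟨_, _, h6, _⟩ h7 h8
  have hm1 : (1 : ℝ) ≤ m := by exact_mod_cast h1
  have hm0 : (0 : ℝ) < m := by linarith
  refine Nat.ceil_le.2 ?_
  have hlead : leadA P M m ≤ M.lam * (m : ℝ) ^ J + (m : ℝ) ^ J := by
    unfold leadA
    have e1 : (m : ℝ) ^ M.beta ≤ (m : ℝ) ^ J := by
      rw [← Real.rpow_natCast]
      refine Real.rpow_le_rpow_of_exponent_le hm1 ?_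
      exact (Nat.le_ceil _).trans (by exact_mod_cast Nat.le_succ _)
    have e2 : (m : ℝ) ≤ (m : ℝ) ^ J := le_self_pow₀ hm1 (by omega)
    have e3 : M.c m * m / M.signal P m ≤ 1 * (m : ℝ) ^ J := by
      calc M.c m * m / M.signal P m = M.c m / M.signal P m * m := by ring
        _ ≤ _ := by gcongr
    have := kstar_le hM m
    have : M.lam * (m : ℝ) ^ M.beta ≤ M.lam * (m : ℝ) ^ J := by gcongr
    linarith
  push_cast
  calc 2 * M.a P m 0 0 ≤ (4 * M.lam + 4) * (m : ℝ) ^ J := by linarith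
    _ ≤ m * (m : ℝ) ^ J := by gcongr
    _ = _ := by ring

/-- If `β < 1`, then `k* / √(m a_m) → 0`. -/
lemma ThresholdAssumption.tendsto_kstar_div_sqrt (hthr : M.ThresholdAssumption P)
    (hch : M.ChangeAssumption P) (hM : M.Standing P) (hβ : M.beta < 1) :
    Tendsto (fun m => (M.kstar m : ℝ) / (√(m : ℝ) * √(M.a P m 0 0))) atTop (𝓝 0) := by
  have hlam := hM.lam_pos
  have ht : Tendsto (fun m : ℕ => √(M.lam * (m : ℝ) ^ (-(1 - M.beta)))) atTop (𝓝 0) := by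
    have := ((tendsto_rpow_neg_atTop (show 0 < 1 - M.beta by linarith)).comp
      (tendsto_natCast_atTop_atTop (R := ℝ))).const_mul M.lam
    rw [mul_zero] at this
    simpa [Function.comp_def] using (Real.continuous_sqrt.tendsto _).comp this
  refine tendsto_of_tendsto_of_tendsto_of_le_of_le' tendsto_const_nhds ht
    (Eventually.of_forall fun m => by positivity) ?_
  filter_upwards [hthr.eventually_pos hch, hthr.a_bounds hch] with m ⟨h1, h2, h3, h4, h5⟩
      ⟨h6, h7, h8, h9⟩
  have hm0 : (0 : ℝ) < m := by exact_mod_cast h1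
  have ha : 0 < M.a P m 0 0 := h9.trans_le h7
  have hK : (M.kstar m : ℝ) ≤ M.a P m 0 0 := by
    refine le_trans ?_ h7
    unfold leadA
    have : 0 < M.c m * m / M.signal P m := by positivity
    linarith
  refine Real.le_sqrt_of_sq_le ?_
  rw [div_pow, mul_pow, Real.sq_sqrt hm0.le, Real.sq_sqrt ha.le, div_le_iff₀ (by positivity)]
  calc (M.kstar m : ℝ) ^ 2 = M.kstar m * M.kstar m := by ring
    _ ≤ (M.lam * (m : ℝ) ^ M.beta) * M.a P m 0 0 := by
        gcongr; exact kstar_le hM m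
    _ = M.lam * ((m : ℝ) ^ (-(1 - M.beta)) * m) * M.a P m 0 0 := by
        congr 2
        nth_rewrite 3 [← Real.rpow_one (m : ℝ)]
        rw [← Real.rpow_add hm0]; congr 1; ring
    _ = _ := by ring

/-- This ratio is the order of the displacement of a_m, in units of b_m, when S_1* is replaced by 0.
The summand with m is at most the square root of c_m / (√m |Δ_m|), since a_m ≥ c_m m / (√m |Δ_m|).
The summand with k* uses k* ≤ a_m and yields the power m^((β-1)/2). -/
lemma NotTooLate.tendsto_ratio (hN : M.NotTooLate P) (hthr : M.ThresholdAssumption P)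
    (hch : M.ChangeAssumption P) (hM : M.Standing P) :
    Tendsto (fun m => M.c m * (m + M.kstar m) / (M.signal P m * (√(m : ℝ) * √(M.a P m 0 0))))
      atTop (𝓝 0) := by
  have hlam := hM.lam_pos
  have ht : Tendsto (fun m : ℕ => √(M.c m / M.signal P m) + √M.lam *
      (M.c m / (√(m : ℝ) * |M.Delta P m|) * max 1 ((m : ℝ) ^ ((M.beta - 1) / 2))))
      atTop (𝓝 0) := by
    have h1 := (Real.continuous_sqrt.tendsto _).comp hch.tendsto_inv_detectable
    have h2 := h1.add (Tendsto.const_mul (√M.lam) hN)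
    simpa [Function.comp_def] using h2
  refine tendsto_of_tendsto_of_tendsto_of_le_of_le' tendsto_const_nhds ht ?_ ?_
  · filter_upwards [hthr.eventually_pos hch] with m ⟨h1, h2, h3, h4, h5⟩
    positivity
  filter_upwards [hthr.eventually_pos hch, hthr.a_bounds hch] with m ⟨h1, h2, h3, h4, h5⟩
      ⟨h6, h7, h8, h9⟩
  have hm0 : (0 : ℝ) < m := by exact_mod_cast h1
  have hsm := Real.sqrt_pos.2 hm0
  have hsq : √(m : ℝ) ^ 2 = m := Real.sq_sqrt hm0.le
  have ha : 0 < M.a P m 0 0 := h9.trans_le h7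
  have hsa := Real.sqrt_pos.2 ha
  have hsqa : √(M.a P m 0 0) ^ 2 = M.a P m 0 0 := Real.sq_sqrt ha.le
  have hcd : 0 < M.c m / M.signal P m := by positivity
  have hK : (M.kstar m : ℝ) ≤ M.a P m 0 0 := by
    refine le_trans ?_ h7
    unfold leadA
    have : 0 < M.c m * m / M.signal P m := by positivity
    linarith
  have hA : M.c m * m / M.signal P m ≤ M.a P m 0 0 := le_trans (by simp [leadA]) h7
  have e : M.c m * (m + M.kstar m) / (M.signal P m * (√(m : ℝ) * √(M.a P m 0 0)))
      = M.c m / M.signal P m * (√(m : ℝ) / √(M.a P m 0 0))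
        + M.c m / M.signal P m * (M.kstar m / (√(m : ℝ) * √(M.a P m 0 0))) := by
    field_simp
    rw [hsq]
  rw [e]
  refine add_le_add ?_ ?_
  · refine Real.le_sqrt_of_sq_le ?_
    rw [mul_pow, div_pow (√(m : ℝ)), hsq, hsqa]
    calc (M.c m / M.signal P m) ^ 2 * (m / M.a P m 0 0)
        = (M.c m / M.signal P m) * ((M.c m * m / M.signal P m) / M.a P m 0 0) := by ring
      _ ≤ (M.c m / M.signal P m) * 1 := by
          gcongr
          rwa [div_le_one ha]
      _ = _ := mul_one _
  · rw [← signal, mul_left_comm]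
    gcongr
    calc (M.kstar m : ℝ) / (√(m : ℝ) * √(M.a P m 0 0))
        ≤ √(M.lam * (m : ℝ) ^ (M.beta - 1)) := by
          refine Real.le_sqrt_of_sq_le ?_
          rw [div_pow, mul_pow, hsq, hsqa, div_le_iff₀ (by positivity)]
          calc (M.kstar m : ℝ) ^ 2 = M.kstar m * M.kstar m := by ring
            _ ≤ (M.lam * (m : ℝ) ^ M.beta) * M.a P m 0 0 := by
                gcongr; exact kstar_le hM m
            _ = _ := by
                rw [Real.rpow_sub_one hm0.ne']
                field_simp
      _ = √M.lam * (m : ℝ) ^ ((M.beta - 1) / 2) := by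
          rw [Real.sqrt_mul hlam.le, Real.sqrt_eq_rpow ((m : ℝ) ^ _), ← Real.rpow_mul hm0.le]
          congr 2; ring
      _ ≤ √M.lam * max 1 ((m : ℝ) ^ ((M.beta - 1) / 2)) := by
          gcongr; exact le_max_right _ _

lemma ChangeAssumption.notTooLate_of_le_one (hch : M.ChangeAssumption P) (hβ : M.beta ≤ 1) :
    M.NotTooLate P := by
  refine hch.tendsto_inv_detectable.congr' ?_
  filter_upwards [eventually_ge_atTop 1] with m hm
  have : (m : ℝ) ^ ((M.beta - 1) / 2) ≤ 1 :=
    Real.rpow_le_one_of_one_le_of_nonpos (by exact_mod_cast hm) (by linarith)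
  rw [max_eq_left this, mul_one, signal]

lemma notTooLate_iff_of_one_lt (hβ : 1 < M.beta) : M.NotTooLate P ↔
    Tendsto (fun m : ℕ => M.c m * (m : ℝ) ^ (M.beta / 2 - 1) / |M.Delta P m|) atTop (𝓝 0) := by
  refine tendsto_congr' ?_
  filter_upwards [eventually_ge_atTop 1] with m hm
  have hm0 : (0 : ℝ) < m := by exact_mod_cast hm
  have : 1 ≤ (m : ℝ) ^ ((M.beta - 1) / 2) :=
    Real.one_le_rpow (by exact_mod_cast hm) (by linarith)
  rw [max_eq_right this, show M.beta / 2 - 1 = (M.beta - 1) / 2 - 1 / 2 by ring,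
    Real.rpow_sub hm0, ← Real.sqrt_eq_rpow]
  field_simp

end Model

/-! ### The first crossing time, path by path. -/

/-- Deterministic localization of the first crossing time of the detector. -/
lemma exists_first_crossing {K N : ℕ} {q Dl A a0 b ra U η δ C : ℝ} {g thr T R : ℕ → ℝ}
    (hDl : 0 < Dl) (hra : 0 < ra) (hb : b = ra / Dl) (hη : 0 < η) (hδ : δ ≤ 1) (ha0 : 0 < a0)
    (hδ0 : 0 ≤ δ)
    (hg : ∀ k, K < k → g k = thr k + q * Dl * (k - A) + T k + R k)
    (hlow : ∀ k, K < k → k ≤ N → -thr k ≤ g k)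
    (hR : ∀ k, K < k → k ≤ N → |R k| ≤ η / 16 * ra)
    (hT : ∀ k, K < k → k ≤ N → |T k| ≤ C * ra)
    (hW : ∀ k : ℕ, K < k → |(k : ℝ) - a0| ≤ δ * a0 → |T k + U * ra| ≤ η / 16 * ra)
    (hU : |U| ≤ C) (hq : 7 / 8 ≤ q) (hqC : |q - 1| * C ≤ η / 8)
    (hA : |A - a0| ≤ δ / 4 * a0) (hbC : (C + η) * b + 1 ≤ δ / 4 * a0) (hKA : K + C * b ≤ A)
    (hbη : 1 ≤ η / 2 * b) (hN : 2 * a0 ≤ N) :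
    ∃ n : ℕ, IsLeast {k | K < k ∧ thr k < |g k|} n ∧ |((n : ℝ) - A) / b - U| ≤ η := by
  have hb0 : 0 < b := by rw [hb]; positivity
  have hDb : Dl * b = ra := by rw [hb]; field_simp
  have hg' : ∀ k : ℕ, K < k → g k = thr k + q * (((k : ℝ) - A) / b) * ra + T k + R k := by
    intro k hk
    rw [hg k hk, ← hDb]; field_simp
  rw [abs_le] at hU hA
  have hqU : |(q - 1) * U| ≤ η / 8 := by
    rw [abs_mul]
    refine le_trans ?_ hqC
    gcongr
    rwa [abs_le]
  rw [abs_le] at hqU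
  have hδa : 0 ≤ δ * a0 := by positivity
  have hδa1 : δ * a0 ≤ a0 := mul_le_of_le_one_left ha0.le hδ
  have hUb : U * b ≤ C * b := by gcongr; exact hU.2
  have hUb' : -C * b ≤ U * b := by gcongr; exact hU.1
  have hqη : 7 / 8 * η ≤ q * η := by gcongr
  have hηb : 0 < η * b := by positivity
  -- existence of a crossing
  have hx0 : (K : ℝ) < A + (U + η / 2) * b := by linarith
  -- Half of the tolerance is spent on the drift at `k₁`: it overcomes the slope error η/8, the
  -- fluctuation η/16 and the remainder η/16. The other half absorbs the rounding, since 1 ≤ (η/2)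
  -- b.
  set k₁ := ⌈A + (U + η / 2) * b⌉₊ with hk₁
  have hk₁l : A + (U + η / 2) * b ≤ k₁ := Nat.le_ceil _
  have hk₁u : (k₁ : ℝ) < A + (U + η / 2) * b + 1 :=
    Nat.ceil_lt_add_one ((Nat.cast_nonneg K).trans hx0.le)
  have hKk₁ : K < k₁ := by exact_mod_cast hx0.trans_le hk₁l
  have hwin₁ : |(k₁ : ℝ) - a0| ≤ δ * a0 := by
    rw [abs_le]; constructor <;> linarith
  have hk₁N : k₁ ≤ N := by
    rw [abs_le] at hwin₁
    have : (k₁ : ℝ) ≤ N := by linarith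
    exact_mod_cast this
  have hcross : thr k₁ < |g k₁| := by
    refine lt_of_lt_of_le ?_ (le_abs_self _)
    have h1 := hW k₁ hKk₁ hwin₁
    have h2 := hR k₁ hKk₁ hk₁N
    rw [abs_le] at h1 h2
    have h3 : U + η / 2 ≤ ((k₁ : ℝ) - A) / b := by
      rw [le_div_iff₀ hb0]; linarith
    have h4 : q * (U + η / 2) * ra ≤ q * (((k₁ : ℝ) - A) / b) * ra := by gcongr
    have h5 : (U + η / 4) * ra ≤ q * (U + η / 2) * ra := by
      gcongr
      linarith
    rw [hg' k₁ hKk₁]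
    have : 0 < η * ra := by positivity
    linarith
  have hne : {k | K < k ∧ thr k < |g k|}.Nonempty := ⟨k₁, hKk₁, hcross⟩
  refine ⟨sInf {k | K < k ∧ thr k < |g k|}, ⟨Nat.sInf_mem hne, fun _ h => Nat.sInf_le h⟩, ?_⟩
  obtain ⟨hKn, hn⟩ := Nat.sInf_mem hne
  have hnk₁ : sInf {k | K < k ∧ thr k < |g k|} ≤ k₁ := Nat.sInf_le ⟨hKk₁, hcross⟩
  set n := sInf {k | K < k ∧ thr k < |g k|}
  have hnk₁' : (n : ℝ) ≤ k₁ := by exact_mod_cast hnk₁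
  rw [abs_le]
  constructor
  -- A first crossing earlier than A + (U - η) b is contradictory: the signed detector would lie
  -- below the threshold and, by `hlow`, above its negative. The cases are inside the window, where
  -- the noise is known up to η/16, and outside it, where only the crude bound C is available.
  · by_contra hlt
    rw [not_le] at hlt
    have h3 : ((n : ℝ) - A) / b ≤ U - η := by linarith
    have hnN : n ≤ N := hnk₁.trans hk₁N
    have h2 := hR n hKn hnN
    rw [abs_le] at h2
    refine absurd hn (not_lt.2 (abs_le.2 ⟨hlow n hKn hnN, ?_⟩))
    rw [hg' n hKn]
    have hηra : 0 < η * ra := by positivity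
    by_cases hw : |(n : ℝ) - a0| ≤ δ * a0
    · have h1 := hW n hKn hw
      rw [abs_le] at h1
      have h4 : q * (((n : ℝ) - A) / b) * ra ≤ q * (U - η) * ra := by gcongr
      have h5 : q * (U - η) * ra ≤ (U - η / 2) * ra := by
        gcongr
        linarith
      linarith
    · have h1 := hT n hKn hnN
      rw [abs_le] at h1
      have hlow' : (n : ℝ) - a0 < -(δ * a0) := by
        rw [abs_le, not_and_or, not_le, not_le] at hw
        rw [abs_le] at hwin₁
        rcases hw with h | h
        · exact h
        · linarith
      -- To the left of the window n lies at least (3/4) δ a0 below A, and δ a0 / 4 exceeds (C + η)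
      -- b.
      have h3 : ((n : ℝ) - A) / b ≤ -(3 * (C + η)) := by
        rw [div_le_iff₀ hb0]
        linarith
      have hC0 : 0 ≤ C := by linarith
      have h4 : q * (((n : ℝ) - A) / b) * ra ≤ q * (-(3 * (C + η))) * ra := by gcongr
      have h5 : q * (-(3 * (C + η))) * ra ≤ (-(2 * (C + η))) * ra := by
        gcongr
        have h7 : 7 / 8 * C ≤ q * C := by gcongr
        linarith
      have h6 : 0 ≤ C * ra := by positivity
      linarith
  · have : ((n : ℝ) - A) / b ≤ U + η := by
      rw [div_le_iff₀ hb0]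
      linarith
    linarith

lemma BoundedInProb.mul_bounded {Ω : Type*} [MeasurableSpace Ω] {P : Measure Ω} {X : ℕ → Ω → ℝ}
    (h : BoundedInProb P X) {t : ℕ → ℝ} {B : ℝ} (ht : ∀ᶠ m in atTop, |t m| ≤ B) :
    BoundedInProb P fun m ω => t m * X m ω := by
  intro ε hε
  obtain ⟨C, hC0, hC⟩ := h.exists_pos hε
  refine ⟨B * C, ?_⟩
  filter_upwards [hC, ht] with m hm htm
  refine (measure_mono fun ω (hω : B * C < |t m * X m ω|) => ?_).trans hm
  by_contra hlt
  have hlt : |X m ω| ≤ C := not_lt.1 hlt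
  rw [abs_mul] at hω
  have : |t m| * |X m ω| ≤ B * C := mul_le_mul htm hlt (abs_nonneg _) ((abs_nonneg _).trans htm)
  linarith

lemma abs_sign_le_one (x : ℝ) : |Real.sign x| ≤ 1 := by
  rcases Real.sign_apply_eq x with h | h | h <;> simp [h]

/-! ### Linear sums over windows and the negligible remainder. -/

namespace Model

variable {Ω : Type*} [MeasurableSpace Ω] {P : Measure Ω} {M : Model Ω}

section Windows

variable [IsProbabilityMeasure P]

lemma RegularityAssumption.boundedInProb_windowMax (hreg : M.RegularityAssumption P)
    (hM : M.Standing P) {L : ℕ → ℕ} (hL : Tendsto L atTop atTop) (s : ℕ → ℕ) :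
    BoundedInProb P fun m ω =>
      (√(L m : ℝ))⁻¹ * windowMax (fun j => M.h2 P (M.Y j ω)) (s m) (L m) := by
  refine boundedInProb_windowMax_of_stationary (X := fun _ => M.Y) (f := fun _ => M.h2 P)
    (s := fun m => m) (Eventually.of_forall fun _ => hM.stationary_Y)
    (fun _ => hM.measurable_h2) ?_ s
  refine (hreg.maximal L hL).mono (Eventually.of_forall fun m ω => ?_)
  rw [maxAbs_const_mul, windowMax, abs_of_nonneg (by positivity : 0 ≤ (√(L m : ℝ))⁻¹)]

/-- The Hájek–Rényi assumption at α = 0 is a plain maximal bound, and stationarity frees it from the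
starting point m + k*. -/
lemma StoppingAssumption.boundedInProb_windowMax {σ σs : ℝ≥0} {D : ℝ≥0∞}
    (hpost : M.StoppingAssumption P σ σs D)
    (hM : M.Standing P) {L : ℕ → ℕ} (hL : Tendsto L atTop atTop) (s : ℕ → ℕ) :
    BoundedInProb P fun m ω =>
      (√(L m : ℝ))⁻¹ * windowMax (fun j => M.h2Star P m (M.Z m j ω)) (s m) (L m) := by
  refine boundedInProb_windowMax_of_stationary (X := M.Z) (f := M.h2Star P)
    (s := fun m => m + M.kstar m) ?_ hM.measurable_h2Star ?_ s
  · filter_upwards [eventually_ge_atTop 1] with m hm using hM.stationary_Z m hm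
  refine (hpost.hajekRenyi 0 le_rfl (by norm_num) L hL).mono (Eventually.of_forall fun m ω => ?_)
  simp only [sub_zero, Real.rpow_zero, mul_one, ← Real.sqrt_eq_rpow]
  rw [maxAbs_const_mul, windowMax, abs_of_nonneg (by positivity : 0 ≤ (√(L m : ℝ))⁻¹)]

omit [IsProbabilityMeasure P] in
-- Fluctuations over L_m terms have order √L_m, hence are negligible at scale √a_m once L_m =
-- o(a_m).
lemma vanish_of_window {w : ℕ → Ω → ℝ} {L : ℕ → ℕ} {a : ℕ → ℝ} (hL : Tendsto L atTop atTop)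
    (h : BoundedInProb P fun m ω => (√(L m : ℝ))⁻¹ * w m ω)
    (hLa : Tendsto (fun m => (L m : ℝ) / a m) atTop (𝓝 0)) :
    VanishInProb P fun m ω => (√(a m))⁻¹ * w m ω := by
  have ht := (Real.continuous_sqrt.tendsto _).comp hLa
  rw [Real.sqrt_zero] at ht
  refine (h.vanish_mul ht).mono ?_
  filter_upwards [hL.eventually_ge_atTop 1] with m hm ω
  have : 0 < √(L m : ℝ) := Real.sqrt_pos.2 (by exact_mod_cast hm)
  simp only [Function.comp, Real.sqrt_div (Nat.cast_nonneg (L m))]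
  refine le_of_eq ?_
  congr 1
  field_simp

omit [IsProbabilityMeasure P] in
lemma bounded_of_window {w : ℕ → Ω → ℝ} {L : ℕ → ℕ} {a : ℕ → ℝ} {B : ℝ}
    (hL : Tendsto L atTop atTop)
    (h : BoundedInProb P fun m ω => (√(L m : ℝ))⁻¹ * w m ω)
    (hLa : ∀ᶠ m in atTop, (L m : ℝ) / a m ≤ B) :
    BoundedInProb P fun m ω => (√(a m))⁻¹ * w m ω := by
  have ht : ∀ᶠ m in atTop, |√((L m : ℝ) / a m)| ≤ √B := by
    filter_upwards [hLa] with m hm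
    rw [abs_of_nonneg (Real.sqrt_nonneg _)]
    exact Real.sqrt_le_sqrt hm
  refine (h.mul_bounded ht).mono ?_
  filter_upwards [hL.eventually_ge_atTop 1] with m hm ω
  have : 0 < √(L m : ℝ) := Real.sqrt_pos.2 (by exact_mod_cast hm)
  simp only [Real.sqrt_div (Nat.cast_nonneg (L m))]
  refine le_of_eq ?_
  congr 1
  field_simp

end Windows

/-- An upper bound for the range of the delay time. -/
noncomputable def horizon (P : Measure Ω) (M : Model Ω) (m : ℕ) : ℕ := ⌈2 * M.a P m 0 0⌉₊

lemma ThresholdAssumption.tendsto_horizon (hthr : M.ThresholdAssumption P)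
    (hch : M.ChangeAssumption P) : Tendsto (horizon P M) atTop atTop :=
  tendsto_nat_ceil_atTop.comp ((hthr.tendsto_a hch).const_mul_atTop two_pos)

lemma ThresholdAssumption.horizon_le (hthr : M.ThresholdAssumption P)
    (hch : M.ChangeAssumption P) : ∀ᶠ m in atTop, (horizon P M m : ℝ) ≤ 3 * M.a P m 0 0 := by
  filter_upwards [(hthr.tendsto_a hch).eventually_ge_atTop 1] with m hm
  have := Nat.ceil_lt_add_one (show 0 ≤ 2 * M.a P m 0 0 by linarith)
  unfold horizon
  linarith

lemma two_pow_clog_le {n : ℕ} (hn : 2 ≤ n) : 2 ^ Nat.clog 2 n ≤ 2 * n := by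
  have h1 := Nat.pow_pred_clog_lt_self (b := 2) (by norm_num) (x := n) (by omega)
  have h2 : 0 < Nat.clog 2 n := Nat.clog_pos (by norm_num) hn
  obtain ⟨p, hp⟩ := Nat.exists_eq_succ_of_ne_zero h2.ne'
  rw [hp] at h1 ⊢
  simp only [Nat.pred_succ, Nat.succ_eq_add_one, pow_succ] at h1 ⊢
  omega

/-- The remainder terms are negligible up to the horizon. -/
lemma ThresholdAssumption.vanish_remainder (hthr : M.ThresholdAssumption P)
    (hch : M.ChangeAssumption P) (hM : M.Standing P) {ξ : ℕ → ℕ → Ω → ℝ}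
    (hξ : ∀ m j, Measurable (ξ m j)) {u : ℕ → ℝ}
    (hu : Tendsto (fun m : ℕ => u m / (m : ℝ) ^ 2 * Real.log m ^ 2) atTop (𝓝 0))
    (h : ∀ m k₁ k₂ : ℕ, 1 ≤ m → m + 1 ≤ k₁ → k₁ ≤ k₂ →
      ∫⁻ ω, ENNReal.ofReal ((∑ j ∈ Finset.Icc k₁ k₂, ξ m j ω) ^ 2) ∂P
        ≤ ENNReal.ofReal (u m * ((k₂ : ℝ) - k₁ + 1)))
    {s : ℕ → ℕ} (hs : ∀ m, m ≤ s m) :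
    VanishInProb P fun m ω => (√(M.a P m 0 0))⁻¹ *
      (windowMax (fun j => ξ m j ω) (s m) (horizon P M m) / m) := by
  intro η hη
  obtain ⟨J, hJ⟩ := hthr.exists_horizon_le_pow hch hM
  have hl2 : 0 < Real.log 2 := Real.log_pos one_lt_two
  set B := (J / Real.log 2 + 2)
  -- The factor 6 bounds 2^p / a_m, since 2^p is at most twice the horizon and the horizon at most 3
  -- a_m. `B` bounds (p + 1) / log m through (p - 1) log 2 ≤ J log m.
  have ht : Tendsto (fun m : ℕ => ENNReal.ofReal
      (6 * B ^ 2 / η ^ 2 * |u m / (m : ℝ) ^ 2 * Real.log m ^ 2|)) atTop (𝓝 0) := by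
    have h1 := (hu.abs).const_mul (6 * B ^ 2 / η ^ 2)
    rw [abs_zero, mul_zero] at h1
    simpa [Function.comp_def] using (ENNReal.continuous_ofReal.tendsto 0).comp h1
  refine tendsto_of_tendsto_of_tendsto_of_le_of_le' tendsto_const_nhds ht
    (Eventually.of_forall fun _ => zero_le) ?_
  have hlog : ∀ᶠ m : ℕ in atTop, 1 ≤ Real.log m :=
    (Real.tendsto_log_atTop.comp tendsto_natCast_atTop_atTop).eventually_ge_atTop 1
  filter_upwards [hthr.eventually_pos hch, hJ, hthr.horizon_le hch, hlog,
    (hthr.tendsto_horizon hch).eventually_ge_atTop 2, (hthr.tendsto_a hch).eventually_gt_atTop 0]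
    with m ⟨h1, _⟩ h2 h3 h4 h5 h6
  have hm0 : (0 : ℝ) < m := by exact_mod_cast h1
  have hsa := Real.sqrt_pos.2 h6
  set p := Nat.clog 2 (horizon P M m) with hp
  have hpow : (2 : ℝ) ^ p ≤ 6 * M.a P m 0 0 := by
    have : ((2 ^ p : ℕ) : ℝ) ≤ ((2 * horizon P M m : ℕ) : ℝ) := by
      exact_mod_cast two_pow_clog_le h5
    push_cast at this
    linarith
  have hplog : (p : ℝ) + 1 ≤ B * Real.log m := by
    have hp0 : 0 < p := Nat.clog_pos (by norm_num) h5
    have e1 : 2 ^ (p - 1) ≤ m ^ J :=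
      (Nat.pow_pred_clog_lt_self (b := 2) (by norm_num) (by omega)).le.trans h2
    have e2 : ((2 : ℝ) ^ (p - 1)) ≤ (m : ℝ) ^ J := by exact_mod_cast e1
    have e3 := Real.log_le_log (by positivity) e2
    rw [Real.log_pow, Real.log_pow, Nat.cast_sub (by omega), Nat.cast_one] at e3
    have e4 : (p : ℝ) - 1 ≤ J * Real.log m / Real.log 2 := by
      rw [le_div_iff₀ hl2]; exact e3
    have e5 : B * Real.log m = J * Real.log m / Real.log 2 + 2 * Real.log m := by
      simp only [B]; ring
    linarith
  have hbd : ∀ k₁ k₂, m + 1 ≤ k₁ → k₁ ≤ k₂ →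
      ∫⁻ ω, ENNReal.ofReal ((∑ j ∈ Finset.Icc k₁ k₂, ξ m j ω) ^ 2) ∂P
        ≤ ENNReal.ofReal (|u m| * ((k₂ : ℝ) - k₁ + 1)) := by
    intro k₁ k₂ hk₁ hk₂
    refine (h m k₁ k₂ h1 hk₁ hk₂).trans (ENNReal.ofReal_le_ofReal ?_)
    have : (k₁ : ℝ) ≤ k₂ := by exact_mod_cast hk₂
    exact mul_le_mul_of_nonneg_right (le_abs_self _) (by linarith)
  have hη' : 0 < η * √(M.a P m 0 0) * m := by positivity
  have key := measure_windowMax_le (hξ m) (abs_nonneg (u m)) hbd (hs m)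
    (Nat.le_pow_clog one_lt_two (horizon P M m)) hη'
  calc P {ω | η < |(√(M.a P m 0 0))⁻¹ *
          (windowMax (fun j => ξ m j ω) (s m) (horizon P M m) / m)|}
      = P {ω | η * √(M.a P m 0 0) * m
          < windowMax (fun j => ξ m j ω) (s m) (horizon P M m)} := by
        congr 1
        ext ω
        have hw := windowMax_nonneg (fun j => ξ m j ω) (s m) (horizon P M m)
        simp only [Set.mem_ofPred_eq]
        rw [abs_of_nonneg (by positivity), inv_mul_eq_div, lt_div_iff₀ hsa, lt_div_iff₀ hm0]
    _ ≤ _ := key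
    _ ≤ _ := by
        refine ENNReal.ofReal_le_ofReal ?_
        rw [mul_pow, mul_pow, Real.sq_sqrt h6.le, abs_mul, abs_div, abs_of_pos (pow_pos hm0 2),
          abs_of_nonneg (sq_nonneg (Real.log m))]
        calc |u m| * 2 ^ p * ((p : ℝ) + 1) ^ 2 / (η ^ 2 * M.a P m 0 0 * m ^ 2)
            ≤ |u m| * (6 * M.a P m 0 0) * (B * Real.log m) ^ 2
              / (η ^ 2 * M.a P m 0 0 * m ^ 2) := by gcongr
          _ = _ := by field_simp

end Model

/-! ### Localization of the delay time around a_m. -/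

namespace Model

variable {Ω : Type*} [MeasurableSpace Ω] {P : Measure Ω} {M : Model Ω}

/-- The radius, relative to `a_m`, of a window around `a_m` in which the delay time is located. -/
noncomputable def radius (P : Measure Ω) (M : Model Ω) (m : ℕ) : ℝ :=
  √(M.signal P m)⁻¹ + √(|M.Delta P m| * √(M.a P m 0 0))⁻¹

lemma radius_nonneg (m : ℕ) : 0 ≤ radius P M m := by unfold radius; positivity

lemma ThresholdAssumption.tendsto_radius (hthr : M.ThresholdAssumption P)
    (hch : M.ChangeAssumption P) : Tendsto (radius P M) atTop (𝓝 0) := by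
  have h0 := Real.continuous_sqrt.tendsto 0
  rw [Real.sqrt_zero] at h0
  have h := (h0.comp (hthr.tendsto_signal hch).inv_tendsto_atTop).add
    (h0.comp (hthr.tendsto_delta_mul_sqrt_a hch).inv_tendsto_atTop)
  rw [add_zero] at h
  exact h

/-- With ρ = (|Δ_m| √a_m)⁻¹ we have b_m = ρ a_m, whereas the radius contains √ρ. Since ρ → 0, the
window is longer than any fixed multiple of b_m. -/
lemma ThresholdAssumption.eventually_mul_b_le (hthr : M.ThresholdAssumption P)
    (hch : M.ChangeAssumption P) (C : ℝ) :
    ∀ᶠ m in atTop, C * M.b P m 0 0 + 1 ≤ radius P M m / 4 * M.a P m 0 0 := by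
  have h0 := Real.continuous_sqrt.tendsto 0
  rw [Real.sqrt_zero] at h0
  have h1 : Tendsto (fun m => √(|M.Delta P m| * √(M.a P m 0 0))⁻¹) atTop (𝓝 0) :=
    h0.comp (hthr.tendsto_delta_mul_sqrt_a hch).inv_tendsto_atTop
  have h2 : ∀ᶠ m in atTop, √(|M.Delta P m| * √(M.a P m 0 0))⁻¹ < 1 / (4 * (|C| + 1)) :=
    h1.eventually_lt_const (by positivity)
  filter_upwards [h2, hthr.eventually_pos hch, (hthr.tendsto_a hch).eventually_gt_atTop 0,
    (hthr.tendsto_b hch).eventually_ge_atTop 1] with m h3 ⟨_, _, _, _, h5⟩ h6 h7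
  have hsa := Real.sqrt_pos.2 h6
  set ρ := (|M.Delta P m| * √(M.a P m 0 0))⁻¹ with hρ
  have hρ0 : 0 < ρ := by positivity
  have hb : M.b P m 0 0 = √ρ * √ρ * M.a P m 0 0 := by
    rw [Real.mul_self_sqrt hρ0.le, hρ, b]
    nth_rewrite 3 [← Real.mul_self_sqrt h6.le]
    field_simp
  have h8 : √ρ ≤ radius P M m := by
    unfold radius
    have := Real.sqrt_nonneg (M.signal P m)⁻¹
    linarith
  have hC := le_abs_self C
  calc C * M.b P m 0 0 + 1 ≤ (|C| + 1) * M.b P m 0 0 := by nlinarith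
    _ = √ρ * ((|C| + 1) * √ρ) * M.a P m 0 0 := by rw [hb]; ring
    _ ≤ √ρ * ((|C| + 1) * (1 / (4 * (|C| + 1)))) * M.a P m 0 0 := by gcongr
    _ = √ρ / 4 * M.a P m 0 0 := by field_simp
    _ ≤ _ := by gcongr

lemma ThresholdAssumption.eventually_one_le_radius_mul (hthr : M.ThresholdAssumption P)
    (hch : M.ChangeAssumption P) : ∀ᶠ m in atTop, 1 ≤ radius P M m * M.a P m 0 0 := by
  filter_upwards [hthr.eventually_mul_b_le hch 0] with m hm
  linarith

lemma ThresholdAssumption.tendsto_radius_mul (hthr : M.ThresholdAssumption P)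
    (hch : M.ChangeAssumption P) :
    Tendsto (fun m => radius P M m * M.a P m 0 0) atTop atTop := by
  refine tendsto_atTop_mono' _ ?_ (hthr.tendsto_b hch)
  filter_upwards [hthr.eventually_mul_b_le hch 1, (hthr.tendsto_b hch).eventually_ge_atTop 0]
    with m hm hb
  linarith

lemma ThresholdAssumption.eventually_abs_slope_sub_one_le (hthr : M.ThresholdAssumption P)
    (hch : M.ChangeAssumption P) (C : ℝ) {η : ℝ} (hη : 0 < η) :
    ∀ᶠ m in atTop, ∀ sStar, |sStar| ≤ C → |slope P M m sStar - 1| ≤ η := by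
  have h1 : Tendsto (fun m => M.c m / M.signal P m + C * (M.signal P m)⁻¹) atTop (𝓝 0) := by
    simpa using hch.tendsto_inv_detectable.add
      ((hthr.tendsto_signal hch).inv_tendsto_atTop.const_mul C)
  filter_upwards [h1.eventually_lt_const hη, hthr.eventually_pos hch] with m h2 ⟨_, h3, h4, _⟩ s hs
  have e : slope P M m s - 1
      = -(M.c m / M.signal P m) + s * Real.sign (M.Delta P m) * (M.signal P m)⁻¹ := by
    unfold slope; ring
  rw [e]
  refine (abs_add_le _ _).trans ?_
  rw [abs_neg, abs_of_pos (show 0 < M.c m / M.signal P m by positivity), abs_mul, abs_mul,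
    abs_of_pos (inv_pos.2 h4)]
  have : |s| * |Real.sign (M.Delta P m)| ≤ C * 1 :=
    mul_le_mul hs (abs_sign_le_one _) (abs_nonneg _) ((abs_nonneg _).trans hs)
  have : |s| * |Real.sign (M.Delta P m)| * (M.signal P m)⁻¹ ≤ C * 1 * (M.signal P m)⁻¹ := by
    gcongr
  linarith

lemma ThresholdAssumption.kstar_le_a (hthr : M.ThresholdAssumption P)
    (hch : M.ChangeAssumption P) : ∀ᶠ m in atTop, (M.kstar m : ℝ) ≤ M.a P m 0 0 := by
  filter_upwards [hthr.eventually_pos hch, hthr.a_bounds hch] with m ⟨h1, h2, h3, _⟩ ⟨_, h7, _⟩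
  refine le_trans ?_ h7
  unfold leadA
  have : 0 ≤ M.c m * m / M.signal P m := by positivity
  linarith

/-- Subtracting the linear equations for a_m(s, s*) and a_m(0,0) leaves (k*(s* - s) - s* a_m(0,0)) /
(√m |Δ_m|) up to sign, with numerator at most 3 C a_m(0,0). Division by a slope of at least 3/4
gives 4 C. -/
lemma ThresholdAssumption.eventually_abs_a_sub_le (hthr : M.ThresholdAssumption P)
    (hch : M.ChangeAssumption P) (C : ℝ) :
    ∀ᶠ m in atTop, ∀ s sStar, |s| ≤ C → |sStar| ≤ C →
      |M.a P m s sStar - M.a P m 0 0| ≤ 4 * C * M.a P m 0 0 / M.signal P m := by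
  filter_upwards [hthr.eventually_abs_slope_sub_one_le hch C (show (0 : ℝ) < 1 / 4 by norm_num),
    hthr.eventually_pos hch, hthr.kstar_le_a hch,
    hthr.eventually_abs_slope_sub_one_le hch 0 (show (0 : ℝ) < 1 / 4 by norm_num),
    (hthr.tendsto_a hch).eventually_gt_atTop 0]
    with m hq ⟨h1, h2, h3, h4, h5⟩ hK hq0 ha s t hs ht
  have hq := hq t ht
  have hq0 := hq0 0 (by simp)
  rw [abs_le] at hq hq0
  have hC : 0 ≤ C := (abs_nonneg _).trans hs
  have e1 := slope_mul_a (s := s) h1 h4 (show slope P M m t ≠ 0 by linarith)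
  have e2 := slope_mul_a (s := 0) h1 h4 (show slope P M m 0 ≠ 0 by linarith)
  have e3 : slope P M m t * (M.a P m s t - M.a P m 0 0)
      = Real.sign (M.Delta P m) * ((M.kstar m * (t - s) - t * M.a P m 0 0) / M.signal P m) := by
    have : slope P M m t = slope P M m 0 + t * Real.sign (M.Delta P m) / M.signal P m := by
      unfold slope; ring
    rw [mul_sub, e1, this, add_mul, e2]
    ring
  have hnum : |(M.kstar m : ℝ) * (t - s) - t * M.a P m 0 0| ≤ 3 * C * M.a P m 0 0 := by
    have hts : |t - s| ≤ 2 * C := (abs_sub _ _).trans (by linarith)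
    refine (abs_sub _ _).trans ?_
    rw [abs_mul, abs_mul, abs_of_pos ha, abs_of_nonneg (Nat.cast_nonneg (M.kstar m))]
    have e4 : (M.kstar m : ℝ) * |t - s| ≤ M.a P m 0 0 * (2 * C) := by gcongr
    have e5 : |t| * M.a P m 0 0 ≤ C * M.a P m 0 0 := by gcongr
    linarith
  have habs := congrArg abs e3
  rw [abs_mul, abs_mul, abs_div, abs_of_pos h3, abs_of_pos (show 0 < slope P M m t by linarith)]
    at habs
  have h6 : slope P M m t * |M.a P m s t - M.a P m 0 0|
      ≤ 1 * (3 * C * M.a P m 0 0 / M.signal P m) := by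
    rw [habs]
    gcongr
    exact abs_sign_le_one _
  have h7 : 3 / 4 * |M.a P m s t - M.a P m 0 0|
      ≤ slope P M m t * |M.a P m s t - M.a P m 0 0| := by gcongr; linarith
  have h8 : 4 * C * M.a P m 0 0 / M.signal P m
      = 4 / 3 * (3 * C * M.a P m 0 0 / M.signal P m) := by ring
  linarith

/-- The random centre deviates by a relative error of order (√m |Δ_m|)⁻¹, while the radius contains
the square root of this quantity. -/
lemma ThresholdAssumption.eventually_abs_a_sub_le_radius (hthr : M.ThresholdAssumption P)
    (hch : M.ChangeAssumption P) (C : ℝ) :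
    ∀ᶠ m in atTop, ∀ s sStar, |s| ≤ C → |sStar| ≤ C →
      |M.a P m s sStar - M.a P m 0 0| ≤ radius P M m / 4 * M.a P m 0 0 := by
  have h0 := Real.continuous_sqrt.tendsto 0
  rw [Real.sqrt_zero] at h0
  have h1 : Tendsto (fun m => 16 * C * √(M.signal P m)⁻¹) atTop (𝓝 0) := by
    simpa [Function.comp_def] using!
      (h0.comp (hthr.tendsto_signal hch).inv_tendsto_atTop).const_mul (16 * C)
  filter_upwards [hthr.eventually_abs_a_sub_le hch C, hthr.eventually_pos hch,
    h1.eventually_lt_const one_pos, (hthr.tendsto_a hch).eventually_gt_atTop 0]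
    with m h2 ⟨_, _, h3, _⟩ h4 h5 s t hs ht
  refine (h2 s t hs ht).trans ?_
  have h6 : √(M.signal P m)⁻¹ * √(M.signal P m)⁻¹ = (M.signal P m)⁻¹ :=
    Real.mul_self_sqrt (inv_pos.2 h3).le
  have h7 : √(M.signal P m)⁻¹ ≤ radius P M m := by
    unfold radius
    have := Real.sqrt_nonneg (|M.Delta P m| * √(M.a P m 0 0))⁻¹
    linarith
  calc 4 * C * M.a P m 0 0 / M.signal P m
      = (16 * C * √(M.signal P m)⁻¹) * √(M.signal P m)⁻¹ / 4 * M.a P m 0 0 := by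
        rw [mul_assoc (16 * C), h6]; ring
    _ ≤ 1 * √(M.signal P m)⁻¹ / 4 * M.a P m 0 0 := by gcongr
    _ ≤ _ := by rw [one_mul]; gcongr

/-- `b_m` in terms of `√(m a_m)`. -/
lemma b_eq {m : ℕ} (hm : 1 ≤ m) :
    M.b P m 0 0 = √(m : ℝ) * √(M.a P m 0 0) / M.signal P m := by
  have hm0 : (0 : ℝ) < m := by exact_mod_cast hm
  have hsm := Real.sqrt_pos.2 hm0
  rw [b, signal, mul_div_mul_left _ _ hsm.ne']

/-- The centre lies beyond k* by more than the scale of the noise, so the restriction k > k* does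
not interfere with the crossing. After multiplication by the slope, this is the domination of k* and
√(m a_m) by c_m (m + k*). -/
lemma ThresholdAssumption.eventually_kstar_add_le_a (hthr : M.ThresholdAssumption P)
    (hch : M.ChangeAssumption P) (hM : M.Standing P) {C₁ C : ℝ} (hC₁ : 0 ≤ C₁) (hC : 0 ≤ C) :
    ∀ᶠ m in atTop, ∀ s sStar, |s| ≤ C₁ → |sStar| ≤ C₁ →
      M.kstar m + C * M.b P m 0 0 ≤ M.a P m s sStar := by
  have h0 : Tendsto (fun m : ℕ => C₁ * ((M.kstar m : ℝ) / (M.c m * (m + M.kstar m)))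
      + 2 * C * (√(m : ℝ) * √(M.a P m 0 0) / (M.c m * (m + M.kstar m)))) atTop (𝓝 0) := by
    simpa using ((hthr.tendsto_kstar_div hch hM).const_mul C₁).add
      ((hthr.tendsto_sqrt_div hch hM).const_mul (2 * C))
  filter_upwards [hthr.eventually_abs_slope_sub_one_le hch C₁ (show (0 : ℝ) < 1 / 4 by norm_num),
    hthr.eventually_pos hch, h0.eventually_lt_const one_pos]
    with m hq ⟨h1, h2, h3, h4, h5⟩ h6 s t hs ht
  have hq := hq t ht
  rw [abs_le] at hq
  have hm0 : (0 : ℝ) < m := by exact_mod_cast h1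
  have e1 := slope_mul_a (s := s) h1 h4 (show slope P M m t ≠ 0 by linarith)
  have e2 : slope P M m t * (M.a P m s t - M.kstar m)
      = (M.c m * (m + M.kstar m) - M.kstar m * (s * Real.sign (M.Delta P m))) / M.signal P m := by
    rw [mul_sub, e1]; unfold slope; ring
  have hKs : (M.kstar m : ℝ) * (s * Real.sign (M.Delta P m)) ≤ M.kstar m * C₁ := by
    gcongr
    refine (le_abs_self _).trans ?_
    rw [abs_mul]
    simpa using mul_le_mul hs (abs_sign_le_one (M.Delta P m)) (abs_nonneg _) hC₁
  have hden : 0 < M.c m * (m + M.kstar m) := by positivity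
  have h7 : C₁ * M.kstar m + 2 * C * (√(m : ℝ) * √(M.a P m 0 0)) ≤ M.c m * (m + M.kstar m) := by
    rw [← mul_div_assoc, ← mul_div_assoc, ← add_div, div_lt_one hden] at h6
    exact h6.le
  have h8 : slope P M m t * (C * M.b P m 0 0) ≤ slope P M m t * (M.a P m s t - M.kstar m) := by
    rw [e2]
    have hCb : 0 ≤ C * M.b P m 0 0 := by unfold b; positivity
    calc slope P M m t * (C * M.b P m 0 0) ≤ 2 * (C * M.b P m 0 0) := by
          gcongr; linarith
      _ = 2 * C * (√(m : ℝ) * √(M.a P m 0 0)) / M.signal P m := by rw [b_eq h1]; ring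
      _ ≤ _ := by gcongr; linarith
  have := le_of_mul_le_mul_left h8 (show 0 < slope P M m t by linarith)
  linarith

/-- The index around which the delay time is concentrated. -/
noncomputable def center (P : Measure Ω) (M : Model Ω) (m : ℕ) : ℕ := ⌊M.a P m 0 0⌋₊

lemma ThresholdAssumption.tendsto_center (hthr : M.ThresholdAssumption P)
    (hch : M.ChangeAssumption P) : Tendsto (center P M) atTop atTop :=
  tendsto_nat_floor_atTop.comp (hthr.tendsto_a hch)

lemma ThresholdAssumption.eventually_kstar_lt_center (hthr : M.ThresholdAssumption P)
    (hch : M.ChangeAssumption P) (hM : M.Standing P) :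
    ∀ᶠ m in atTop, M.kstar m < center P M m := by
  filter_upwards [hthr.eventually_kstar_add_le_a hch hM le_rfl zero_le_one,
    (hthr.tendsto_b hch).eventually_ge_atTop 1] with m h1 h2
  have := h1 0 0 (by simp) (by simp)
  refine Nat.lt_of_succ_le (Nat.le_floor ?_)
  push_cast
  linarith

/-- The limiting noise of the delay time. -/
noncomputable def noise (P : Measure Ω) (M : Model Ω) (m : ℕ) (ω : Ω) : ℝ :=
  -(Real.sign (M.Delta P m) *
    ((√(M.a P m 0 0))⁻¹ * (M.preSum P m ω + M.postSum P m (center P M m) ω)))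

/-- The delay time, centered at `A`, is finite and close to the noise term with probability
tending to one. -/
def DelayApprox (P : Measure Ω) (M : Model Ω) (A : ℕ → Ω → ℝ) (U : ℕ → Ω → ℝ) : Prop :=
  ∀ η : ℝ, 0 < η → Tendsto (fun m => P {ω | ¬ ∃ n : ℕ, M.kappa P m ω = n ∧
    |((n : ℝ) - A m ω) / M.b P m 0 0 - U m ω| ≤ η}) atTop (𝓝 0)

/-- Changing the centre by o_P(b_m) and the limiting variable by o_P(1) is harmless; all passages
between the parts of the theorem go through this. -/
lemma DelayApprox.of_vanish {A A' U U' : ℕ → Ω → ℝ} (h : DelayApprox P M A U)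
    (hA : VanishInProb P fun m ω => (A' m ω - A m ω) / M.b P m 0 0)
    (hU : VanishInProb P fun m ω => U' m ω - U m ω) : DelayApprox P M A' U' := by
  intro η hη
  have h1 := ((h (η / 3) (by positivity)).add (hA (η / 3) (by positivity))).add
    (hU (η / 3) (by positivity))
  simp only [add_zero] at h1
  refine tendsto_of_tendsto_of_tendsto_of_le_of_le tendsto_const_nhds h1 (fun _ => zero_le)
    fun m => ?_
  refine le_trans (measure_mono ?_) ((measure_union_le _ _).trans
    (add_le_add_left (measure_union_le _ _) _))
  intro ω hω
  by_contra hc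
  simp only [Set.mem_union, Set.mem_ofPred_eq, not_or, not_not, not_lt] at hc
  obtain ⟨⟨⟨n, hn, h2⟩, h3⟩, h4⟩ := hc
  refine hω ⟨n, hn, ?_⟩
  have e : ((n : ℝ) - A' m ω) / M.b P m 0 0 - U' m ω
      = (((n : ℝ) - A m ω) / M.b P m 0 0 - U m ω) - (A' m ω - A m ω) / M.b P m 0 0
        - (U' m ω - U m ω) := by ring
  rw [e]
  refine (abs_sub _ _).trans ?_
  have := abs_sub (((n : ℝ) - A m ω) / M.b P m 0 0 - U m ω) ((A' m ω - A m ω) / M.b P m 0 0)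
  linarith

/-- Starting point of the window around `a_m`. -/
noncomputable def windowStart (P : Measure Ω) (M : Model Ω) (m : ℕ) : ℕ :=
  max (M.kstar m) ⌊M.a P m 0 0 * (1 - radius P M m)⌋₊

/-- Length of the window around `a_m`. -/
noncomputable def windowLength (P : Measure Ω) (M : Model Ω) (m : ℕ) : ℕ :=
  ⌈4 * (radius P M m * M.a P m 0 0)⌉₊

lemma ThresholdAssumption.tendsto_windowLength (hthr : M.ThresholdAssumption P)
    (hch : M.ChangeAssumption P) : Tendsto (windowLength P M) atTop atTop :=
  tendsto_nat_ceil_atTop.comp ((hthr.tendsto_radius_mul hch).const_mul_atTop four_pos)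

lemma ThresholdAssumption.tendsto_windowLength_div (hthr : M.ThresholdAssumption P)
    (hch : M.ChangeAssumption P) :
    Tendsto (fun m => (windowLength P M m : ℝ) / M.a P m 0 0) atTop (𝓝 0) := by
  have ht : Tendsto (fun m => 5 * radius P M m) atTop (𝓝 0) := by
    simpa using (hthr.tendsto_radius hch).const_mul 5
  refine tendsto_of_tendsto_of_tendsto_of_le_of_le' tendsto_const_nhds ht ?_ ?_
  · filter_upwards [(hthr.tendsto_a hch).eventually_gt_atTop 0] with m h1
    positivity
  filter_upwards [(hthr.tendsto_a hch).eventually_gt_atTop 0,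
    hthr.eventually_one_le_radius_mul hch] with m h1 h2
  rw [div_le_iff₀ h1]
  have := Nat.ceil_lt_add_one (show 0 ≤ 4 * (radius P M m * M.a P m 0 0) by linarith)
  unfold windowLength
  linarith

/-- The neighbourhood has length 2 δ a_m, and rounding costs at most 1 ≤ δ a_m, so the length 4 δ
a_m is ample. Starting no earlier than k* keeps the window after the change. -/
lemma ThresholdAssumption.eventually_mem_window (hthr : M.ThresholdAssumption P)
    (hch : M.ChangeAssumption P) :
    ∀ᶠ m in atTop, ∀ k : ℕ, M.kstar m < k → |(k : ℝ) - M.a P m 0 0| ≤ radius P M m * M.a P m 0 0 →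
      windowStart P M m ≤ k ∧ k ≤ windowStart P M m + windowLength P M m := by
  filter_upwards [(hthr.tendsto_a hch).eventually_gt_atTop 0,
    hthr.eventually_one_le_radius_mul hch] with m h1 h2 k hk hka
  rw [abs_le] at hka
  have hs : M.a P m 0 0 * (1 - radius P M m) < (windowStart P M m : ℝ) + 1 := by
    refine (Nat.lt_floor_add_one _).trans_le ?_
    gcongr
    exact le_max_right _ _
  constructor
  · refine max_le hk.le (Nat.floor_le_of_le ?_)
    linarith
  · have hL : 4 * (radius P M m * M.a P m 0 0) ≤ windowLength P M m := Nat.le_ceil _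
    have : (k : ℝ) ≤ windowStart P M m + windowLength P M m := by linarith
    exact_mod_cast this

lemma ThresholdAssumption.eventually_center_mem_window (hthr : M.ThresholdAssumption P)
    (hch : M.ChangeAssumption P) :
    ∀ᶠ m in atTop, |(center P M m : ℝ) - M.a P m 0 0| ≤ radius P M m * M.a P m 0 0 := by
  filter_upwards [(hthr.tendsto_a hch).eventually_gt_atTop 0,
    hthr.eventually_one_le_radius_mul hch] with m h1 h2
  have e1 := Nat.floor_le h1.le
  have e2 := Nat.lt_floor_add_one (M.a P m 0 0)
  unfold center
  rw [abs_le]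
  constructor <;> linarith

end Model

/-! ### Approximation of the delay time by the noise. -/

namespace Model

variable {Ω : Type*} [MeasurableSpace Ω] {P : Measure Ω} {M : Model Ω}

lemma kappa_eq_of_isLeast {m n : ℕ} {ω : Ω} {thr : ℕ → ℝ} (hm : 1 ≤ m)
    (hthr : ∀ k, thr k = M.c m * (√(m : ℝ) * (1 + (k : ℝ) / m)))
    (h : IsLeast {k | M.kstar m < k ∧ thr k < |M.Gam P m k ω|} n) : M.kappa P m ω = n := by
  have h' : IsLeast {k | M.kstar m < k ∧ M.c m < weight m k * |M.Gam P m k ω|} n := by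
    convert h using 3 with k
    rw [lt_weight_mul_iff hm, hthr]
  have hmono : Monotone fun k : ℕ => (k : ℕ∞) := Nat.mono_cast
  exact (hmono.map_isLeast h').csInf_eq

lemma abs_remSum_le (m k N : ℕ) (ω : Ω) (hK : M.kstar m ≤ N) (hk : k ≤ N) :
    |M.remSum P m k ω| ≤ windowMax (fun j => M.remCol P m j ω) m N
      + windowMax (fun j => M.remColStar P m j ω) (m + M.kstar m) N := by
  refine (abs_add_le _ _).trans (add_le_add ?_ ?_)
  · exact abs_sum_le_windowMax (fun j => M.remCol P m j ω) (by omega)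
  · exact abs_sum_le_windowMax (fun j => M.remColStar P m j ω) (by omega)

lemma abs_sign_mul_le (x y : ℝ) : |Real.sign x * y| ≤ |y| := by
  rw [abs_mul]
  exact mul_le_of_le_one_left (abs_nonneg _) (abs_sign_le_one x)

/-- The detector stays above the negative threshold. -/
lemma neg_threshold_le {m k : ℕ} (hm : 1 ≤ m) (hk : M.kstar m ≤ k) {ω : Ω} {C₁ C₂ : ℝ}
    (hc : 0 < M.c m) (hsig : C₁ ≤ M.signal P m)
    (hS : |M.S1 P m ω| ≤ C₁) (hS' : |M.S1Star P m ω| ≤ C₁)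
    (hT : |M.preSum P m ω + M.postSum P m k ω| ≤ C₂ * √(M.a P m 0 0))
    (hR : |M.remSum P m k ω / m| ≤ √(M.a P m 0 0))
    (hsmall : C₁ * M.kstar m + (C₂ + 1) * (√(m : ℝ) * √(M.a P m 0 0))
      ≤ M.c m * (m + M.kstar m)) :
    -(M.c m * (√(m : ℝ) * (1 + (k : ℝ) / m)))
      ≤ Real.sign (M.Delta P m) * M.Gam P m k ω := by
  have hm0 : (0 : ℝ) < m := by exact_mod_cast hm
  have hsm := Real.sqrt_pos.2 hm0
  have hsq : √(m : ℝ) * √(m : ℝ) = m := Real.mul_self_sqrt hm0.le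
  have hkK : (M.kstar m : ℝ) ≤ k := by exact_mod_cast hk
  set σ := Real.sign (M.Delta P m)
  have e : σ * M.Gam P m k ω = M.kstar m * (σ * M.S1 P m ω) / √(m : ℝ)
      + ((k : ℝ) - M.kstar m) * (σ * M.S1Star P m ω / √(m : ℝ) + |M.Delta P m|)
      + σ * (M.preSum P m ω + M.postSum P m k ω) + σ * (M.remSum P m k ω / m) := by
    rw [Gam_eq hm hk, ← sign_mul_self_eq_abs (M.Delta P m)]
    ring
  have h1 := (abs_sign_mul_le (M.Delta P m) (M.S1 P m ω)).trans hS
  have h2 := (abs_sign_mul_le (M.Delta P m) (M.S1Star P m ω)).trans hS'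
  have h3 := (abs_sign_mul_le (M.Delta P m) _).trans hT
  have h4 := (abs_sign_mul_le (M.Delta P m) _).trans hR
  rw [abs_le] at h1 h2 h3 h4
  -- After the change the drift |Δ_m| exceeds |S_1*| / √m, so this term can only push the signed
  -- detector upwards. The remaining terms are bounded by the threshold at k*, and the threshold
  -- increases with k.
  have h5 : 0 ≤ ((k : ℝ) - M.kstar m) * (σ * M.S1Star P m ω / √(m : ℝ) + |M.Delta P m|) := by
    refine mul_nonneg (by linarith) ?_
    have : -|M.Delta P m| ≤ σ * M.S1Star P m ω / √(m : ℝ) := by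
      rw [le_div_iff₀ hsm]
      unfold signal at hsig
      linarith [h2.1]
    linarith
  have h6 : -(M.kstar m * C₁ / √(m : ℝ)) ≤ M.kstar m * (σ * M.S1 P m ω) / √(m : ℝ) := by
    rw [← neg_div, ← mul_neg]
    gcongr
    exact h1.1
  have h7 : M.kstar m * C₁ / √(m : ℝ) + (C₂ + 1) * √(M.a P m 0 0)
      ≤ M.c m * (√(m : ℝ) * (1 + (k : ℝ) / m)) := by
    have e2 : √(m : ℝ) * (1 + (k : ℝ) / m) = (m + k) / √(m : ℝ) := by
      field_simp
      rw [pow_two, hsq]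
    have e3 : M.kstar m * C₁ / √(m : ℝ) + (C₂ + 1) * √(M.a P m 0 0)
        = (C₁ * M.kstar m + (C₂ + 1) * (√(m : ℝ) * √(M.a P m 0 0))) / √(m : ℝ) := by
      field_simp
    rw [e2, e3, ← mul_div_assoc]
    gcongr
    refine hsmall.trans ?_
    gcongr
  rw [e]
  linarith

section Main

variable [IsProbabilityMeasure P] {σ σs : ℝ≥0} {D : ℝ≥0∞}

/-- The delay time is approximated by `a_m(S_1, S_1^*)` plus the noise term. -/
theorem delayApprox_a (hM : M.Standing P) (hch : M.ChangeAssumption P)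
    (hreg : M.RegularityAssumption P) (hpost : M.StoppingAssumption P σ σs D)
    (hthr : M.ThresholdAssumption P) :
    DelayApprox P M (fun m ω => M.a P m (M.S1 P m ω) (M.S1Star P m ω)) (noise P M) := by
  intro η hη
  refine tendsto_zero_of_forall_eventually_le fun ε hε => ?_
  have hε6 : 0 < ε / 7 := by positivity
  have hhor := hthr.tendsto_horizon hch
  have hhor3 : ∀ᶠ m in atTop, (horizon P M m : ℝ) / M.a P m 0 0 ≤ 3 := by
    filter_upwards [hthr.horizon_le hch, (hthr.tendsto_a hch).eventually_gt_atTop 0] with m h1 h2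
    rwa [div_le_iff₀ h2]
  obtain ⟨A₁, hA₁, hS1⟩ := hthr.S1_bounded.exists_pos hε6
  obtain ⟨A₂, hA₂, hS2⟩ := hthr.S1Star_bounded.exists_pos hε6
  obtain ⟨A₃, hA₃, hT1⟩ := (bounded_of_window hhor
    (hreg.boundedInProb_windowMax hM hhor fun m => m) hhor3).exists_pos hε6
  obtain ⟨A₄, hA₄, hT2⟩ := (bounded_of_window hhor
    (hpost.boundedInProb_windowMax hM hhor fun m => m + M.kstar m) hhor3).exists_pos hε6
  -- The constant 1/32 is half of the η/16 allowed in `exists_first_crossing`: differences of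
  -- partial sums cost two window maxima, and the remainder consists of two parts. The minimum with
  -- 1 also gives the remainder bound √a_m needed in `neg_threshold_le`.
  have hW := eventually_le_of_tendsto_zero ((vanish_of_window (hthr.tendsto_windowLength hch)
    (hpost.boundedInProb_windowMax hM (hthr.tendsto_windowLength hch)
      fun m => m + windowStart P M m) (hthr.tendsto_windowLength_div hch))
    (min η 1 / 32) (by positivity)) hε6
  obtain ⟨u, hu, hur⟩ := hreg.remainder
  obtain ⟨us, hus, hurs⟩ := hpost.remainder
  have hR1 := eventually_le_of_tendsto_zero
    (hthr.vanish_remainder hch hM (ξ := M.remCol P) hM.measurable_remCol hu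
    (fun m k₁ k₂ h1 h2 h3 => by
      have e : ∀ ω, ∑ j ∈ Finset.Icc k₁ k₂, M.remCol P m j ω = _ := fun ω => Finset.sum_comm
      simp only [e]
      exact hur m k₁ k₂ h1 h2 h3) (s := fun m => m)
    (fun m => le_rfl) (min η 1 / 32) (by positivity)) hε6
  have hR2 := eventually_le_of_tendsto_zero
    (hthr.vanish_remainder hch hM (ξ := M.remColStar P) hM.measurable_remColStar hus
    (fun m k₁ k₂ h1 h2 h3 => by
      have e : ∀ ω, ∑ j ∈ Finset.Icc k₁ k₂, M.remColStar P m j ω = _ := fun ω => Finset.sum_comm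
      simp only [e]
      exact hurs m k₁ k₂ h1 h2 h3)
    (s := fun m => m + M.kstar m)
    (fun m => Nat.le_add_right _ _) (min η 1 / 32) (by positivity)) hε6
  set C₁ := max A₁ A₂
  set C := A₃ + A₄
  have hC₁ : 0 ≤ C₁ := hA₁.le.trans (le_max_left _ _)
  have hC : 0 < C := by positivity
  -- Seven bad events of probability at most ε/7 each: large S_1, large S_1*, large noise before and
  -- after the change, fluctuation in the window, and the two remainders.
  have hunion := eventually_measure_union_le (by positivity) (by positivity)
    (eventually_measure_union_le (by positivity) (by positivity)
      (eventually_measure_union_le (by positivity) (by positivity)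
        (eventually_measure_union_le (by positivity) (by positivity)
          (eventually_measure_union_le (by positivity) (by positivity)
            (eventually_measure_union_le hε6.le hε6.le hS1 hS2) hT1) hT2) hW) hR1) hR2
  have hsmall : ∀ᶠ m in atTop, C₁ * M.kstar m + (C + 1) * (√(m : ℝ) * √(M.a P m 0 0))
      ≤ M.c m * (m + M.kstar m) := by
    have h0 : Tendsto (fun m : ℕ => C₁ * ((M.kstar m : ℝ) / (M.c m * (m + M.kstar m)))
        + (C + 1) * (√(m : ℝ) * √(M.a P m 0 0) / (M.c m * (m + M.kstar m)))) atTop (𝓝 0) := by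
      simpa using ((hthr.tendsto_kstar_div hch hM).const_mul C₁).add
        ((hthr.tendsto_sqrt_div hch hM).const_mul (C + 1))
    filter_upwards [h0.eventually_lt_const one_pos, hthr.eventually_pos hch]
      with m h6 ⟨h1, h2, _⟩
    have hm0 : (0 : ℝ) < m := by exact_mod_cast h1
    have hden : 0 < M.c m * (m + M.kstar m) := by positivity
    rw [← mul_div_assoc, ← mul_div_assoc, ← add_div, div_lt_one hden] at h6
    exact h6.le
  filter_upwards [hunion, hsmall, hthr.eventually_pos hch, hthr.eventually_mul_b_le hch (C + η),
    hthr.eventually_abs_slope_sub_one_le hch C₁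
      (show 0 < min (1 / 8) (η / (8 * C)) by positivity),
    hthr.eventually_abs_a_sub_le_radius hch C₁, hthr.eventually_kstar_add_le_a hch hM hC₁ hC.le,
    (hthr.tendsto_a hch).eventually_gt_atTop 0,
    (hthr.tendsto_b hch).eventually_ge_atTop (2 / η), hthr.kstar_le_a hch,
    (hthr.tendsto_radius hch).eventually_le_const one_pos,
    hthr.eventually_mem_window hch, hthr.eventually_center_mem_window hch,
    hthr.eventually_kstar_lt_center hch hM,
    (hthr.tendsto_signal hch).eventually_ge_atTop C₁]
    with m hP hsm ⟨h1, h2, h3, h4, h5⟩ hbC hslope haR hKa ha hb hKle hrad hwin hcwin hKc hsig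
  refine le_trans (measure_mono ?_) (hP.trans_eq (by congr 1; ring))
  intro ω hω
  by_contra hgood
  simp only [Set.mem_union, Set.mem_ofPred_eq, not_or, not_lt] at hgood
  obtain ⟨⟨⟨⟨⟨⟨g1, g2⟩, g3⟩, g4⟩, g5⟩, g6⟩, g7⟩ := hgood
  refine hω ?_
  have hm0 : (0 : ℝ) < m := by exact_mod_cast h1
  have hsa := Real.sqrt_pos.2 ha
  replace g1 : |M.S1 P m ω| ≤ C₁ := g1.trans (le_max_left _ _)
  replace g2 : |M.S1Star P m ω| ≤ C₁ := g2.trans (le_max_right _ _)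
  have hwle : ∀ {w B : ℝ}, |(√(M.a P m 0 0))⁻¹ * w| ≤ B → w ≤ B * √(M.a P m 0 0) := by
    intro w B h
    have := (le_abs_self _).trans h
    rwa [inv_mul_le_iff₀ hsa, mul_comm] at this
  replace g3 := hwle g3
  replace g4 := hwle g4
  replace g5 := hwle g5
  replace g6 := hwle g6
  replace g7 := hwle g7
  have hKN : M.kstar m ≤ horizon P M m := by
    have : (M.kstar m : ℝ) ≤ horizon P M m :=
      le_trans (by linarith) (Nat.le_ceil (2 * M.a P m 0 0))
    exact_mod_cast this
  have hTk : ∀ k, k ≤ horizon P M m →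
      |M.preSum P m ω + M.postSum P m k ω| ≤ C * √(M.a P m 0 0) := by
    intro k hk
    have e1 : |M.preSum P m ω| ≤ A₃ * √(M.a P m 0 0) :=
      (abs_sum_le_windowMax (fun j => M.h2 P (M.Y j ω)) (by omega)).trans g3
    have e2 : |M.postSum P m k ω| ≤ A₄ * √(M.a P m 0 0) :=
      (abs_sum_le_windowMax (fun j => M.h2Star P m (M.Z m j ω)) (by omega)).trans g4
    refine (abs_add_le _ _).trans ?_
    simp only [C]
    linarith
  have hRk : ∀ k, k ≤ horizon P M m →
      |M.remSum P m k ω / m| ≤ min η 1 / 16 * √(M.a P m 0 0) := by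
    intro k hk
    rw [abs_div, abs_of_pos hm0]
    have := div_le_div_of_nonneg_right (abs_remSum_le (P := P) m k _ ω hKN hk) hm0.le
    rw [add_div] at this
    linarith
  have hmin1 : min η 1 ≤ 1 := min_le_right _ _
  have hminη : min η 1 ≤ η := min_le_left _ _
  have hq := hslope _ g2
  have hq1 := hq.trans (min_le_left _ _)
  have hq2 := hq.trans (min_le_right _ _)
  rw [abs_le] at hq1
  have hq0 : slope P M m (M.S1Star P m ω) ≠ 0 := by linarith
  have hcN : center P M m ≤ horizon P M m := by
    have e1 : (center P M m : ℝ) ≤ M.a P m 0 0 := Nat.floor_le ha.le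
    have : (center P M m : ℝ) ≤ horizon P M m :=
      le_trans (by linarith) (Nat.le_ceil (2 * M.a P m 0 0))
    exact_mod_cast this
  have hσ := abs_sign_le_one (M.Delta P m)
  obtain ⟨n, hn, hn'⟩ := exists_first_crossing (K := M.kstar m) (N := horizon P M m)
    (q := slope P M m (M.S1Star P m ω)) (Dl := |M.Delta P m|)
    (A := M.a P m (M.S1 P m ω) (M.S1Star P m ω)) (a0 := M.a P m 0 0) (b := M.b P m 0 0)
    (ra := √(M.a P m 0 0)) (U := noise P M m ω) (η := η) (δ := radius P M m) (C := C)
    (g := fun k => Real.sign (M.Delta P m) * M.Gam P m k ω)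
    (thr := fun k => M.c m * (√(m : ℝ) * (1 + (k : ℝ) / m)))
    (T := fun k => Real.sign (M.Delta P m) * (M.preSum P m ω + M.postSum P m k ω))
    (R := fun k => Real.sign (M.Delta P m) * (M.remSum P m k ω / m))
    h5 hsa rfl hη hrad ha (radius_nonneg m)
    (fun k hk => sign_mul_Gam_eq h1 hk.le ω h4 hq0)
    (fun k hk hkN => neg_threshold_le h1 hk.le h2 hsig g1 g2 (hTk k hkN)
      ((hRk k hkN).trans (by nlinarith)) hsm)
    (fun k hk hkN => (abs_sign_mul_le _ _).trans ((hRk k hkN).trans (by gcongr)))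
    (fun k hk hkN => (abs_sign_mul_le _ _).trans (hTk k hkN))
    (fun k hk hka => by
      obtain ⟨w1, w2⟩ := hwin k hk hka
      obtain ⟨w3, w4⟩ := hwin _ hKc hcwin
      have e : Real.sign (M.Delta P m) * (M.preSum P m ω + M.postSum P m k ω)
          + noise P M m ω * √(M.a P m 0 0) = Real.sign (M.Delta P m) *
            (M.postSum P m k ω - M.postSum P m (center P M m) ω) := by
        unfold noise; field_simp; ring
      rw [e]
      refine (abs_sign_mul_le _ _).trans ?_
      have := abs_sum_sub_sum_le_windowMax (fun j => M.h2Star P m (M.Z m j ω))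
        (s₀ := m + M.kstar m) (s := m + windowStart P M m) (k := m + k)
        (k' := m + center P M m) (L := windowLength P M m)
        (Nat.add_le_add_left (le_max_left _ _) _) (by omega) (by omega) (by omega) (by omega)
      refine this.trans ?_
      nlinarith)
    (by
      unfold noise
      rw [abs_neg]
      refine (abs_sign_mul_le _ _).trans ?_
      rw [abs_mul, abs_of_pos (inv_pos.2 hsa), inv_mul_le_iff₀ hsa, mul_comm]
      exact hTk _ hcN)
    (by linarith)
    (by
      calc |slope P M m (M.S1Star P m ω) - 1| * C ≤ η / (8 * C) * C := by gcongr
        _ = η / 8 := by field_simp)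
    (haR _ _ g1 g2) hbC (hKa _ _ g1 g2)
    (by
      rw [div_le_iff₀ hη] at hb
      linarith)
    (Nat.le_ceil _)
  refine ⟨n, kappa_eq_of_isLeast h1 (fun _ => rfl) ?_, hn'⟩
  -- The sign was introduced only to make the drift positive; it has modulus 1 and disappears from
  -- the two-sided crossing condition.
  have habs : |Real.sign (M.Delta P m)| = 1 := by
    rcases Real.sign_apply_eq_of_ne_zero _ h4 with h | h <;> simp [h]
  simpa only [abs_mul, habs, one_mul] using hn

/-! ### Replacing the historic quantities in the centring by zero. -/

omit [IsProbabilityMeasure P] in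
-- Since S_1 and S_1* are stochastically bounded, estimates uniform over compact ranges of (s, s*)
-- suffice.
lemma ThresholdAssumption.vanish_of_uniform (hthr : M.ThresholdAssumption P)
    {f : ℕ → ℝ → ℝ → ℝ} (h : ∀ C : ℝ, 0 < C → ∃ r : ℕ → ℝ, Tendsto r atTop (𝓝 0) ∧
      ∀ᶠ m in atTop, ∀ s t, |s| ≤ C → |t| ≤ C → |f m s t| ≤ r m) :
    VanishInProb P fun m ω => f m (M.S1 P m ω) (M.S1Star P m ω) := by
  intro η hη
  refine tendsto_zero_of_forall_eventually_le fun ε hε => ?_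
  obtain ⟨A₁, hA₁, hS1⟩ := hthr.S1_bounded.exists_pos (half_pos hε)
  obtain ⟨A₂, hA₂, hS2⟩ := hthr.S1Star_bounded.exists_pos (half_pos hε)
  obtain ⟨r, hr, hf⟩ := h (max A₁ A₂) (by positivity)
  filter_upwards [eventually_measure_union_le (by positivity) (by positivity) hS1 hS2, hf,
    hr.eventually_le_const hη] with m hm hfm hrm
  rw [add_halves] at hm
  refine (measure_mono fun ω (hω : η < _) => ?_).trans hm
  by_contra hc
  simp only [Set.mem_union, Set.mem_ofPred_eq, not_or, not_lt] at hc
  linarith [hfm _ _ (hc.1.trans (le_max_left A₁ A₂)) (hc.2.trans (le_max_right A₁ A₂))]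

omit [IsProbabilityMeasure P] in
-- The slope times a_m(s,0) - a_m(s,t) equals, up to sign, t (a_m(s,0) - k*) / (√m |Δ_m|), and
-- a_m(s,0) - k* has order c_m (m + k*) / (√m |Δ_m|). Division by b_m leaves the ratio of
-- `NotTooLate.tendsto_ratio`.
lemma ThresholdAssumption.vanish_a_sub_a_zero_right (hM : M.Standing P)
    (hch : M.ChangeAssumption P) (hthr : M.ThresholdAssumption P) (hN : M.NotTooLate P) :
    VanishInProb P fun m ω => (M.a P m (M.S1 P m ω) 0 - M.a P m (M.S1 P m ω) (M.S1Star P m ω))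
      / M.b P m 0 0 := by
  refine hthr.vanish_of_uniform
    (f := fun m s t => (M.a P m s 0 - M.a P m s t) / M.b P m 0 0) fun C hC => ?_
  refine ⟨fun m => 4 * C * (M.c m * (m + M.kstar m)
    / (M.signal P m * (√(m : ℝ) * √(M.a P m 0 0)))), ?_, ?_⟩
  · simpa using (hN.tendsto_ratio hthr hch hM).const_mul (4 * C)
  filter_upwards [hthr.eventually_abs_slope_sub_one_le hch C (show (0 : ℝ) < 1 / 4 by norm_num),
    hthr.eventually_pos hch,
    hthr.eventually_abs_slope_sub_one_le hch 0 (show (0 : ℝ) < 1 / 4 by norm_num),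
    (hthr.tendsto_a hch).eventually_gt_atTop 0,
    (hthr.tendsto_kstar_div hch hM).eventually_lt_const (show 0 < 1 / C by positivity)]
    with m hq ⟨h1, h2, h3, h4, h5⟩ hq0 ha hK s t hs ht
  have hq := hq t ht
  have hq0 := hq0 0 (by simp)
  rw [abs_le] at hq hq0
  have hm0 : (0 : ℝ) < m := by exact_mod_cast h1
  have hsa := Real.sqrt_pos.2 ha
  have hsm := Real.sqrt_pos.2 hm0
  have hden : 0 < M.c m * (m + M.kstar m) := by positivity
  have hKC : C * M.kstar m ≤ M.c m * (m + M.kstar m) := by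
    rw [div_lt_div_iff₀ hden hC] at hK
    linarith
  have e1 := slope_mul_a (s := s) h1 h4 (show slope P M m t ≠ 0 by linarith)
  have e2 := slope_mul_a (s := s) h1 h4 (show slope P M m 0 ≠ 0 by linarith)
  have e3 : slope P M m t * (M.a P m s 0 - M.a P m s t)
      = Real.sign (M.Delta P m) * (t / M.signal P m * (M.a P m s 0 - M.kstar m)) := by
    have : slope P M m t = slope P M m 0 + t * Real.sign (M.Delta P m) / M.signal P m := by
      unfold slope; ring
    rw [mul_sub, e1, this, add_mul, e2]
    ring
  have e4 : slope P M m 0 * (M.a P m s 0 - M.kstar m)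
      = (M.c m * (m + M.kstar m) - Real.sign (M.Delta P m) * (s * M.kstar m)) / M.signal P m := by
    rw [mul_sub, e2]; unfold slope; ring
  have h6 : 3 / 4 * |M.a P m s 0 - M.kstar m| ≤ 2 * (M.c m * (m + M.kstar m)) / M.signal P m := by
    have habs := congrArg abs e4
    rw [abs_mul, abs_div, abs_of_pos h3, abs_of_pos (show 0 < slope P M m 0 by linarith)] at habs
    calc 3 / 4 * |M.a P m s 0 - M.kstar m|
        ≤ slope P M m 0 * |M.a P m s 0 - M.kstar m| := by gcongr; linarith
      _ = _ := habs
      _ ≤ _ := by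
        gcongr
        refine (abs_sub _ _).trans ?_
        have := abs_sign_mul_le (M.Delta P m) (s * M.kstar m)
        rw [abs_mul s, Nat.abs_cast] at this
        have : |s| * (M.kstar m : ℝ) ≤ C * M.kstar m := by gcongr
        rw [abs_of_pos hden]
        linarith
  have h7 : 3 / 4 * |M.a P m s 0 - M.a P m s t|
      ≤ C / M.signal P m * |M.a P m s 0 - M.kstar m| := by
    have habs := congrArg abs e3
    rw [abs_mul, abs_of_pos (show 0 < slope P M m t by linarith)] at habs
    calc 3 / 4 * |M.a P m s 0 - M.a P m s t|
        ≤ slope P M m t * |M.a P m s 0 - M.a P m s t| := by gcongr; linarith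
      _ = _ := habs
      _ ≤ _ := by
        refine (abs_sign_mul_le _ _).trans ?_
        rw [abs_mul, abs_div, abs_of_pos h3]
        gcongr
  have hb : 0 < M.b P m 0 0 := by unfold b; positivity
  rw [abs_div, abs_of_pos hb, div_le_iff₀ hb, b_eq h1]
  have e5 : 4 * C * (M.c m * (m + M.kstar m) / (M.signal P m * (√(m : ℝ) * √(M.a P m 0 0))))
      * (√(m : ℝ) * √(M.a P m 0 0) / M.signal P m)
      = 2 * (C / M.signal P m * (2 * (M.c m * (m + M.kstar m)) / M.signal P m)) := by
    field_simp; ring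
  rw [e5]
  have h8 : C / M.signal P m * (3 / 4 * |M.a P m s 0 - M.kstar m|)
      ≤ C / M.signal P m * (2 * (M.c m * (m + M.kstar m)) / M.signal P m) := by gcongr
  have h9 : 0 ≤ C / M.signal P m * (2 * (M.c m * (m + M.kstar m)) / M.signal P m) := by positivity
  linarith

omit [IsProbabilityMeasure P] in
-- With s* = 0 the slope does not depend on s, so the difference is of order k* / (√m |Δ_m|). In
-- units of b_m this is k* / √(m a_m), which vanishes for β < 1.
lemma ThresholdAssumption.vanish_a_sub_a_zero_zero (hM : M.Standing P)
    (hch : M.ChangeAssumption P) (hthr : M.ThresholdAssumption P) (hβ : M.beta < 1) :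
    VanishInProb P fun m ω => (M.a P m 0 0 - M.a P m (M.S1 P m ω) 0) / M.b P m 0 0 := by
  refine hthr.vanish_of_uniform
    (f := fun m s _ => (M.a P m 0 0 - M.a P m s 0) / M.b P m 0 0) fun C hC => ?_
  refine ⟨fun m => 2 * C * ((M.kstar m : ℝ) / (√(m : ℝ) * √(M.a P m 0 0))), ?_, ?_⟩
  · simpa using (hthr.tendsto_kstar_div_sqrt hch hM hβ).const_mul (2 * C)
  filter_upwards [hthr.eventually_pos hch,
    hthr.eventually_abs_slope_sub_one_le hch 0 (show (0 : ℝ) < 1 / 4 by norm_num),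
    (hthr.tendsto_a hch).eventually_gt_atTop 0]
    with m ⟨h1, h2, h3, h4, h5⟩ hq0 ha s t hs ht
  have hq0 := hq0 0 (by simp)
  rw [abs_le] at hq0
  have hm0 : (0 : ℝ) < m := by exact_mod_cast h1
  have hsa := Real.sqrt_pos.2 ha
  have hsm := Real.sqrt_pos.2 hm0
  have e1 := slope_mul_a (s := 0) h1 h4 (show slope P M m 0 ≠ 0 by linarith)
  have e2 := slope_mul_a (s := s) h1 h4 (show slope P M m 0 ≠ 0 by linarith)
  have e3 : slope P M m 0 * (M.a P m 0 0 - M.a P m s 0)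
      = Real.sign (M.Delta P m) * (s * M.kstar m / M.signal P m) := by
    rw [mul_sub, e1, e2]; ring
  have h7 : 3 / 4 * |M.a P m 0 0 - M.a P m s 0| ≤ C * M.kstar m / M.signal P m := by
    have habs := congrArg abs e3
    rw [abs_mul, abs_of_pos (show 0 < slope P M m 0 by linarith)] at habs
    calc 3 / 4 * |M.a P m 0 0 - M.a P m s 0|
        ≤ slope P M m 0 * |M.a P m 0 0 - M.a P m s 0| := by gcongr; linarith
      _ = _ := habs
      _ ≤ _ := by
        refine (abs_sign_mul_le _ _).trans ?_
        rw [abs_div, abs_mul, abs_of_pos h3, Nat.abs_cast]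
        gcongr
  have hb : 0 < M.b P m 0 0 := by unfold b; positivity
  rw [abs_div, abs_of_pos hb, div_le_iff₀ hb, b_eq h1]
  have e5 : 2 * C * ((M.kstar m : ℝ) / (√(m : ℝ) * √(M.a P m 0 0)))
      * (√(m : ℝ) * √(M.a P m 0 0) / M.signal P m) = 2 * (C * M.kstar m / M.signal P m) := by
    field_simp
  rw [e5]
  have h9 : 0 ≤ C * M.kstar m / M.signal P m := by positivity
  linarith

end Main

end Model

/-! ### Convergence in distribution. -/

section Distribution

variable {Ω : Type*} [MeasurableSpace Ω] {P : Measure Ω} [IsProbabilityMeasure P]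

lemma tendstoInDistribution_iff_integral {Ω' E : Type*} [MeasurableSpace Ω'] {μ : Measure Ω'}
    [IsProbabilityMeasure μ] [TopologicalSpace E] [MeasurableSpace E] [BorelSpace E]
    {X : ℕ → Ω → E} {Z : Ω' → E} (hX : ∀ m, Measurable (X m)) (hZ : Measurable Z) :
    TendstoInDistribution X atTop Z (fun _ => P) μ ↔
      ∀ φ : E →ᵇ ℝ, Tendsto (fun m => ∫ ω, φ (X m ω) ∂P) atTop (𝓝 (∫ ω, φ (Z ω) ∂μ)) := by
  have e1 : ∀ (φ : E →ᵇ ℝ) m, ∫ x, φ x ∂(P.map (X m)) = ∫ ω, φ (X m ω) ∂P := fun φ m =>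
    integral_map (hX m).aemeasurable φ.continuous.measurable.aestronglyMeasurable
  have e2 : ∀ φ : E →ᵇ ℝ, ∫ x, φ x ∂(μ.map Z) = ∫ ω, φ (Z ω) ∂μ := fun φ =>
    integral_map hZ.aemeasurable φ.continuous.measurable.aestronglyMeasurable
  constructor
  · intro h φ
    have := ProbabilityMeasure.tendsto_iff_forall_integral_tendsto.1 h.tendsto φ
    simpa only [ProbabilityMeasure.coe_mk, e1, e2] using this
  · intro h
    refine ⟨fun m => (hX m).aemeasurable, hZ.aemeasurable, ?_⟩
    refine ProbabilityMeasure.tendsto_iff_forall_integral_tendsto.2 fun φ => ?_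
    simpa only [ProbabilityMeasure.coe_mk, e1, e2] using h φ

/-- Convergence in distribution is not affected by changes on sets of vanishing probability. -/
lemma tendstoInDistribution_of_measure_ne {Ω' E : Type*} [MeasurableSpace Ω'] {μ : Measure Ω'}
    [IsProbabilityMeasure μ] [TopologicalSpace E] [MeasurableSpace E] [BorelSpace E]
    {X Y : ℕ → Ω → E} {Z : Ω' → E} (hX : ∀ m, Measurable (X m)) (hY : ∀ m, Measurable (Y m))
    (hZ : Measurable Z) (h : TendstoInDistribution X atTop Z (fun _ => P) μ)
    (hne : Tendsto (fun m => P {ω | Y m ω ≠ X m ω}) atTop (𝓝 0)) :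
    TendstoInDistribution Y atTop Z (fun _ => P) μ := by
  rw [tendstoInDistribution_iff_integral hY hZ]
  rw [tendstoInDistribution_iff_integral hX hZ] at h
  intro φ
  have hint : ∀ W : Ω → E, Measurable W → Integrable (fun ω => φ (W ω)) P := fun W hW =>
    Integrable.of_bound (φ.continuous.measurable.comp hW).aestronglyMeasurable ‖φ‖
      (Eventually.of_forall fun ω => φ.norm_coe_le_norm _)
  have hdiff : Tendsto (fun m => ∫ ω, φ (Y m ω) ∂P - ∫ ω, φ (X m ω) ∂P) atTop (𝓝 0) := by
    have ht : Tendsto (fun m => 2 * ‖φ‖ * (P {ω | Y m ω ≠ X m ω}).toReal) atTop (𝓝 0) := by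
      simpa using ((ENNReal.tendsto_toReal ENNReal.zero_ne_top).comp hne).const_mul (2 * ‖φ‖)
    refine squeeze_zero_norm (fun m => ?_) ht
    rw [← integral_sub (hint _ (hY m)) (hint _ (hX m))]
    -- The set where the variables differ need not be measurable in a general E, so a measurable
    -- hull of the same measure is used.
    set S := toMeasurable P {ω | Y m ω ≠ X m ω} with hS
    have hbound : ∀ ω, ‖φ (Y m ω) - φ (X m ω)‖ ≤ S.indicator (fun _ => 2 * ‖φ‖) ω := by
      intro ω
      by_cases hω : ω ∈ S
      · rw [Set.indicator_of_mem hω]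
        refine (norm_sub_le _ _).trans ?_
        linarith [φ.norm_coe_le_norm (Y m ω), φ.norm_coe_le_norm (X m ω)]
      · rw [Set.indicator_of_notMem hω]
        have : Y m ω = X m ω := by
          by_contra hc
          exact hω (subset_toMeasurable P _ hc)
        simp [this]
    have hSm : MeasurableSet S := measurableSet_toMeasurable _ _
    refine (norm_integral_le_of_norm_le ((integrable_const _).indicator hSm)
      (Eventually.of_forall hbound)).trans_eq ?_
    rw [integral_indicator hSm, setIntegral_const, smul_eq_mul, mul_comm, Measure.real, hS,
      measure_toMeasurable]
  simpa using hdiff.add (h φ)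

/-- Random signs do not matter in convergence to a centered normal distribution. -/
lemma tendstoInDistribution_sign_mul {X : ℕ → Ω → ℝ} (hX : ∀ m, Measurable (X m)) {v : ℝ≥0}
    (h : TendstoInDistribution X atTop (fun x : ℝ => x) (fun _ => P) (gaussianReal 0 v))
    {s : ℕ → ℝ} (hs : ∀ᶠ m in atTop, s m = 1 ∨ s m = -1) :
    TendstoInDistribution (fun m ω => s m * X m ω) atTop (fun x : ℝ => x) (fun _ => P)
      (gaussianReal 0 v) := by
  rw [tendstoInDistribution_iff_integral (fun m => (hX m).const_mul _) measurable_id']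
  rw [tendstoInDistribution_iff_integral hX measurable_id'] at h
  intro φ
  have h1 := h φ
  -- By symmetry of the normal law, the expectations of φ(X) and φ(-X) have the same limit, so each
  -- index may use either one.
  have h2 := h (φ.compContinuous ⟨fun x : ℝ => -x, continuous_neg⟩)
  have e : ∫ x, (φ.compContinuous ⟨fun x : ℝ => -x, continuous_neg⟩) x ∂(gaussianReal 0 v)
      = ∫ x, φ x ∂(gaussianReal 0 v) := by
    have := gaussianReal_map_neg (μ := 0) (v := v)
    rw [neg_zero] at this
    conv_rhs => rw [← this]
    rw [integral_map measurable_neg.aemeasurable φ.continuous.measurable.aestronglyMeasurable]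
    rfl
  rw [e] at h2
  rw [Metric.tendsto_atTop'] at *
  intro ε hε
  obtain ⟨N₁, hN₁⟩ := h1 ε hε
  obtain ⟨N₂, hN₂⟩ := h2 ε hε
  obtain ⟨N₃, hN₃⟩ := eventually_atTop.1 hs
  refine ⟨max N₁ (max N₂ N₃), fun n hn => ?_⟩
  rcases hN₃ n ((le_max_right N₂ N₃).trans ((le_max_right _ _).trans hn.le)) with h | h
  · simpa [h] using hN₁ n ((le_max_left _ _).trans_lt hn)
  · simpa [h] using hN₂ n ((le_max_left N₂ N₃).trans_lt ((le_max_right _ _).trans_lt hn))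

end Distribution

namespace Model

variable {Ω : Type*} [MeasurableSpace Ω] {P : Measure Ω} [IsProbabilityMeasure P] {M : Model Ω}

omit [IsProbabilityMeasure P] in
lemma standardizedDelay_eq {A : ℕ → Ω → ℝ} {m n : ℕ} {ω : Ω} (h : M.kappa P m ω = n) :
    M.standardizedDelay P A m ω = ((((n : ℝ) - A m ω) / M.b P m 0 0 : ℝ) : EReal) := by
  have : (((n : ℕ∞) : ℝ≥0∞) : EReal) = ((n : ℝ) : EReal) := by
    rw [ENat.toENNReal_coe, ← ENNReal.coe_natCast, EReal.coe_nnreal_eq_coe_real]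
    simp
  rw [standardizedDelay, h, EReal.coe_div, EReal.coe_sub, this]

/-- An approximation of the delay time by asymptotically normal variables gives the limit
distribution of the delay time. -/
theorem DelayApprox.delayTendstoNormal (hM : M.Standing P) {A U : ℕ → Ω → ℝ}
    (hA : ∀ m, Measurable (A m)) (h : DelayApprox P M A U) {v : ℝ≥0}
    (hU : TendstoInDistribution U atTop (fun x : ℝ => x) (fun _ => P) (gaussianReal 0 v)) :
    M.DelayTendstoNormal P A v := by
  have hmeas := fun m => hM.measurable_standardizedDelay (P := P) m (hA m)
  have hsub : TendstoInMeasure P ((fun m ω => (M.standardizedDelay P A m ω).toReal) - U) atTop 0 := by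
    rw [tendstoInMeasure_iff_norm]
    intro ε hε
    refine tendsto_of_tendsto_of_tendsto_of_le_of_le tendsto_const_nhds (h (ε / 2) (by positivity))
      (fun _ => zero_le) fun m => measure_mono fun ω hω => ?_
    rintro ⟨n, hn, hle⟩
    simp only [Set.mem_ofPred_eq, Pi.sub_apply, Pi.zero_apply, sub_zero, standardizedDelay_eq hn,
      EReal.toReal_coe, Real.norm_eq_abs] at hω
    linarith
  -- The limit is first proved for the real truncation by `EReal.toReal`. It differs from the delay
  -- itself only where the delay is infinite, an event of vanishing probability.
  have h1 := tendstoInDistribution_of_tendstoInMeasure_sub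
    (fun m ω => (M.standardizedDelay P A m ω).toReal) (fun x : ℝ => x) hU hsub
    fun m => (hmeas m).ereal_toReal.aemeasurable
  have h2 := h1.continuous_comp continuous_coe_real_ereal
  refine tendstoInDistribution_of_measure_ne (fun m => (hmeas m).ereal_toReal.coe_real_ereal) hmeas
    measurable_coe_real_ereal h2 ?_
  refine tendsto_of_tendsto_of_tendsto_of_le_of_le tendsto_const_nhds (h 1 one_pos)
    (fun _ => zero_le) fun m => measure_mono fun ω hω => ?_
  rintro ⟨n, hn, -⟩
  refine hω ?_
  simp [standardizedDelay_eq hn]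

end Model

/-! ### The Gaussian limit of the linear statistic. -/

lemma coe_limitVariance {lam : ℝ} (hlam : 0 < lam) (σ σs : ℝ≥0) {D : ℝ≥0∞} (hD : D ≠ ⊤) :
    (limitVariance lam σ σs D : ℝ)
      = Model.tau lam D * (σ : ℝ) ^ 2 + (1 - Model.tau lam D) * (σs : ℝ) ^ 2 := by
  have hD0 : 0 ≤ D.toReal := ENNReal.toReal_nonneg
  unfold limitVariance Model.tau
  rw [if_neg hD, if_neg hD]
  split_ifs with h
  · simp [h]
  · push_cast
    rw [Real.coe_toNNReal _ (by positivity), Real.coe_toNNReal _ (by positivity)]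
    congr 2
    have : 1 + lam * D.toReal ≠ 0 := by positivity
    field_simp
    ring

/-- The law of `W(t) + W*(1) - W*(t)` for a bivariate Wiener process. -/
lemma IsBivariateWiener.map_eq_gaussianReal {Ω : Type*} [MeasurableSpace Ω]
    {W : Set.Icc (0 : ℝ) 1 → Ω → ℝ × ℝ} {Q : Measure Ω} [IsProbabilityMeasure Q] {σ σs : ℝ≥0}
    (hW : IsBivariateWiener W Q σ σs) (t : Set.Icc (0 : ℝ) 1) {v : ℝ≥0}
    (hv : (v : ℝ) = t * (σ : ℝ) ^ 2 + (1 - t) * (σs : ℝ) ^ 2) :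
    AEMeasurable (fun ω => (W t ω).1 + ((W 1 ω).2 - (W t ω).2)) Q ∧
    Q.map (fun ω => (W t ω).1 + ((W 1 ω).2 - (W t ω).2)) = gaussianReal 0 v := by
  have hjoint := hW.isGaussian.hasGaussianLaw_prodMk (s := t) (t := 1)
  have hlaw : HasGaussianLaw (fun ω => (W t ω).1 + ((W 1 ω).2 - (W t ω).2)) Q :=
    hjoint.map_fun ((ContinuousLinearMap.fst ℝ ℝ ℝ).comp (ContinuousLinearMap.fst ℝ (ℝ × ℝ) (ℝ × ℝ))
      + ((ContinuousLinearMap.snd ℝ ℝ ℝ).comp (ContinuousLinearMap.snd ℝ (ℝ × ℝ) (ℝ × ℝ))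
        - (ContinuousLinearMap.snd ℝ ℝ ℝ).comp (ContinuousLinearMap.fst ℝ (ℝ × ℝ) (ℝ × ℝ))))
  have hf : ∀ s, HasGaussianLaw (fun ω => (W s ω).1) Q := fun s =>
    (hW.isGaussian.hasGaussianLaw_eval s).map_fun (ContinuousLinearMap.fst ℝ ℝ ℝ)
  have hs : ∀ s, HasGaussianLaw (fun ω => (W s ω).2) Q := fun s =>
    (hW.isGaussian.hasGaussianLaw_eval s).map_fun (ContinuousLinearMap.snd ℝ ℝ ℝ)
  have mA := (hf t).memLp_two
  have mB := (hs 1).memLp_two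
  have mC := (hs t).memLp_two
  have mBC : MemLp (fun ω => (W 1 ω).2 - (W t ω).2) 2 Q := mB.sub mC
  refine ⟨hlaw.aemeasurable, ?_⟩
  rw [hlaw.map_eq_gaussianReal]
  have hmean : ∫ ω, ((W t ω).1 + ((W 1 ω).2 - (W t ω).2)) ∂Q = 0 := by
    rw [integral_add (hf t).integrable (mBC.integrable one_le_two),
      integral_sub (hs 1).integrable (hs t).integrable, hW.mean_fst, hW.mean_snd, hW.mean_snd]
    simp
  obtain ⟨ρ, hρ⟩ := hW.cov_fst_snd
  have hvar : variance (fun ω => (W t ω).1 + ((W 1 ω).2 - (W t ω).2)) Q = v := by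
    have ht1 : (t : ℝ) ≤ 1 := t.2.2
    rw [← covariance_self hlaw.aemeasurable]
    change covariance ((fun ω => (W t ω).1) + fun ω => (W 1 ω).2 - (W t ω).2)
      ((fun ω => (W t ω).1) + fun ω => (W 1 ω).2 - (W t ω).2) Q = v
    -- The cross terms cancel: W(t) has covariance tρ with both W*(1) and W*(t). Hence the variances
    -- tσ² and (1 - t)σ*² simply add.
    rw [covariance_add_left mA mBC (mA.add mBC), covariance_add_right mA mA mBC,
      covariance_add_right mBC mA mBC, covariance_fun_sub_fun_sub mB mC mB mC,
      covariance_fun_sub_right mA mB mC, covariance_fun_sub_left mB mC mA,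
      covariance_comm (fun ω => (W 1 ω).2) (fun ω => (W t ω).1),
      covariance_comm (fun ω => (W t ω).2) (fun ω => (W t ω).1)]
    simp only [hW.cov_fst, hW.cov_snd, hρ, hv]
    simp only [Set.Icc.coe_one, min_self, min_eq_left ht1, min_eq_right ht1]
    ring
  rw [hmean, hvar, Real.toNNReal_coe]

namespace Model

variable {Ω : Type*} [MeasurableSpace Ω] {P : Measure Ω} [IsProbabilityMeasure P] {M : Model Ω}
  {σ σs : ℝ≥0} {D : ℝ≥0∞}

/-- The linear statistic with the change point at the fraction `tau` of the center. -/
noncomputable def linearStat (P : Measure Ω) (M : Model Ω) (D : ℝ≥0∞) (m : ℕ) (ω : Ω) : ℝ :=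
  (√(center P M m : ℝ))⁻¹ *
    (∑ j ∈ Finset.Icc (m + 1) (m + ⌊(center P M m : ℝ) * tau M.lam D⌋₊), M.h2 P (M.Y j ω)
      + ∑ j ∈ Finset.Icc (m + ⌊(center P M m : ℝ) * tau M.lam D⌋₊ + 1) (m + center P M m),
          M.h2Star P m (M.Z m j ω))

lemma Standing.measurable_linearStat (hM : M.Standing P) (m : ℕ) :
    Measurable (linearStat P M D m) :=
  ((Finset.measurable_sum _ fun j _ => hM.measurable_h2.comp (hM.measurable_Y j)).add
    (Finset.measurable_sum _ fun j _ =>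
      (hM.measurable_h2Star m).comp (hM.measurable_Z m j))).const_mul _

omit [IsProbabilityMeasure P] in
lemma floor_mul_tau_le (hM : M.Standing P) (n : ℕ) : ⌊(n : ℝ) * tau M.lam D⌋₊ ≤ n := by
  refine Nat.floor_le_of_le ?_
  exact mul_le_of_le_one_right (Nat.cast_nonneg n) (tau_le_one hM D)

/-- The statistic is the functional w ↦ w₁(τ) + w₂(1) - w₂(τ) of the bivariate partial sum path
along `center`. It is continuous because evaluation at a point is continuous for the uniform
topology. -/
lemma tendsto_linearStat_of_ne_top (hM : M.Standing P) (hch : M.ChangeAssumption P)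
    (hpost : M.StoppingAssumption P σ σs D) (hthr : M.ThresholdAssumption P) (hD : D ≠ ⊤) :
    TendstoInDistribution (linearStat P M D) atTop (fun x : ℝ => x) (fun _ => P)
      (gaussianReal 0 (limitVariance M.lam σ σs D)) := by
  rw [tendstoInDistribution_iff_integral hM.measurable_linearStat measurable_id']
  intro φ
  obtain ⟨-, -, hstat, hclt⟩ := hpost.veryEarly hD
  obtain ⟨Ω', _, Q, _, W, hW, hF⟩ := hclt _ (hthr.tendsto_center hch)
  set τ : Set.Icc (0 : ℝ) 1 := ⟨tau M.lam D, tau_nonneg hM D, tau_le_one hM D⟩ with hτ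
  have hev : ∀ t : Set.Icc (0 : ℝ) 1,
      Continuous fun w : Set.Icc (0 : ℝ) 1 →ᵤ ℝ × ℝ => UniformFun.toFun w t := fun t =>
    (UniformFun.uniformContinuous_eval (ℝ × ℝ) t).continuous
  have hcont : Continuous fun w : Set.Icc (0 : ℝ) 1 →ᵤ ℝ × ℝ =>
      (UniformFun.toFun w τ).1 + ((UniformFun.toFun w 1).2 - (UniformFun.toFun w τ).2) :=
    (continuous_fst.comp (hev τ)).add
      ((continuous_snd.comp (hev 1)).sub (continuous_snd.comp (hev τ)))
  have hlim := hF (φ.compContinuous ⟨_, hcont⟩)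
  obtain ⟨hae, hmap⟩ := hW.map_eq_gaussianReal τ (coe_limitVariance hM.lam_pos σ σs hD)
  have hR : ∫ ω, (φ.compContinuous ⟨_, hcont⟩) (UniformFun.ofFun fun t => W t ω) ∂Q
      = ∫ x, φ x ∂(gaussianReal 0 (limitVariance M.lam σ σs D)) := by
    rw [← hmap, integral_map hae φ.continuous.measurable.aestronglyMeasurable]
    rfl
  rw [hR] at hlim
  refine hlim.congr' ?_
  filter_upwards [eventually_ge_atTop 1] with m hm
  set n := center P M m with hn
  set e := ⌊(n : ℝ) * tau M.lam D⌋₊ with he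
  have hen : e ≤ n := floor_mul_tau_le hM n
  -- the functional of the stationary bivariate series
  set Ψ : (ℕ → ℝ × ℝ) → ℝ := fun x => φ ((√(n : ℝ))⁻¹ *
    (∑ j ∈ Finset.Icc 1 e, M.h2 P (x j).1 + ∑ j ∈ Finset.Icc (e + 1) n, M.h2Star P m (x j).2))
    with hΨ
  have hΨm : Measurable Ψ := by
    refine φ.continuous.measurable.comp (Measurable.const_mul (Measurable.add ?_ ?_) _)
    · exact Finset.measurable_sum _ fun j _ =>
        hM.measurable_h2.comp (measurable_fst.comp (measurable_pi_apply j))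
    · exact Finset.measurable_sum _ fun j _ =>
        (hM.measurable_h2Star m).comp (measurable_snd.comp (measurable_pi_apply j))
  -- The functional limit theorem concerns sums from index 1, the statistic sums from m + 1. Joint
  -- stationarity of Y and Z is needed, because the functional involves both series.
  have hid := ((hstat m hm m).comp hΨm).integral_eq
  have e1 : ∀ ω, φ (linearStat P M D m ω) = Ψ fun i => (M.Y (i + m) ω, M.Z m (i + m) ω) := by
    intro ω
    simp only [hΨ, linearStat, ← hn, ← he]
    rw [sum_Icc_shift _ m e n]
    have := sum_Icc_shift (fun j => M.h2 P (M.Y j ω)) m 0 e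
    simp only [add_zero, zero_add] at this
    rw [this]
  have e2 : ∀ ω, (φ.compContinuous ⟨_, hcont⟩)
      (partialSumPath n fun j => (M.h2 P (M.Y j ω), M.h2Star P m (M.Z m j ω)))
      = Ψ fun i => (M.Y i ω, M.Z m i ω) := by
    intro ω
    have hsplit := sum_Icc_split (fun j => M.h2Star P m (M.Z m j ω)) (Nat.zero_le e) hen
    simp only [zero_add] at hsplit
    simp only [hΨ, BoundedContinuousFunction.compContinuous_apply, ContinuousMap.coe_mk,
      partialSumPath, UniformFun.toFun_ofFun, Set.Icc.coe_one, mul_one, Nat.floor_natCast,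
      Prod.smul_fst, Prod.smul_snd, Prod.fst_sum, Prod.snd_sum, smul_eq_mul, hτ, ← he, hsplit]
    congr 1
    ring
  simp only [e1, e2]
  exact hid.symm

/-- Here τ = 1, so the sum after the change is empty and only the univariate limit theorem for
h_2(Y) and stationarity of Y are needed. -/
lemma tendsto_linearStat_of_eq_top (hM : M.Standing P) (hch : M.ChangeAssumption P)
    (hpost : M.StoppingAssumption P σ σs D) (hthr : M.ThresholdAssumption P) (hD : D = ⊤) :
    TendstoInDistribution (linearStat P M D) atTop (fun x : ℝ => x) (fun _ => P)
      (gaussianReal 0 (limitVariance M.lam σ σs D)) := by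
  have hv : limitVariance M.lam σ σs D = σ ^ 2 := by
    rw [limitVariance, if_pos hD, if_neg (by simp [hD])]
  obtain ⟨-, hclt, -⟩ := hpost.later hD
  have h := hclt _ (hthr.tendsto_center hch)
  have hms : ∀ m, Measurable fun ω =>
      (√(center P M m : ℝ))⁻¹ * ∑ j ∈ Finset.Icc 1 (center P M m), M.h2 P (M.Y j ω) := fun m =>
    (Finset.measurable_sum _ fun j _ => hM.measurable_h2.comp (hM.measurable_Y j)).const_mul _
  rw [tendstoInDistribution_iff_integral hms measurable_id'] at h
  rw [hv, tendstoInDistribution_iff_integral hM.measurable_linearStat measurable_id']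
  intro φ
  refine (h φ).congr fun m => ?_
  set n := center P M m with hn
  set Ψ : (ℕ → ℝ) → ℝ := fun x => φ ((√(n : ℝ))⁻¹ * ∑ j ∈ Finset.Icc 1 n, M.h2 P (x j)) with hΨ
  have hΨm : Measurable Ψ :=
    φ.continuous.measurable.comp ((Finset.measurable_sum _ fun j _ =>
      hM.measurable_h2.comp (measurable_pi_apply j)).const_mul _)
  have hid := ((hM.stationary_Y m).comp hΨm).integral_eq
  have e1 : ∀ ω, φ (linearStat P M D m ω) = Ψ fun i => M.Y (i + m) ω := by
    intro ω
    simp only [hΨ, linearStat, ← hn, tau, if_pos hD, mul_one, Nat.floor_natCast]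
    have := sum_Icc_shift (fun j => M.h2 P (M.Y j ω)) m 0 n
    simp only [add_zero, zero_add] at this
    rw [this, Finset.Icc_eq_empty (by omega : ¬ m + n + 1 ≤ m + n)]
    simp
  simp only [e1]
  exact hid.symm

theorem tendsto_linearStat (hM : M.Standing P) (hch : M.ChangeAssumption P)
    (hpost : M.StoppingAssumption P σ σs D) (hthr : M.ThresholdAssumption P) :
    TendstoInDistribution (linearStat P M D) atTop (fun x : ℝ => x) (fun _ => P)
      (gaussianReal 0 (limitVariance M.lam σ σs D)) := by
  by_cases hD : D = ⊤
  · exact tendsto_linearStat_of_eq_top hM hch hpost hthr hD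
  · exact tendsto_linearStat_of_ne_top hM hch hpost hthr hD

omit [IsProbabilityMeasure P] in
lemma ThresholdAssumption.tendsto_center_div (hthr : M.ThresholdAssumption P)
    (hch : M.ChangeAssumption P) :
    Tendsto (fun m => (center P M m : ℝ) / M.a P m 0 0) atTop (𝓝 1) :=
  (tendsto_nat_floor_div_atTop (R := ℝ)).comp (hthr.tendsto_a hch)

/-- Distance of the change point to its asymptotic position, inflated so as to diverge. -/
noncomputable def changeGap (P : Measure Ω) (M : Model Ω) (D : ℝ≥0∞) (m : ℕ) : ℕ :=
  (M.kstar m - ⌊(center P M m : ℝ) * tau M.lam D⌋₊)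
    + (⌊(center P M m : ℝ) * tau M.lam D⌋₊ - M.kstar m) + ⌊√(M.a P m 0 0)⌋₊

omit [IsProbabilityMeasure P] in
lemma ThresholdAssumption.tendsto_changeGap (hthr : M.ThresholdAssumption P)
    (hch : M.ChangeAssumption P) : Tendsto (changeGap P M D) atTop atTop :=
  tendsto_atTop_mono (fun _ => Nat.le_add_left _ _)
    (tendsto_nat_floor_atTop.comp (hthr.tendsto_sqrt_a hch))

/-- Both k* and ⌊nτ⌋ with n the centre are τ a_m + o(a_m), and the inflation √a_m is o(a_m) too. -/
lemma ThresholdAssumption.tendsto_changeGap_div (hthr : M.ThresholdAssumption P)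
    (hch : M.ChangeAssumption P) (hM : M.Standing P) (hpost : M.StoppingAssumption P σ σs D) :
    Tendsto (fun m => (changeGap P M D m : ℝ) / M.a P m 0 0) atTop (𝓝 0) := by
  have h1 := hthr.tendsto_kstar_div_a hch hM hpost.limit_D
  have h2 : Tendsto (fun m => (⌊(center P M m : ℝ) * tau M.lam D⌋₊ : ℝ) / M.a P m 0 0) atTop
      (𝓝 (tau M.lam D)) := by
    have h3 := (tendsto_nat_floor_mul_div_atTop (R := ℝ) (tau_nonneg hM D)).comp
      ((tendsto_natCast_atTop_atTop (R := ℝ)).comp (hthr.tendsto_center hch))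
    have h4 := h3.mul (hthr.tendsto_center_div hch)
    rw [mul_one] at h4
    refine h4.congr' ?_
    filter_upwards [(hthr.tendsto_center hch).eventually_ge_atTop 1] with m hm
    have : (0 : ℝ) < center P M m := by exact_mod_cast hm
    simp only [Function.comp, mul_comm (tau M.lam D)]
    field_simp
  have h5 : Tendsto (fun m => √(M.a P m 0 0) / M.a P m 0 0) atTop (𝓝 0) := by
    refine (hthr.tendsto_sqrt_a hch).inv_tendsto_atTop.congr fun m => ?_
    simp [Real.sqrt_div_self]
  have h6 := (h1.sub h2).abs.add h5
  simp only [sub_self, abs_zero, add_zero] at h6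
  refine tendsto_of_tendsto_of_tendsto_of_le_of_le' tendsto_const_nhds h6 ?_ ?_
  · filter_upwards [(hthr.tendsto_a hch).eventually_gt_atTop 0] with m h
    positivity
  filter_upwards [(hthr.tendsto_a hch).eventually_gt_atTop 0] with m h
  rw [← sub_div, abs_div, abs_of_pos h, ← add_div]
  gcongr
  unfold changeGap
  have h7 := Nat.floor_le (Real.sqrt_nonneg (M.a P m 0 0))
  set K := M.kstar m
  set e := ⌊(center P M m : ℝ) * tau M.lam D⌋₊
  push_cast
  refine add_le_add ?_ h7
  -- One of the two truncated differences is zero, so their sum is the distance of K and e.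
  rcases le_total K e with hKe | hKe
  · rw [Nat.sub_eq_zero_of_le hKe, Nat.cast_sub hKe, abs_sub_comm]
    simpa using le_abs_self ((e : ℝ) - K)
  · rw [Nat.sub_eq_zero_of_le hKe, Nat.cast_sub hKe]
    simpa using le_abs_self ((K : ℝ) - e)

/-- Moving the index at which the summand switches from f to g alters only the terms between the two
switching points. -/
lemma abs_sum_add_sum_sub_le (f g : ℕ → ℝ) {m K e n L : ℕ} (hK : K ≤ n) (he : e ≤ n)
    (hL : K - e + (e - K) ≤ L) :
    |(∑ j ∈ Finset.Icc (m + 1) (m + e), f j + ∑ j ∈ Finset.Icc (m + e + 1) (m + n), g j)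
      - (∑ j ∈ Finset.Icc (m + 1) (m + K), f j + ∑ j ∈ Finset.Icc (m + K + 1) (m + n), g j)|
      ≤ windowMax f (m + min K e) L + windowMax g (m + min K e) L := by
  rcases le_total K e with h | h
  · rw [min_eq_left h]
    have e1 := sum_Icc_split f (show m ≤ m + K by omega) (show m + K ≤ m + e by omega)
    have e2 := sum_Icc_split g (show m + K ≤ m + e by omega) (show m + e ≤ m + n by omega)
    have b1 := abs_sum_le_windowMax f (s := m + K) (k := m + e) (L := L) (by omega)
    have b2 := abs_sum_le_windowMax g (s := m + K) (k := m + e) (L := L) (by omega)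
    rw [e1, e2]
    rw [abs_le] at *
    constructor <;> linarith [b1.1, b1.2, b2.1, b2.2]
  · rw [min_eq_right h]
    have e1 := sum_Icc_split f (show m ≤ m + e by omega) (show m + e ≤ m + K by omega)
    have e2 := sum_Icc_split g (show m + e ≤ m + K by omega) (show m + K ≤ m + n by omega)
    have b1 := abs_sum_le_windowMax f (s := m + e) (k := m + K) (L := L) (by omega)
    have b2 := abs_sum_le_windowMax g (s := m + e) (k := m + K) (L := L) (by omega)
    rw [e1, e2]
    rw [abs_le] at *
    constructor <;> linarith [b1.1, b1.2, b2.1, b2.2]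

/-- The noise term is asymptotically equivalent to the linear statistic, up to sign. -/
lemma vanish_linearStat_sub_noise (hM : M.Standing P) (hch : M.ChangeAssumption P)
    (hreg : M.RegularityAssumption P) (hpost : M.StoppingAssumption P σ σs D)
    (hthr : M.ThresholdAssumption P) :
    VanishInProb P fun m ω =>
      -Real.sign (M.Delta P m) * linearStat P M D m ω - noise P M m ω := by
  have hc := hthr.tendsto_center hch
  have hg := hthr.tendsto_changeGap hch (D := D)
  have hga := hthr.tendsto_changeGap_div hch hM hpost
  -- the linear statistic is stochastically bounded
  have hB : BoundedInProb P (linearStat P M D) := by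
    refine ((hreg.boundedInProb_windowMax hM hc fun m => m).add
      (hpost.boundedInProb_windowMax hM hc
        fun m => m + ⌊(center P M m : ℝ) * tau M.lam D⌋₊)).mono (Eventually.of_forall fun m ω => ?_)
    rw [linearStat, ← mul_add, abs_mul, abs_mul]
    have b1 := abs_sum_le_windowMax (fun j => M.h2 P (M.Y j ω))
      (Nat.add_le_add_left (floor_mul_tau_le (D := D) hM (center P M m)) m)
    have b2 := abs_sum_le_windowMax (fun j => M.h2Star P m (M.Z m j ω))
      (s := m + ⌊(center P M m : ℝ) * tau M.lam D⌋₊) (k := m + center P M m)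
      (L := center P M m) (by omega)
    exact mul_le_mul_of_nonneg_left
      (((abs_add_le _ _).trans (add_le_add b1 b2)).trans (le_abs_self _)) (abs_nonneg _)
  have hscale : Tendsto (fun m => √((center P M m : ℝ) / M.a P m 0 0) - 1) atTop (𝓝 0) := by
    have := ((Real.continuous_sqrt.tendsto _).comp (hthr.tendsto_center_div hch)).sub_const 1
    simpa [Function.comp_def] using this
  have h1 := hB.vanish_mul hscale
  have h2 := vanish_of_window hg (hreg.boundedInProb_windowMax hM hg fun m =>
    m + min (M.kstar m) ⌊(center P M m : ℝ) * tau M.lam D⌋₊) hga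
  have h3 := vanish_of_window hg (hpost.boundedInProb_windowMax hM hg fun m =>
    m + min (M.kstar m) ⌊(center P M m : ℝ) * tau M.lam D⌋₊) hga
  intro η hη
  have h4 := ((h1 (η / 3) (by positivity)).add (h2 (η / 3) (by positivity))).add
    (h3 (η / 3) (by positivity))
  simp only [add_zero] at h4
  refine tendsto_of_tendsto_of_tendsto_of_le_of_le' tendsto_const_nhds h4
    (Eventually.of_forall fun _ => zero_le) ?_
  filter_upwards [hthr.eventually_kstar_lt_center hch hM,
    (hthr.tendsto_a hch).eventually_gt_atTop 0, hc.eventually_ge_atTop 1] with m hK ha hc1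
  refine le_trans (measure_mono ?_) ((measure_union_le _ _).trans
    (add_le_add_left (measure_union_le _ _) _))
  intro ω (hω : η < _)
  by_contra hcon
  simp only [Set.mem_union, Set.mem_ofPred_eq, not_or, not_lt] at hcon
  obtain ⟨⟨g1, g2⟩, g3⟩ := hcon
  have hsa := Real.sqrt_pos.2 ha
  have hsc : 0 < √(center P M m : ℝ) := Real.sqrt_pos.2 (by exact_mod_cast hc1)
  have key := abs_sum_add_sum_sub_le (fun j => M.h2 P (M.Y j ω))
    (fun j => M.h2Star P m (M.Z m j ω)) (m := m) (L := changeGap P M D m) hK.le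
    (floor_mul_tau_le (D := D) hM (center P M m)) (Nat.le_add_right _ _)
  set n := center P M m with hn
  set e := ⌊(n : ℝ) * tau M.lam D⌋₊ with he
  set B := ∑ j ∈ Finset.Icc (m + 1) (m + e), M.h2 P (M.Y j ω)
      + ∑ j ∈ Finset.Icc (m + e + 1) (m + n), M.h2Star P m (M.Z m j ω) with hBdef
  set T := M.preSum P m ω + M.postSum P m n ω with hT
  have hlin : linearStat P M D m ω = (√(n : ℝ))⁻¹ * B := rfl
  -- Two errors are separated: the normalization √n against √a_m, a vanishing factor times a bounded
  -- statistic, and the switching point nτ against k*, controlled by window maxima over the gap.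
  have e1 : -Real.sign (M.Delta P m) * linearStat P M D m ω - noise P M m ω
      = Real.sign (M.Delta P m) * ((√((n : ℝ) / M.a P m 0 0) - 1) * linearStat P M D m ω
        - (√(M.a P m 0 0))⁻¹ * (B - T)) := by
    rw [hlin, noise, ← hn, ← hT, Real.sqrt_div (Nat.cast_nonneg n)]
    field_simp
    ring
  rw [e1] at hω
  have h5 := hω.trans_le (abs_sign_mul_le _ _)
  have h6 := abs_sub ((√((n : ℝ) / M.a P m 0 0) - 1) * linearStat P M D m ω)
    ((√(M.a P m 0 0))⁻¹ * (B - T))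
  have h7 : |(√(M.a P m 0 0))⁻¹ * (B - T)| ≤ 2 * (η / 3) := by
    rw [abs_mul, abs_of_pos (inv_pos.2 hsa)]
    have h8 : (√(M.a P m 0 0))⁻¹ * |B - T| ≤ (√(M.a P m 0 0))⁻¹ *
        (windowMax (fun j => M.h2 P (M.Y j ω)) (m + min (M.kstar m) e) (changeGap P M D m)
        + windowMax (fun j => M.h2Star P m (M.Z m j ω)) (m + min (M.kstar m) e)
          (changeGap P M D m)) := by
      gcongr
      exact key
    rw [mul_add] at h8
    linarith [(le_abs_self _).trans g2, (le_abs_self _).trans g3]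
  linarith

omit [IsProbabilityMeasure P] in
lemma Standing.measurable_a {s t : Ω → ℝ} (hs : Measurable s) (ht : Measurable t) (m : ℕ) :
    Measurable fun ω => M.a P m (s ω) (t ω) := by
  unfold Model.a
  fun_prop

end Model

end SeqUStat

theorem mainTheorem4 {Ω : Type*} [MeasurableSpace Ω] (P : Measure Ω) [IsProbabilityMeasure P]
    (M : SeqUStat.Model Ω) (σ σs : ℝ≥0) (D : ℝ≥0∞)
    (hM : M.Standing P)
    (hchange : M.ChangeAssumption P)
    (hreg : M.RegularityAssumption P)
    (hindep : M.IndependenceAssumption P)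
    (hpost : M.StoppingAssumption P σ σs D)
    (hthr : M.ThresholdAssumption P) :
    M.DelayTendstoNormal P (fun m ω => M.a P m (M.S1 P m ω) (M.S1Star P m ω))
        (SeqUStat.limitVariance M.lam σ σs D) ∧
    (M.NotTooLate P →
      M.DelayTendstoNormal P (fun m ω => M.a P m (M.S1 P m ω) 0)
        (SeqUStat.limitVariance M.lam σ σs D)) ∧
    (M.beta ≤ 1 → M.NotTooLate P) ∧
    (1 < M.beta → (M.NotTooLate P ↔
      Tendsto (fun m : ℕ => M.c m * (m : ℝ) ^ (M.beta / 2 - 1) / |M.Delta P m|) atTop (𝓝 0))) ∧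
    (M.beta < 1 →
      M.DelayTendstoNormal P (fun m _ => M.a P m 0 0)
        (SeqUStat.limitVariance M.lam σ σs D)) := by
  have hU := SeqUStat.tendstoInDistribution_sign_mul hM.measurable_linearStat
    (SeqUStat.Model.tendsto_linearStat hM hchange hpost hthr)
    (s := fun m => -Real.sign (M.Delta P m)) (by
      filter_upwards [hthr.eventually_pos hchange] with m ⟨_, _, _, h4, _⟩
      rcases Real.sign_apply_eq_of_ne_zero _ h4 with h | h <;> simp [h])
  have h0 : ∀ A : ℕ → Ω → ℝ,
      SeqUStat.VanishInProb P fun m ω => (A m ω - A m ω) / M.b P m 0 0 := by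
    intro A η hη
    simp [hη.not_gt]
  have hmS := fun m => hM.measurable_S1 m
  have hmS' := fun m => hM.measurable_S1Star m
  -- The centring stays as it is; only the noise is exchanged for the signed linear statistic, whose
  -- limit law is `hU`. Parts (b) and (c) then change the centring alone.
  have hA := (SeqUStat.Model.delayApprox_a hM hchange hreg hpost hthr).of_vanish (h0 _)
    (SeqUStat.Model.vanish_linearStat_sub_noise hM hchange hreg hpost hthr)
  have hzero : ∀ A : ℕ → Ω → ℝ, SeqUStat.VanishInProb P fun m ω => A m ω - A m ω := by
    intro A η hη
    simp [hη.not_gt]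
  have hA1 := fun hN => hA.of_vanish (hthr.vanish_a_sub_a_zero_right hM hchange hN) (hzero _)
  refine ⟨hA.delayTendstoNormal hM (fun m => SeqUStat.Model.Standing.measurable_a (hmS m) (hmS' m) m)
      hU, fun hN => (hA1 hN).delayTendstoNormal hM
        (fun m => SeqUStat.Model.Standing.measurable_a (hmS m) measurable_const m) hU,
    hchange.notTooLate_of_le_one, SeqUStat.Model.notTooLate_iff_of_one_lt, fun hβ => ?_⟩
  exact ((hA1 (hchange.notTooLate_of_le_one hβ.le)).of_vanish
    (hthr.vanish_a_sub_a_zero_zero hM hchange hβ) (hzero _)).delayTendstoNormal hM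
      (fun m => measurable_const) hU
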